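/- Let $\vec v_1,\dots,\vec v_4$ be pairwise non-collinear unit vectors of the Euclidean plane, let $a_1,\dots,a_4\ge 1$ be integers, and let $D=\{\sum_k\lambda_k\vec v_k : 0\le\lambda_k\le a_k\}$. A rhombus tiling of $D$ is a set of translates of the rhombi $\{\lambda\vec v_i+\mu\vec v_j : 0\le\lambda,\mu\le1\}$ ($i<j$) with union $D$, any two distinct ones of which intersect in the empty set, a common vertex or a common entire edge. A flip rotates by $180^\circ$ a hexagon formed by three tiles; the flip-distance of two tilings is the minimal number of flips that transform one into the other ($\infty$ if there is no such sequence of flips). A $\vec v_i$-directed ribbon of a tiling is an inclusion-maximal sequence of tiles, each adjacent to the next one by an edge parallel to $\vec v_i$. The pseudoline $\ell$ of the ribbon is the curve that joins the midpoints of its consecutive edges parallel to $\vec v_i$; its sides are $\ell_\pm=\{y\pm\lambda\vec v_i\in D : y\in\ell,\ \lambda>0\}$. The pseudolines of the $\vec v_i$-directed ribbons form the $i$-th bundle; they are numbered in the order in which, along $\vec v_i$, they cross a side of $D$ parallel to $\vec v_i$, and pseudolines of two tilings of $D$ are identified if they have the same bundle and number. A triangle is a triple $(p,q,r)$ of pairwise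 crossing pseudolines from bundles $i<j<k$. In a given tiling it is positive if $p\cap q\in r_+$ and negative otherwise; and its region is the set of points of $D$ that lie, for each of the three pseudolines, on it or on the same side of it as the crossing point of the other two. A triangle is inclusion-minimal in a tiling if its region there contains no region of another triangle as a proper subset. The Hamming-distance of two tilings is the number of triangles that have different signs in them. Then, for any two distinct rhombus tilings $T\neq T'$ of $D$, each of $T$ and $T'$ has a triangle that is inclusion-minimal in it and has different signs in $T$ and $T'$. Moreover, for any two rhombus tilings of $D$, the flip-distance is finite and equals the Hamming-distance. -/

import Mathlib

open scoped BigOperators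

noncomputable section

/-- The Euclidean plane. -/
abbrev Plane : Type := EuclideanSpace ℝ (Fin 2)

namespace RhombusTiling

variable {n : ℕ}

/-- The zonotope `(a 0, …, a (n-1))` spanned by the vectors `v`: all points `∑ k, c k • v k`
with `0 ≤ c k ≤ a k` for every `k`. -/
def zonotope (v : Fin n → Plane) (a : Fin n → ℕ) : Set Plane :=
  {x | ∃ c : Fin n → ℝ, (∀ k, 0 ≤ c k ∧ c k ≤ (a k : ℝ)) ∧ x = ∑ k, c k • v k}

/-- A translated rhombus tile, recorded by its translation vector `base` and by the
indices `i < j` of the two vectors that span it. -/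
@[ext]
structure Tile (n : ℕ) where
  base : Plane
  i : Fin n
  j : Fin n
  lt : i < j

/-- The closed rhombus `base + {s • v i + t • v j | 0 ≤ s, t ≤ 1}`. -/
def Tile.carrier (v : Fin n → Plane) (t : Tile n) : Set Plane :=
  {x | ∃ r s : ℝ, 0 ≤ r ∧ r ≤ 1 ∧ 0 ≤ s ∧ s ≤ 1 ∧ x = t.base + r • v t.i + s • v t.j}

/-- The four vertices of a tile. -/
def Tile.vertices (v : Fin n → Plane) (t : Tile n) : Set Plane :=
  {t.base, t.base + v t.i, t.base + v t.j, t.base + v t.i + v t.j}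

/-- The four edges of a tile. The pair `(b, k)` stands for the segment from `b` to `b + v k`. -/
def Tile.edges (v : Fin n → Plane) (t : Tile n) : Set (Plane × Fin n) :=
  {(t.base, t.i), (t.base + v t.j, t.i), (t.base, t.j), (t.base + v t.i, t.j)}

/-- The segment that the pair `(b, k)` stands for. -/
def edgeCarrier (v : Fin n → Plane) (e : Plane × Fin n) : Set Plane :=
  segment ℝ e.1 (e.1 + v e.2)

/-- The rhombus tilings of the zonotope: sets of tiles whose union is the zonotope, any two
distinct tiles meeting in nothing, in a common vertex or in a common entire edge. -/
@[ext]
structure Tiling (v : Fin n → Plane) (a : Fin n → ℕ) where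
  tiles : Set (Tile n)
  covers : ⋃ t ∈ tiles, t.carrier v = zonotope v a
  meets : ∀ s ∈ tiles, ∀ t ∈ tiles, s ≠ t →
    s.carrier v ∩ t.carrier v = ∅ ∨
    (∃ x ∈ s.vertices v ∩ t.vertices v, s.carrier v ∩ t.carrier v = {x}) ∨
    (∃ e ∈ s.edges v ∩ t.edges v, s.carrier v ∩ t.carrier v = edgeCarrier v e)

/-! ### Flips -/

/-- The hexagon `q + {r • v i + s • v j + t • v k | 0 ≤ r, s, t ≤ 1}`. -/
def hexagon (v : Fin n → Plane) (q : Plane) (i j k : Fin n) : Set Plane :=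
  {x | ∃ r s t : ℝ, 0 ≤ r ∧ r ≤ 1 ∧ 0 ≤ s ∧ s ≤ 1 ∧ 0 ≤ t ∧ t ≤ 1 ∧
    x = q + r • v i + s • v j + t • v k}

/-- The image of a tile under the rotation by `180` degrees around the point `c`, that is,
under `x ↦ 2 • c - x`. -/
def Tile.rotate (v : Fin n → Plane) (c : Plane) (t : Tile n) : Tile n where
  base := (2 : ℝ) • c - (t.base + v t.i + v t.j)
  i := t.i
  j := t.j
  lt := t.lt

/-- `T'` arises from `T` by one flip: three tiles of `T` form a hexagon, which is rotated by
`180` degrees (around its centre). -/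
def IsFlip {v : Fin n → Plane} {a : Fin n → ℕ} (T T' : Tiling v a) : Prop :=
  ∃ (i j k : Fin n) (hij : i < j) (hjk : j < k) (q p₁ p₂ p₃ : Plane),
    let t₁ : Tile n := ⟨p₁, i, j, hij⟩
    let t₂ : Tile n := ⟨p₂, i, k, hij.trans hjk⟩
    let t₃ : Tile n := ⟨p₃, j, k, hjk⟩
    let c : Plane := q + (1 / 2 : ℝ) • (v i + v j + v k)
    t₁ ∈ T.tiles ∧ t₂ ∈ T.tiles ∧ t₃ ∈ T.tiles ∧
    t₁.carrier v ∪ t₂.carrier v ∪ t₃.carrier v = hexagon v q i j k ∧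
    T'.tiles = (T.tiles \ {t₁, t₂, t₃}) ∪ {t₁.rotate v c, t₂.rotate v c, t₃.rotate v c}

/-- The rhombus tiling space: the undirected graph on the tilings, two of them being joined
by an edge if they differ by a flip. -/
def tilingSpace (v : Fin n → Plane) (a : Fin n → ℕ) : SimpleGraph (Tiling v a) :=
  SimpleGraph.fromRel IsFlip

/-- The flip-distance: the least number of flips that transform `T` into `T'`
(`⊤` if there is no such sequence of flips). -/
def flipDist {v : Fin n → Plane} {a : Fin n → ℕ} (T T' : Tiling v a) : ℕ∞ :=
  (tilingSpace v a).edist T T'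

/-! ### Ribbons and pseudolines -/

/-- Labels of pseudolines: `⟨i, m⟩` is the `m`-th pseudoline of the `i`-th bundle
(counted from `0`). -/
abbrev Line (a : Fin n → ℕ) : Type := (i : Fin n) × Fin (a i)

/-- Two distinct tiles of `T` are adjacent by an edge parallel to `v i`. -/
def Adjacent {v : Fin n → Plane} {a : Fin n → ℕ} (T : Tiling v a) (i : Fin n)
    (s t : Tile n) : Prop :=
  s ∈ T.tiles ∧ t ∈ T.tiles ∧ s ≠ t ∧ ∃ b : Plane, (b, i) ∈ s.edges v ∧ (b, i) ∈ t.edges v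

/-- The determinant of two vectors of the plane. -/
def cross (x y : Plane) : ℝ := x 0 * y 1 - x 1 * y 0

/-- The zonotope has a side that runs in direction `v i`, from this corner to
this corner plus `a i • v i`: the side on which `cross (v i)` is minimal. -/
def corner (v : Fin n → Plane) (a : Fin n → ℕ) (i : Fin n) : Plane :=
  open scoped Classical in
  ∑ k ∈ Finset.univ.filter (fun k => cross (v i) (v k) < 0), (a k : ℝ) • v k

/-- The unit edge of the boundary of the zonotope at which the pseudoline `l = ⟨i, m⟩` starts:
the `m`-th one (from `0`), in direction `v i`, on a side of the zonotope parallel to `v i`. -/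
def startEdge (v : Fin n → Plane) (a : Fin n → ℕ) (l : Line a) : Plane × Fin n :=
  (corner v a l.1 + (l.2 : ℝ) • v l.1, l.1)

/-- The ribbon in which the pseudoline `l = ⟨i, m⟩` is drawn: the `v i`-directed ribbon through
the `m`-th edge of a side of the zonotope parallel to `v i`. It consists of all tiles that can
be reached from the tile at that edge by passing through edges parallel to `v i`, so it is
an inclusion-maximal sequence of tiles adjacent by such edges. -/
def ribbon {v : Fin n → Plane} {a : Fin n → ℕ} (T : Tiling v a) (l : Line a) : Set (Tile n) :=
  {t | ∃ s ∈ T.tiles, startEdge v a l ∈ s.edges v ∧ Relation.ReflTransGen (Adjacent T l.1) s t}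

/-- The part of a `v i`-directed pseudoline in a tile: the segment that joins the midpoints of
the two edges parallel to `v i`. -/
def midline (v : Fin n → Plane) (i : Fin n) (t : Tile n) : Set Plane :=
  convexHull ℝ {x | ∃ b : Plane, (b, i) ∈ t.edges v ∧ x = b + (1 / 2 : ℝ) • v i}

/-- The pseudoline `l`, drawn through its ribbon by joining the midpoints of the consecutive
edges parallel to `v i`. -/
def curve {v : Fin n → Plane} {a : Fin n → ℕ} (T : Tiling v a) (l : Line a) : Set Plane :=
  ⋃ t ∈ ribbon T l, midline v l.1 t

/-- The side `l_+` of the pseudoline `l` in the zonotope. -/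
def posSide {v : Fin n → Plane} {a : Fin n → ℕ} (T : Tiling v a) (l : Line a) : Set Plane :=
  {x ∈ zonotope v a | ∃ y ∈ curve T l, ∃ c : ℝ, 0 < c ∧ x = y + c • v l.1}

/-- The side `l_-` of the pseudoline `l` in the zonotope. -/
def negSide {v : Fin n → Plane} {a : Fin n → ℕ} (T : Tiling v a) (l : Line a) : Set Plane :=
  {x ∈ zonotope v a | ∃ y ∈ curve T l, ∃ c : ℝ, 0 < c ∧ x = y - c • v l.1}

/-! ### Triangles -/

/-- A triple of pseudolines from three different bundles, in increasing order of bundles. -/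
@[ext]
structure Triple (a : Fin n → ℕ) where
  l₁ : Line a
  l₂ : Line a
  l₃ : Line a
  lt₁₂ : l₁.1 < l₂.1
  lt₂₃ : l₂.1 < l₃.1

/-- The intersection of two pseudolines, in the tiling `T`. -/
def crossing {v : Fin n → Plane} {a : Fin n → ℕ} (T : Tiling v a) (l m : Line a) : Set Plane :=
  curve T l ∩ curve T m

/-- A triangle is a triple of pairwise crossing pseudolines. -/
def IsTriangle {v : Fin n → Plane} {a : Fin n → ℕ} (T : Tiling v a) (t : Triple a) : Prop :=
  (crossing T t.l₁ t.l₂).Nonempty ∧ (crossing T t.l₁ t.l₃).Nonempty ∧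
    (crossing T t.l₂ t.l₃).Nonempty

/-- The sign of a triangle is positive if its first two pseudolines cross on the positive side
of the third one, and negative otherwise. -/
def IsPositive {v : Fin n → Plane} {a : Fin n → ℕ} (T : Tiling v a) (t : Triple a) : Prop :=
  crossing T t.l₁ t.l₂ ⊆ posSide T t.l₃

/-- `t` is a triangle that has different signs in `T` and in `T'`. -/
def IsInverted {v : Fin n → Plane} {a : Fin n → ℕ} (T T' : Tiling v a) (t : Triple a) : Prop :=
  IsTriangle T t ∧ IsTriangle T' t ∧ ¬ (IsPositive T t ↔ IsPositive T' t)

/-- The Hamming-distance: the number of triangles with different signs in the two tilings. -/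
def hammingDist {v : Fin n → Plane} {a : Fin n → ℕ} (T T' : Tiling v a) : ℕ∞ :=
  {t : Triple a | IsInverted T T' t}.encard

/-- The closed side of the pseudoline `l` that contains `X`, for a set `X` on one side of `l`. -/
def closedSide {v : Fin n → Plane} {a : Fin n → ℕ} (T : Tiling v a) (l : Line a)
    (X : Set Plane) : Set Plane :=
  curve T l ∪ {x | (x ∈ posSide T l ∧ X ⊆ posSide T l) ∨ (x ∈ negSide T l ∧ X ⊆ negSide T l)}

/-- The closed region of the plane that the triangle `t` bounds in the tiling `T`: the points
that lie, for each of the three pseudolines, on that pseudoline or on the same side of it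
as the crossing of the two others. -/
def region {v : Fin n → Plane} {a : Fin n → ℕ} (T : Tiling v a) (t : Triple a) : Set Plane :=
  closedSide T t.l₁ (crossing T t.l₂ t.l₃) ∩ closedSide T t.l₂ (crossing T t.l₁ t.l₃) ∩
    closedSide T t.l₃ (crossing T t.l₁ t.l₂)

/-- `t` is an inclusion-minimal triangle of `T`. -/
def IsMinimalTriangle {v : Fin n → Plane} {a : Fin n → ℕ} (T : Tiling v a) (t : Triple a) :
    Prop :=
  IsTriangle T t ∧ ∀ s : Triple a, IsTriangle T s → ¬ region T s ⊂ region T t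

end RhombusTiling

end

/-! A tiling is encoded by the orders `Tiling.Before`: on every pseudoline, the order in which it is
crossed by the pseudolines of other bundles. Two lines of different bundles share exactly one tile
(`exists_cross`, `cross_unique`), so three lines from three bundles always form a triangle, and its
sign amounts to the order of two of them on the third (`isInverted_iff`). The orders determine the
tiling, because the place of a tile in a ribbon is the start of the ribbon plus the vectors of the
lines crossed before (`On.lft_eq`). Hence distinct tilings differ in the sign of some triangle.

The heart is combinatorial: among the inverted triangles there is one that no line crosses
(`IsArr.exists_empty`). Two facts about inversion are used. A line that passes between `a` and `b`
on `l` splits an inverted triple `l`, `a`, `b` into two triples, one of which is inverted; and if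
both parts are inverted, so is the whole. Moreover a triple with two parallel lines is never
inverted. By splitting, there is an inverted triangle one side of which is uncrossed, so that all
lines across it meet the other two sides. If each of them cuts off an inverted triangle at the apex,
the lines nearest to the apex bound an uncrossed inverted one (`exists_empty_of_side`). Otherwise
the offending line is from the fourth bundle and its direction is opposite to one of the three
others in the cyclic order; this leads to another triangle to which the first case applies
(`exists_empty_of_opposite`). Only this part depends on there being four bundles.

An uncrossed triangle is inclusion-minimal, since any crossing inside its region is a crossing of
two of its own sides (`mem_of_inside`). Its three tiles are consecutive on each of the three ribbons
and form a hexagon (`exists_hex_of_uncrossed`). Rotating the hexagon gives a tiling again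
(`exists_flipped`), in which exactly this triangle has changed its sign. So flipping uncrossed
inverted triangles lowers the Hamming-distance by one each time, until the tilings agree.
Conversely, a flip swaps two consecutive tiles in each of three ribbons and inverts at most one
triangle (`on_of_inv_of_hex`), so fewer flips cannot suffice. -/

noncomputable section

/-! ### Abstract arrangements in four bundles, and the axiom of Pasch -/

namespace RhombusTiling

/-- An arrangement of lines in four sorted bundles `β`: `nb l m r` says that `l` crosses `m` before
`r`, and `prec` is the order of the lines in a bundle. -/
structure IsArr {L : Type*} (β : L → Fin 4) (prec : L → L → Prop) (nb : L → L → L → Prop) : Prop where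
  ne : ∀ {l m r}, nb l m r → β m ≠ β l ∧ β r ≠ β l
  irrefl : ∀ l m, ¬ nb l m m
  trans : ∀ {l m n r}, nb l m n → nb l n r → nb l m r
  total : ∀ {l m r}, β m ≠ β l → β r ≠ β l → m ≠ r → nb l m r ∨ nb l r m
  par : ∀ {l m r}, β m = β r → β l ≠ β m → m ≠ r → (nb l m r ↔ (β l < β m ↔ prec m r))
  tri : ∀ {l m r}, β l ≠ β m → β l ≠ β r → β m ≠ β r →
    (nb l r m ↔ (nb m r l ↔ (β l < β r ↔ β m < β r)))

namespace IsArr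
variable {L : Type*} {β : L → Fin 4} {prec : L → L → Prop} {nb : L → L → L → Prop}

/-- On `l`, the line `w` crosses between `a` and `b`. -/
def Bt (nb : L → L → L → Prop) (l a w b : L) : Prop :=
  (nb l a w ∧ nb l w b) ∨ (nb l b w ∧ nb l w a)

theorem Bt.symm {l a w b : L} (h : Bt nb l a w b) : Bt nb l b w a := Or.symm h

theorem asymm (H : IsArr β prec nb) {l m r : L} (h : nb l m r) : ¬ nb l r m :=
  fun h' => H.irrefl _ _ (H.trans h h')

theorem Bt.ne (H : IsArr β prec nb) {l a w b : L} (h : Bt nb l a w b) :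
    β a ≠ β l ∧ β w ≠ β l ∧ β b ≠ β l ∧ a ≠ w ∧ w ≠ b ∧ a ≠ b := by
  have := @IsArr.ne _ _ _ _ H
  have := H.irrefl
  have := @IsArr.asymm _ _ _ _ H
  unfold Bt at h
  grind

theorem not_iff_swap (H : IsArr β prec nb) {l m r : L} (h1 : β m ≠ β l) (h2 : β r ≠ β l)
    (h3 : m ≠ r) : nb l m r ↔ ¬ nb l r m := by
  have := H.total h1 h2 h3
  have := @IsArr.asymm _ _ _ _ H l m r
  tauto


/-- A line of a side's bundle that meets one of the other two sides meets both. -/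
theorem pasch_par (H : IsArr β prec nb) {p q r u : L} (hpq : β p ≠ β q) (hpr : β p ≠ β r)
    (hqr : β q ≠ β r) (hu : β u = β q) (h : Bt nb p q u r) : Bt nb r q u p := by
  obtain ⟨h1, h2, h3, h4, h5, h6⟩ := h.ne H
  have hup : u ≠ p := by rintro rfl; exact h2 rfl
  have hru : β u ≠ β r := hu ▸ hqr
  -- `tri` transports orders between the lines of a triangle and `par` fixes the order of the
  -- parallel lines `q` and `u`; what remains is propositional.
  have e1 := @IsArr.tri _ _ _ _ H r p q hpr.symm hqr.symm hpq
  have e2 := @IsArr.tri _ _ _ _ H r p u hpr.symm hru.symm h2.symm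
  have e3 := @IsArr.par _ _ _ _ H p q u hu.symm hpq h4
  have e4 := @IsArr.par _ _ _ _ H r q u hu.symm hqr.symm h4
  have e5 := H.not_iff_swap h1 h3 h6
  have e6 := H.not_iff_swap h1 h2 h4
  have e7 := H.not_iff_swap h2 h3 h5
  have e8 := H.not_iff_swap hqr hpr (by rintro rfl; exact hpq rfl)
  have e9 := H.not_iff_swap hqr hru h4
  have e10 := H.not_iff_swap hru hpr hup
  rw [hu] at *
  unfold Bt at *
  grind only

/-- A line parallel to one of two lines, that crosses the other one on the other side. -/
theorem par_opposite (H : IsArr β prec nb) {a y x u : L} (hay : β a ≠ β y) (hax : β a ≠ β x)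
    (hyx : β y ≠ β x) (hu : β u = β x) (h : Bt nb a x y u) : Bt nb y x a u := by
  obtain ⟨h1, h2, h3, h4, h5, h6⟩ := h.ne H
  have hyu : β u ≠ β y := hu ▸ hyx.symm
  have hxa : x ≠ a := by rintro rfl; exact hax rfl
  have hua : u ≠ a := by rintro rfl; exact h3 rfl
  have e1 := @IsArr.tri _ _ _ _ H a y x hay hax hyx
  have e2 := @IsArr.tri _ _ _ _ H a y u hay h3.symm hyu.symm
  have e3 := @IsArr.par _ _ _ _ H a x u hu.symm hax h6
  have e4 := @IsArr.par _ _ _ _ H y x u hu.symm hyx h6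
  have e5 := H.not_iff_swap h1 h3 h6
  have e6 := H.not_iff_swap h1 h2 h4
  have e7 := H.not_iff_swap h2 h3 h5
  have e8 := H.not_iff_swap hyx.symm hay hxa
  have e9 := H.not_iff_swap hyx.symm hyu h6
  have e10 := H.not_iff_swap hyu hay hua
  rw [hu] at *
  unfold Bt at *
  grind only

/-- In the sorted case, the position of four lines is given by four signs. -/
theorem sign_data (H : IsArr β prec nb) {p q r : L} (hpq : β p < β q) (hqr : β q < β r) :
    (nb p q r ↔ nb q p r) ∧ (nb p q r ↔ nb r p q) ∧ (nb p r q ↔ ¬ nb p q r) ∧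
    (nb q r p ↔ ¬ nb p q r) ∧ (nb r q p ↔ ¬ nb p q r) := by
  have hpr := hpq.trans hqr
  have n1 : p ≠ q := by rintro rfl; exact lt_irrefl _ hpq
  have n2 : q ≠ r := by rintro rfl; exact lt_irrefl _ hqr
  have n3 : p ≠ r := by rintro rfl; exact lt_irrefl _ hpr
  have e1 := @IsArr.tri _ _ _ _ H p q r hpq.ne hpr.ne hqr.ne
  have e2 := @IsArr.tri _ _ _ _ H p r q hpr.ne hpq.ne hqr.ne'
  have e3 := @IsArr.tri _ _ _ _ H q r p hqr.ne hpq.ne' hpr.ne'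
  have e5 := H.not_iff_swap hpq.ne' hpr.ne' n2
  have e6 := H.not_iff_swap hpq.ne hqr.ne' n3
  have e7 := H.not_iff_swap hpr.ne hqr.ne n1
  have a1 : β p < β r ↔ β q < β r := iff_of_true hpr hqr
  have a2 : ¬ (β p < β q ↔ β r < β q) := by simp [hpq, hqr.le]
  have a3 : (β q < β p ↔ β r < β p) := iff_of_false hpq.not_gt hpr.not_gt
  grind only

/-- Transitivity on each of the four lines. In the sequence of the signs of `pqr`, `pqs`, `prs`,
`qrs`, no three entries alternate, so it changes at most once: this is the signotope condition. -/
theorem quad_data (H : IsArr β prec nb) {p q r s : L} (hpq : β p < β q) (hqr : β q < β r)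
    (hrs : β r < β s) :
   ¬ (nb p q r ∧ ¬ nb p q s ∧ nb p r s) ∧ ¬ (¬ nb p q r ∧ nb p q s ∧ ¬ nb p r s) ∧ 
   ¬ (nb p q r ∧ ¬ nb p q s ∧ nb q r s) ∧ ¬ (¬ nb p q r ∧ nb p q s ∧ ¬ nb q r s) ∧ 
   ¬ (nb p q r ∧ ¬ nb p r s ∧ nb q r s) ∧ ¬ (¬ nb p q r ∧ nb p r s ∧ ¬ nb q r s) ∧ 
   ¬ (nb p q s ∧ ¬ nb p r s ∧ nb q r s) ∧ ¬ (¬ nb p q s ∧ nb p r s ∧ ¬ nb q r s) := by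
  have e1 := H.sign_data hpq hqr
  have e2 := H.sign_data hpq (hqr.trans hrs)
  have e3 := H.sign_data (hpq.trans hqr) hrs
  have e4 := H.sign_data hqr hrs
  have t1 := @IsArr.trans _ _ _ _ H p
  have t2 := @IsArr.trans _ _ _ _ H q
  have t3 := @IsArr.trans _ _ _ _ H r
  have t4 := @IsArr.trans _ _ _ _ H s
  have a1 := @t1 q r s
  have a2 := @t1 q s r
  have a3 := @t1 r s q
  have a4 := @t1 r q s
  have a5 := @t1 s r q
  have a6 := @t1 s q r
  have b1 := @t2 p r s
  have b2 := @t2 p s r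
  have b3 := @t2 r s p
  have b4 := @t2 r p s
  have b5 := @t2 s r p
  have b6 := @t2 s p r
  have c1 := @t3 q p s
  have c2 := @t3 q s p
  have c3 := @t3 p s q
  have c4 := @t3 p q s
  have c5 := @t3 s p q
  have c6 := @t3 s q p
  have d1 := @t4 q r p
  have d2 := @t4 q p r
  have d3 := @t4 r p q
  have d4 := @t4 r q p
  have d5 := @t4 p r q
  have d6 := @t4 p q r
  clear t1 t2 t3 t4
  grind only


/-- The axiom of Pasch for four lines in sorted order. -/
theorem pasch_sorted (H : IsArr β prec nb) {p q r s : L} (hpq : β p < β q) (hqr : β q < β r)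
    (hrs : β r < β s) :
    (Bt nb q r p s → Bt nb r q p s ∨ Bt nb s q p r) ∧
    (Bt nb r q p s → Bt nb q r p s ∨ Bt nb s r p q) ∧
    (Bt nb s q p r → Bt nb q s p r ∨ Bt nb r s p q) ∧
    (Bt nb p r q s → Bt nb r p q s ∨ Bt nb s p q r) ∧
    (Bt nb r p q s → Bt nb p r q s ∨ Bt nb s r q p) ∧
    (Bt nb s p q r → Bt nb p s q r ∨ Bt nb r s q p) ∧
    (Bt nb p q r s → Bt nb q p r s ∨ Bt nb s p r q) ∧
    (Bt nb q p r s → Bt nb p q r s ∨ Bt nb s q r p) ∧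
    (Bt nb s p r q → Bt nb p s r q ∨ Bt nb q s r p) ∧
    (Bt nb p q s r → Bt nb q p s r ∨ Bt nb r p s q) ∧
    (Bt nb q p s r → Bt nb p q s r ∨ Bt nb r q s p) ∧
    (Bt nb r p s q → Bt nb p r s q ∨ Bt nb q r s p) := by
  obtain ⟨e11, e12, e13, e14, e15⟩ := H.sign_data hpq hqr
  obtain ⟨e21, e22, e23, e24, e25⟩ := H.sign_data hpq (hqr.trans hrs)
  obtain ⟨e31, e32, e33, e34, e35⟩ := H.sign_data (hpq.trans hqr) hrs
  obtain ⟨e41, e42, e43, e44, e45⟩ := H.sign_data hqr hrs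
  have e5 := H.quad_data hpq hqr hrs
  unfold Bt
  rw [← e11, ← e12, e13, e14, e15, ← e21, ← e22, e23, e24, e25, ← e31, ← e32, e33, e34, e35,
    ← e41, ← e42, e43, e44, e45]
  clear e11 e12 e13 e14 e15 e21 e22 e23 e24 e25 e31 e32 e33 e34 e35 e41 e42 e43 e44 e45
  generalize nb p q r = A at *
  generalize nb p q s = B at *
  generalize nb p r s = C at *
  generalize nb q r s = D at *
  clear hpq hqr hrs
  -- All betweenness relations are now Boolean expressions in four signs, of which `quad_data`
  -- leaves eight of the sixteen combinations.
  by_cases A <;> by_cases B <;> by_cases C <;> by_cases D <;> simp_all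

/-- Lines of opposite bundles, in sorted order. -/
theorem opposite_sorted (H : IsArr β prec nb) {p q r s : L} (hpq : β p < β q) (hqr : β q < β r)
    (hrs : β r < β s) :
    (Bt nb s q p r → Bt nb r q p s ∧ Bt nb q r s p) ∧
    (Bt nb q s p r → Bt nb r s p q ∧ Bt nb s r q p) ∧
    (Bt nb r p q s → Bt nb s p q r ∧ Bt nb p s r q) ∧
    (Bt nb p r q s → Bt nb s r q p ∧ Bt nb r s p q) ∧
    (Bt nb s q r p → Bt nb p q r s ∧ Bt nb q p s r) ∧
    (Bt nb q s r p → Bt nb p s r q ∧ Bt nb s p q r) ∧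
    (Bt nb r p s q → Bt nb q p s r ∧ Bt nb p q r s) ∧
    (Bt nb p r s q → Bt nb q r s p ∧ Bt nb r q p s) := by
  obtain ⟨e11, e12, e13, e14, e15⟩ := H.sign_data hpq hqr
  obtain ⟨e21, e22, e23, e24, e25⟩ := H.sign_data hpq (hqr.trans hrs)
  obtain ⟨e31, e32, e33, e34, e35⟩ := H.sign_data (hpq.trans hqr) hrs
  obtain ⟨e41, e42, e43, e44, e45⟩ := H.sign_data hqr hrs
  have e5 := H.quad_data hpq hqr hrs
  unfold Bt
  rw [← e11, ← e12, e13, e14, e15, ← e21, ← e22, e23, e24, e25, ← e31, ← e32, e33, e34, e35,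
    ← e41, ← e42, e43, e44, e45]
  clear e11 e12 e13 e14 e15 e21 e22 e23 e24 e25 e31 e32 e33 e34 e35 e41 e42 e43 e44 e45
  generalize nb p q r = A at *
  generalize nb p q s = B at *
  generalize nb p r s = C at *
  generalize nb q r s = D at *
  clear hpq hqr hrs
  by_cases A <;> by_cases B <;> by_cases C <;> by_cases D <;> simp_all

/-- Four lines of distinct bundles exhaust `Fin 4`. So a statement about them follows from its
instances for one line of each rank, by running through the permutations. -/
theorem exists_sorted {p q r u : L} (hpq : β p ≠ β q) (hpr : β p ≠ β r) (hqr : β q ≠ β r)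
    (hup : β u ≠ β p) (huq : β u ≠ β q) (hur : β u ≠ β r) :
    ∃ f : Fin 4 → L, (∀ i, β (f i) = i) ∧ f (β p) = p ∧ f (β q) = q ∧ f (β r) = r ∧
      f (β u) = u := by
  refine ⟨fun i => if i = β p then p else if i = β q then q else if i = β r then r else u,
    fun i => ?_, ?_, ?_, ?_, ?_⟩
  · dsimp only
    split_ifs <;> omega
  all_goals simp [hpq.symm, hpr.symm, hqr.symm, hup, huq, hur]

theorem pasch_four (H : IsArr β prec nb) {p q r u : L} (hpq : β p ≠ β q) (hpr : β p ≠ β r)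
    (hqr : β q ≠ β r) (huq : β u ≠ β q) (hur : β u ≠ β r) (h : Bt nb p q u r) :
    Bt nb q p u r ∨ Bt nb r p u q := by
  have hup := (h.ne H).2.1
  obtain ⟨f, hf, fp, fq, fr, fu⟩ := exists_sorted hpq hpr hqr hup huq hur
  have t := H.pasch_sorted (p := f 0) (q := f 1) (r := f 2) (s := f 3) (by simp [hf])
    (by simp [hf]) (by simp [hf])
  have h' := h.symm
  obtain ⟨i, hi⟩ : ∃ i, β p = i := ⟨_, rfl⟩
  obtain ⟨j, hj⟩ : ∃ i, β q = i := ⟨_, rfl⟩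
  obtain ⟨k, hk⟩ : ∃ i, β r = i := ⟨_, rfl⟩
  obtain ⟨l, hl⟩ : ∃ i, β u = i := ⟨_, rfl⟩
  rw [hi] at fp; rw [hj] at fq; rw [hk] at fr; rw [hl] at fu
  rw [hi, hj] at hpq; rw [hi, hk] at hpr; rw [hj, hk] at hqr; rw [hl, hi] at hup
  rw [hl, hj] at huq; rw [hl, hk] at hur
  subst fp fq fr fu
  clear hi hj hk hl hf
  revert hpq hpr hqr hup huq hur h h'
  obtain ⟨t1, t2, t3, t4, t5, t6, t7, t8, t9, t10, t11, t12⟩ := t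
  fin_cases i <;> fin_cases j <;> simp only [Fin.reduceFinMk, ne_eq, not_true_eq_false,
    IsEmpty.forall_iff, Fin.zero_eta, Fin.isValue, Fin.mk_one, imp_true_iff] <;>
  fin_cases k <;> simp only [Fin.reduceFinMk, ne_eq, not_true_eq_false,
    IsEmpty.forall_iff, Fin.zero_eta, Fin.isValue, Fin.mk_one, imp_true_iff] <;>
  fin_cases l <;> simp only [Fin.reduceFinMk, ne_eq, not_true_eq_false,
    IsEmpty.forall_iff, Fin.zero_eta, Fin.isValue, Fin.mk_one, imp_true_iff] <;>
  intros <;>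
  first
  | exact t1 ‹_› | exact t2 ‹_› | exact t3 ‹_› | exact t4 ‹_› | exact t5 ‹_› | exact t6 ‹_›
  | exact t7 ‹_› | exact t8 ‹_› | exact t9 ‹_› | exact t10 ‹_› | exact t11 ‹_› | exact t12 ‹_›
  | exact (t1 ‹_›).symm | exact (t2 ‹_›).symm | exact (t3 ‹_›).symm | exact (t4 ‹_›).symm
  | exact (t5 ‹_›).symm | exact (t6 ‹_›).symm | exact (t7 ‹_›).symm | exact (t8 ‹_›).symm
  | exact (t9 ‹_›).symm | exact (t10 ‹_›).symm | exact (t11 ‹_›).symm | exact (t12 ‹_›).symm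

/-- In the cyclic order of the four directions, `β x + 2` lies on the arc between `a` and `y` that
avoids `x`. A line of such a direction that crosses the triangle has to meet its side on `x`. So
`z`, which meets the side on `y`, leaves through `x` and crosses `a` beyond `y`. -/
theorem opposite (H : IsArr β prec nb) {a x y z : L} (hax : β a ≠ β x) (hay : β a ≠ β y)
    (hxy : β x ≠ β y) (hz : β z = β x + 2) (hza : β z ≠ β a) (h : Bt nb y a z x) :
    Bt nb x a z y ∧ Bt nb a x y z := by
  have hzy := (h.ne H).2.1
  have hzx : β z ≠ β x := by omega
  obtain ⟨f, hf, fp, fq, fr, fu⟩ := exists_sorted hax hay hxy hza hzx hzy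
  have t := H.opposite_sorted (p := f 0) (q := f 1) (r := f 2) (s := f 3) (by simp [hf])
    (by simp [hf]) (by simp [hf])
  obtain ⟨i, hi⟩ : ∃ i, β a = i := ⟨_, rfl⟩
  obtain ⟨j, hj⟩ : ∃ i, β x = i := ⟨_, rfl⟩
  obtain ⟨k, hk⟩ : ∃ i, β y = i := ⟨_, rfl⟩
  obtain ⟨l, hl⟩ : ∃ i, β z = i := ⟨_, rfl⟩
  rw [hi] at fp; rw [hj] at fq; rw [hk] at fr; rw [hl] at fu
  rw [hl, hj] at hz
  rw [hi, hj] at hax; rw [hi, hk] at hay; rw [hj, hk] at hxy; rw [hl, hi] at hza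
  rw [hl, hj] at hzx; rw [hl, hk] at hzy
  subst fp fq fr fu
  clear hi hj hk hl hf
  subst hz
  revert hax hay hxy hza hzx hzy h
  obtain ⟨t1, t2, t3, t4, t5, t6, t7, t8⟩ := t
  fin_cases i <;> fin_cases j <;> simp only [Fin.reduceFinMk, ne_eq, not_true_eq_false,
    IsEmpty.forall_iff, Fin.zero_eta, Fin.isValue, Fin.mk_one, Fin.reduceAdd, zero_add,
    imp_true_iff] <;>
  fin_cases k <;> simp only [Fin.reduceFinMk, ne_eq, not_true_eq_false,
    IsEmpty.forall_iff, Fin.zero_eta, Fin.isValue, Fin.mk_one, imp_true_iff] <;>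
  intros <;>
  first
  | exact t1 ‹_› | exact t2 ‹_› | exact t3 ‹_› | exact t4 ‹_› | exact t5 ‹_› | exact t6 ‹_›
  | exact t7 ‹_› | exact t8 ‹_›

/-- A line that meets one side of a triangle meets a second one. -/
theorem pasch (H : IsArr β prec nb) {p q r u : L} (hpq : β p ≠ β q) (hpr : β p ≠ β r)
    (hqr : β q ≠ β r) (h : Bt nb p q u r) : Bt nb q p u r ∨ Bt nb r p u q := by
  by_cases huq : β u = β q
  · exact Or.inr (H.pasch_par hpq hpr hqr huq h).symm
  by_cases hur : β u = β r
  · exact Or.inl (H.pasch_par hpr hpq hqr.symm hur h.symm).symm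
  exact H.pasch_four hpq hpr hqr huq hur h
end IsArr
end RhombusTiling

end

/-! ### Existence of an inverted triangle that no line crosses -/

noncomputable section

namespace RhombusTiling
namespace IsArr
variable {L : Type*} {β : L → Fin 4} {prec : L → L → Prop} {nb : L → L → L → Prop}

theorem bt_left (H : IsArr β prec nb) {l a u w b : L} (h1 : Bt nb l a u w) (h2 : Bt nb l a w b) :
    Bt nb l a u b ∧ Bt nb l u w b := by
  have := @IsArr.trans _ _ _ _ H l
  have := H.irrefl l
  unfold Bt at *
  grind

theorem bt_right (H : IsArr β prec nb) {l a u w b : L} (h1 : Bt nb l a w b) (h2 : Bt nb l w u b) :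
    Bt nb l a u b ∧ Bt nb l a w u := by
  have := H.bt_left h2.symm h1.symm
  exact ⟨this.1.symm, this.2.symm⟩

theorem bt_total (H : IsArr β prec nb) {l a u w b : L} (h1 : Bt nb l a w b) (h2 : Bt nb l a u b)
    (h : u ≠ w) : Bt nb l a u w ∨ Bt nb l a w u := by
  have a1 := h1.ne H
  have a2 := h2.ne H
  have := H.total a1.2.1 a2.2.1 h.symm
  have := @IsArr.trans _ _ _ _ H l
  have := H.irrefl l
  unfold Bt at *
  grind

theorem exists_nearest [Finite L] (H : IsArr β prec nb) (P : L → Prop) {l a b w : L} (hw : P w)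
    (h : Bt nb l a w b) : ∃ w, P w ∧ Bt nb l a w b ∧ ∀ u, P u → ¬ Bt nb l a u w := by
  induction hk : {u | Bt nb l a u w}.ncard using Nat.strong_induction_on generalizing w with
  | _ k ih =>
    by_cases hex : ∃ u, P u ∧ Bt nb l a u w
    · obtain ⟨u, hu, hbt⟩ := hex
      refine ih _ ?_ hu (H.bt_left hbt h).1 rfl
      rw [← hk]
      refine Set.ncard_lt_ncard ⟨fun t ht => (H.bt_left ht hbt).1, fun hs => ?_⟩ (Set.toFinite _)
      exact absurd (Bt.ne H (hs hbt : Bt nb l a u u)).2.2.2.2.1 (by simp)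
    · push Not at hex
      exact ⟨w, hw, h, hex⟩

/-- The triples of lines that have different signs in two arrangements: all that is needed of
the second arrangement. -/
structure IsInv (β : L → Fin 4) (nb : L → L → L → Prop) (I : L → L → L → Prop) : Prop where
  ne : ∀ {p q r}, I p q r → β p ≠ β q ∧ β p ≠ β r ∧ β q ≠ β r
  swap₁ : ∀ {p q r}, I p q r → I q p r
  swap₂ : ∀ {p q r}, I p q r → I p r q
  split : ∀ {l a w b}, Bt nb l a w b → I l a b → I l a w ∨ I l w b
  join : ∀ {l a w b}, Bt nb l a w b → I l a w → I l w b → I l a b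

/-- No line crosses the triangle. -/
def Uncrossed (nb : L → L → L → Prop) (p q r : L) : Prop :=
  (∀ u, ¬ Bt nb p q u r) ∧ (∀ u, ¬ Bt nb q p u r) ∧ ∀ u, ¬ Bt nb r p u q

variable {I : L → L → L → Prop}

/-- The line `p` cuts off the corner of `m` and `q` from the triangle `m n q`: it enters through `m`
and, by `h2`, leaves through `q`. A line that crosses `q` between `m` and `p` cannot leave through
`n` either; if it leaves through `m`, it is parallel to `p` by `h3` and so crosses `m` between `p`
and `q`, against `h1`. -/
theorem ear (H : IsArr β prec nb) {m n p q : L} (hmp : β m ≠ β p) (hmn : β m ≠ β n)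
    (hmq : β m ≠ β q) (hpq : β p ≠ β q) (hnq : β n ≠ β q)
    (h1 : ∀ u, ¬ Bt nb m q u p) (h2 : ∀ u, ¬ Bt nb n m u q)
    (h3 : ∀ u, Bt nb m n u q → β u = β p) (h4 : Bt nb m n p q) : Uncrossed nb m p q := by
  have h5 : Bt nb q m p n := by
    rcases H.pasch hmn hmq hnq h4 with h | h
    · exact absurd h (h2 _)
    · exact h
  have h6 : ∀ u, ¬ Bt nb q m u p := by
    intro u hu
    rcases H.pasch hmq.symm hnq.symm hmn (H.bt_left hu h5).1 with h | h
    · have hup := h3 u h.symm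
      exact h1 u (H.pasch_par hpq.symm hmq.symm hmp.symm hup hu.symm).symm
    · exact h2 u h.symm
  refine ⟨fun u hu => h1 u hu.symm, fun u hu => ?_, h6⟩
  rcases H.pasch hmp.symm hpq hmq hu with h | h
  · exact h1 u h.symm
  · exact h6 u h.symm

/-- As `b` is not crossed, every line across the triangle meets both `m` and `n`. Let `p` and `q` be
the ones nearest to the apex on `m` and on `n`. If they coincide, they cut off an uncrossed inverted
triangle; if not, they cross each other, and one of the two ears beside their crossing is inverted
and uncrossed. -/
theorem exists_empty_of_side [Finite L] (H : IsArr β prec nb) (HI : IsInv β nb I) {b m n : L}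
    (hI : I b m n) (hb : ∀ u, ¬ Bt nb b m u n) (hw : ∀ w, Bt nb m b w n → I m n w) :
    ∃ p q r, I p q r ∧ Uncrossed nb p q r := by
  obtain ⟨hbm, hbn, hmn⟩ := HI.ne hI
  have hcr : ∀ w, Bt nb m b w n → Bt nb n b w m := fun w h => by
    rcases H.pasch hbm.symm hmn hbn h with h | h
    · exact absurd h (hb w)
    · exact h.symm
  have hcr' : ∀ w, Bt nb n b w m → Bt nb m b w n := fun w h => by
    rcases H.pasch hbn.symm hmn.symm hbm h with h | h
    · exact absurd h.symm (hb w)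
    · exact h.symm
  by_cases hex : ∃ w, Bt nb m b w n
  swap
  · push Not at hex
    exact ⟨b, m, n, hI, hb, hex, fun u hu => hex u (hcr' u hu)⟩
  obtain ⟨w, hw0⟩ := hex
  obtain ⟨p, -, hp, hp1⟩ := H.exists_nearest (fun _ => True) trivial hw0.symm
  obtain ⟨q, -, hq, hq1⟩ := H.exists_nearest (fun _ => True) trivial (hcr _ hw0).symm
  have hpn := hcr _ hp.symm
  have hqm := hcr' _ hq.symm
  have hIp := hw p hp.symm
  by_cases hpq : p = q
  · subst hpq
    refine ⟨m, n, p, hIp, fun u hu => hp1 u trivial hu, fun u hu => hq1 u trivial hu,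
      fun u hu => ?_⟩
    have hne := HI.ne hIp
    rcases H.pasch hne.2.1.symm hne.2.2.symm hne.1 hu with h | h
    · exact hp1 u trivial h.symm
    · exact hq1 u trivial h.symm
  have hmp := (hp.ne H).2.1
  have hnp := (hpn.ne H).2.1
  have hnq := (hq.ne H).2.1
  have hmq := (hqm.ne H).2.1
  have hmpq : Bt nb m n p q := (H.bt_total hp hqm.symm (Ne.symm hpq)).resolve_left (hp1 _ trivial)
  have hnqp : Bt nb n m q p := (H.bt_total hq hpn.symm hpq).resolve_left (hq1 _ trivial)
  -- Parallel lines cut off nested corners, so one of them would be nearest to the apex on both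
  -- sides.
  have hne : β p ≠ β q := fun h =>
    hq1 p trivial (H.pasch_par hmq.symm hmn hnq h hmpq.symm).symm
  -- For the same reason such a line is not parallel to `q`. It also crosses both `m` and `n`, so of
  -- the four bundles only that of `p` is left.
  have t1 : ∀ u, Bt nb m n u q → β u = β p := by
    intro u hu
    have h1 := (H.bt_left hu hqm.symm).1
    have h2 := (h1.ne H).2.1
    have h3 := ((hcr _ h1.symm).ne H).2.1
    have h4 : β u ≠ β q := fun h =>
      hq1 u trivial (H.pasch_par hmq.symm hmn hnq h hu.symm).symm
    omega
  have t2 : ∀ u, Bt nb n m u p → β u = β q := by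
    intro u hu
    have h1 := (H.bt_left hu hpn.symm).1
    have h2 := (h1.ne H).2.1
    have h3 := ((hcr' _ h1.symm).ne H).2.1
    have h4 : β u ≠ β p := fun h =>
      hp1 u trivial (H.pasch_par hnp.symm hmn.symm hmp h hu.symm).symm
    omega
  -- The ears are `m p' q` and `n q' p`: `p'` is the last line before `q` on `m`, and `q'` the last
  -- one before `p` on `n`, both counted from the apex.
  obtain ⟨p', -, hp', hp1'⟩ := H.exists_nearest (fun _ => True) trivial hmpq.symm
  obtain ⟨q', -, hq', hq1'⟩ := H.exists_nearest (fun _ => True) trivial hnqp.symm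
  have e1 := t1 p' hp'.symm
  have e2 := t2 q' hq'.symm
  by_cases hc : I m p' q
  · exact ⟨m, p', q, hc, H.ear (e1 ▸ hmp.symm) hmn hmq.symm (e1 ▸ hne) hnq.symm
      (fun u => hp1' u trivial) (fun u => hq1 u trivial) (fun u hu => e1 ▸ t1 u hu) hp'.symm⟩
  -- Splitting at `p'` leaves either the ear or the triple `m`, `p`, `p'` with two parallel lines.
  have hc2 : ¬ I m p q := fun h => by
    by_cases hpp : p = p'
    · exact hc (hpp ▸ h)
    · have h1 := (H.bt_total hmpq hp'.symm (Ne.symm hpp)).resolve_left (hp1 _ trivial)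
      have h2 := (H.bt_left h1 hp'.symm).2
      rcases HI.split h2 h with h | h
      · exact (HI.ne h).2.2 e1.symm
      · exact hc h
  have h5 : Bt nb p m q n := by
    rcases H.pasch hmn.symm hnp.symm hmp.symm hnqp with h | h
    · exact absurd h (hp1 _ trivial)
    · exact h.symm
  -- On `p`, the crossing with `q` splits the inverted triple `m n p`; the part at `m` is not
  -- inverted, so the part at `n` is.
  have h6 : I n q p := by
    rcases HI.split h5 (HI.swap₁ (HI.swap₂ hIp)) with h | h
    · exact absurd (HI.swap₁ h) hc2
    · exact HI.swap₁ (HI.swap₂ (HI.swap₁ h))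
  have h7 : I n q' p := by
    by_cases hqq : q = q'
    · exact hqq ▸ h6
    · have h1 := (H.bt_total hnqp hq'.symm (Ne.symm hqq)).resolve_left (hq1 _ trivial)
      have h2 := (H.bt_left h1 hq'.symm).2
      rcases HI.split h2 h6 with h | h
      · exact absurd e2.symm (HI.ne h).2.2
      · exact h
  exact ⟨n, q', p, h7, H.ear (e2 ▸ hnq.symm) hmn.symm hnp.symm (e2 ▸ hne.symm) hmp.symm
      (fun u => hq1' u trivial) (fun u => hp1 u trivial) (fun u hu => e2 ▸ t2 u hu) hq'.symm⟩

/-- As long as some line passes between the two crossings, `split` leaves an inverted triple with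
fewer lines in between. -/
theorem exists_adjacent [Finite L] (H : IsArr β prec nb) (HI : IsInv β nb I) {l a b : L}
    (hI : I l a b) : ∃ x y, I l x y ∧ ∀ u, ¬ Bt nb l x u y := by
  induction hk : {u | Bt nb l a u b}.ncard using Nat.strong_induction_on generalizing a b with
  | _ k ih =>
    by_cases hex : ∃ u, Bt nb l a u b
    · obtain ⟨u, hu⟩ := hex
      rcases HI.split hu hI with h | h
      · refine ih _ ?_ h rfl
        rw [← hk]
        refine Set.ncard_lt_ncard ⟨fun t ht => (H.bt_left ht hu).1, fun hs => ?_⟩ (Set.toFinite _)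
        exact absurd (Bt.ne H (hs hu : Bt nb l a u u)).2.2.2.2.1 (by simp)
      · refine ih _ ?_ h rfl
        rw [← hk]
        refine Set.ncard_lt_ncard ⟨fun t ht => (H.bt_right hu ht).1, fun hs => ?_⟩ (Set.toFinite _)
        exact absurd (Bt.ne H (hs hu : Bt nb l u u b)).2.2.2.1 (by simp)
    · push Not at hex
      exact ⟨a, b, hI, hex⟩

/-- The new base is `y`. On it, `z` is replaced by the line `z'` of its bundle nearest to `a`, and
then `a` by the line `a'` of its bundle next to `z'`. The triple `y`, `a'`, `z'` is still inverted
and its side on `y` is uncrossed, so `exists_empty_of_side` can be applied to it. -/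
theorem exists_empty_of_opposite [Finite L] (H : IsArr β prec nb) (HI : IsInv β nb I)
    {a x y z : L} (hI : I a x y) (hb : ∀ u, ¬ Bt nb a x u y) (hz : β z = β x + 2)
    (hza : β z ≠ β a) (hbt : Bt nb y a z x) (hn : ¬ I x y z) :
    ∃ p q r, I p q r ∧ Uncrossed nb p q r := by
  obtain ⟨hax, hay, hxy⟩ := HI.ne hI
  have hzy := (hbt.ne H).2.1
  have hI' : I y a x := HI.swap₁ (HI.swap₂ hI)
  obtain ⟨z', e1, hz1, hz2⟩ := H.exists_nearest (fun u => β u = β z) rfl hbt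
  have i1 : I y a z := (HI.split hbt hI').resolve_right
    fun h => hn (HI.swap₁ (HI.swap₂ h))
  have i2 : I y a z' := by
    by_cases h : z = z'
    · exact h ▸ i1
    · have h1 := (H.bt_total hbt hz1 (Ne.symm h)).resolve_right (hz2 _ rfl)
      exact (HI.split h1 i1).resolve_right fun h => (HI.ne h).2.2 e1
  obtain ⟨a', e2, ha', ha2⟩ : ∃ a', β a' = β a ∧ (a' = a ∨ Bt nb y a a' z') ∧
      ∀ u, β u = β a → ¬ Bt nb y a' u z' := by
    by_cases hex : ∃ u, β u = β a ∧ Bt nb y a u z'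
    · obtain ⟨u, hu, hu'⟩ := hex
      obtain ⟨a', h1, h2, h3⟩ := H.exists_nearest (fun u => β u = β a) hu hu'.symm
      exact ⟨a', h1, Or.inr h2.symm, fun u hu h => h3 u hu h.symm⟩
    · push Not at hex
      exact ⟨a, rfl, Or.inl rfl, hex⟩
  have b1 : Bt nb y a' z' x := by
    rcases ha' with rfl | h
    · exact hz1
    · exact (H.bt_left h hz1).2
  have i3 : I y a' x := by
    rcases ha' with rfl | h
    · exact hI'
    · exact (HI.split (H.bt_left h hz1).1 hI').resolve_left fun h => (HI.ne h).2.2 e2.symm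
  have i4 : I y a' z' := by
    rcases ha' with rfl | h
    · exact i2
    · exact (HI.split h i2).resolve_left fun h => (HI.ne h).2.2 e2.symm
  -- The choices of `a'` and `z'` exclude their two bundles, the uncrossed side on `a` excludes the
  -- bundle of `x`, and lines of the bundle of `y` do not cross `y`.
  have b2 : ∀ u, ¬ Bt nb y a' u z' := by
    intro u hu
    have hu' : Bt nb y a u z' := by
      rcases ha' with rfl | h
      · exact hu
      · exact (H.bt_right h hu).1
    have h1 : β u ≠ β a := fun h => ha2 u h hu
    have h2 : β u ≠ β z := fun h => hz2 u h hu'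
    have h3 : β u ≠ β x := fun h =>
      hb u (H.pasch_par hxy.symm hay.symm hax.symm h (H.bt_left hu' hz1).1.symm)
    have h4 := (hu.ne H).2.1
    omega
  have hz' : β z' = β x + 2 := e1.trans hz
  have hz'a : β z' ≠ β a' := by omega
  have b3 := (H.opposite (e2 ▸ hax) (e2 ▸ hay) hxy hz' hz'a b1).2
  refine H.exists_empty_of_side HI i4 b2 fun w hw => ?_
  have n1 := (hw.ne H).2.1
  have n2 : β w ≠ β z' := fun h =>
    b2 w (H.pasch_par hz'a.symm (e2 ▸ hay) (by omega) h hw.symm).symm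
  have h := (HI.split hw (HI.swap₁ i4))
  refine HI.swap₂ (h.resolve_left fun h => ?_)
  have hwx : β w = β x := by
    have := (HI.ne h).2.2
    omega
  have b4 := (H.bt_right b3 hw).2
  have b5 := H.par_opposite (e2 ▸ hay) (e2 ▸ hax) hxy.symm hwx b4
  -- On `y`, the parallel lines `x` and `w` are on different sides of `a'`; joining there would
  -- invert a triple that contains both of them.
  exact (HI.ne (HI.join b5 (HI.swap₂ i3) (HI.swap₁ h))).2.2 hwx.symm

/-- If some triangle is inverted, then so is one that no line crosses. -/
theorem exists_empty [Finite L] (H : IsArr β prec nb) (HI : IsInv β nb I) {p q r : L}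
    (h : I p q r) : ∃ p q r, I p q r ∧ Uncrossed nb p q r := by
  obtain ⟨x, y, hI, hb⟩ := H.exists_adjacent HI h
  obtain ⟨hax, hay, hxy⟩ := HI.ne hI
  -- The side on `p` is uncrossed. Either all lines across the triangle cut off an inverted corner
  -- of `x` and `y`, or some `w` does not; such a `w` is parallel to none of `p`, `x`, `y`, hence
  -- opposite to exactly one of them.
  by_cases hw : ∀ w, Bt nb x p w y → I x y w
  · exact H.exists_empty_of_side HI hI hb hw
  push Not at hw
  obtain ⟨w, hbt, hn⟩ := hw
  have n1 := (hbt.ne H).2.1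
  have n2 : β w ≠ β y := fun h => hb w (H.pasch_par hxy hax.symm hay.symm h hbt.symm).symm
  have n3 : β w ≠ β p := fun h => hn (HI.swap₂ ((HI.split hbt (HI.swap₁ hI)).resolve_left
    fun h' => (HI.ne h').2.2 h.symm))
  have b2 : Bt nb y p w x := by
    rcases H.pasch hax.symm hxy hay hbt with h | h
    · exact absurd h (hb w)
    · exact h.symm
  have : β w = β p + 2 ∨ β w = β x + 2 ∨ β w = β y + 2 := by omega
  rcases this with e | e | e
  -- A line opposite to `p` would have to meet the uncrossed side on `p`.
  · exact absurd (H.opposite hay.symm hxy.symm hax e n2 hbt.symm).1.symm (hb w)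
  · exact H.exists_empty_of_opposite HI hI hb e n3 b2 hn
  · exact H.exists_empty_of_opposite HI (HI.swap₂ hI) (fun u hu => hb u hu.symm) e n3 hbt
      fun h => hn (HI.swap₁ h)
end IsArr
end RhombusTiling

end

noncomputable section

namespace RhombusTiling
variable {n : ℕ}

/-! ### Plane geometry -/

theorem cross_add (x y z : Plane) : cross x (y + z) = cross x y + cross x z := by
  simp [cross]; ring

theorem cross_sub (x y z : Plane) : cross x (y - z) = cross x y - cross x z := by
  simp [cross]; ring

theorem cross_smul (x y : Plane) (c : ℝ) : cross x (c • y) = c * cross x y := by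
  simp [cross]; ring

theorem cross_neg (x y : Plane) : cross x (-y) = -cross x y := by
  simp [cross]; ring

theorem cross_self (x : Plane) : cross x x = 0 := by
  simp [cross]; ring

theorem cross_zero (x : Plane) : cross x 0 = 0 := by
  simp [cross]

theorem cross_comm (x y : Plane) : cross x y = -cross y x := by
  simp [cross]; ring

theorem add_cross (x y z : Plane) : cross (x + y) z = cross x z + cross y z := by
  simp [cross]; ring

theorem sub_cross (x y z : Plane) : cross (x - y) z = cross x z - cross y z := by
  simp [cross]; ring

theorem smul_cross (x y : Plane) (c : ℝ) : cross (c • x) y = c * cross x y := by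
  simp [cross]; ring

theorem neg_cross (x y : Plane) : cross (-x) y = -cross x y := by
  simp [cross]; ring

theorem cross_sum {ι : Type*} (x : Plane) (s : Finset ι) (f : ι → Plane) :
    cross x (∑ i ∈ s, f i) = ∑ i ∈ s, cross x (f i) := by
  classical
  induction s using Finset.induction_on with
  | empty => simp [cross_zero]
  | insert i s hi ih => rw [Finset.sum_insert hi, Finset.sum_insert hi, cross_add, ih]

theorem continuous_cross (x : Plane) : Continuous fun y => cross x y := by
  unfold cross; fun_prop

theorem continuous_cross_left (x : Plane) : Continuous fun y => cross y x := by
  unfold cross; fun_prop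

/-- Cramer's rule. -/
theorem eq_coords {u w : Plane} (h : cross u w ≠ 0) (x : Plane) :
    x = (cross x w / cross u w) • u + (cross u x / cross u w) • w := by
  have h' : u 0 * w 1 - u 1 * w 0 ≠ 0 := h
  ext i
  fin_cases i
  all_goals
    simp only [cross, PiLp.add_apply, PiLp.smul_apply, smul_eq_mul, Fin.zero_eta, Fin.mk_one]
    rw [div_mul_eq_mul_div, div_mul_eq_mul_div, ← add_div, eq_div_iff h']
    ring

theorem coords_unique {u w : Plane} (h : cross u w ≠ 0) {r s r' s' : ℝ}
    (e : r • u + s • w = r' • u + s' • w) : r = r' ∧ s = s' := by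
  constructor
  · have := congrArg (fun x => cross x w) e
    simp only [add_cross, smul_cross, cross_self, mul_zero, add_zero] at this
    exact mul_right_cancel₀ h this
  · have := congrArg (fun x => cross u x) e
    simp only [cross_add, cross_smul, cross_self, mul_zero, zero_add] at this
    exact mul_right_cancel₀ h this

theorem cross_ne_zero_of_linearIndependent {u w : Plane} (h : LinearIndependent ℝ ![u, w]) :
    cross u w ≠ 0 := by
  intro h0
  rw [LinearIndependent.pair_iff] at h
  have hw := h (w 1) (-u 1) (by
    ext i; fin_cases i
    · simp only [cross] at h0; simp; linarith
    · simp; ring)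
  have hw' := h (w 0) (-u 0) (by
    ext i; fin_cases i
    · simp; ring
    · simp only [cross] at h0; simp; linarith)
  have := h 1 0 (by
    ext i; fin_cases i
    · simp; linarith [hw'.2]
    · simp; linarith [hw.2])
  exact one_ne_zero this.1

/-- Closed parallelogram. -/
def para (b u w : Plane) : Set Plane :=
  {x | ∃ r s : ℝ, 0 ≤ r ∧ r ≤ 1 ∧ 0 ≤ s ∧ s ≤ 1 ∧ x = b + r • u + s • w}

/-- Open parallelogram. -/
def openPara (b u w : Plane) : Set Plane :=
  {x | ∃ r s : ℝ, 0 < r ∧ r < 1 ∧ 0 < s ∧ s < 1 ∧ x = b + r • u + s • w}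

theorem para_swap (b u w : Plane) : para b u w = para b w u := by
  ext x
  constructor <;> rintro ⟨r, s, h1, h2, h3, h4, rfl⟩ <;>
    exact ⟨s, r, h3, h4, h1, h2, by abel⟩

theorem openPara_swap (b u w : Plane) : openPara b u w = openPara b w u := by
  ext x
  constructor <;> rintro ⟨r, s, h1, h2, h3, h4, rfl⟩ <;>
    exact ⟨s, r, h3, h4, h1, h2, by abel⟩

theorem para_flip (b u w : Plane) : para b u w = para (b + w) u (-w) := by
  ext x
  constructor <;> rintro ⟨r, s, h1, h2, h3, h4, rfl⟩ <;>
    exact ⟨r, 1 - s, h1, h2, by linarith, by linarith, by module⟩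

theorem openPara_flip (b u w : Plane) : openPara b u w = openPara (b + w) u (-w) := by
  ext x
  constructor <;> rintro ⟨r, s, h1, h2, h3, h4, rfl⟩ <;>
    exact ⟨r, 1 - s, h1, h2, by linarith, by linarith, by module⟩

theorem openPara_subset (b u w : Plane) : openPara b u w ⊆ para b u w := by
  rintro x ⟨r, s, h1, h2, h3, h4, rfl⟩
  exact ⟨r, s, h1.le, h2.le, h3.le, h4.le, rfl⟩

theorem convex_para (b u w : Plane) : Convex ℝ (para b u w) := by
  rintro x ⟨r, s, h1, h2, h3, h4, rfl⟩ y ⟨r', s', h1', h2', h3', h4', rfl⟩ α β hα hβ hαβ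
  refine ⟨α * r + β * r', α * s + β * s', by positivity, ?_, by positivity, ?_, ?_⟩
  · nlinarith
  · nlinarith
  · obtain rfl : β = 1 - α := by linarith
    module

theorem convex_openPara (b u w : Plane) : Convex ℝ (openPara b u w) := by
  rintro x ⟨r, s, h1, h2, h3, h4, rfl⟩ y ⟨r', s', h1', h2', h3', h4', rfl⟩ α β hα hβ hαβ
  obtain rfl : β = 1 - α := by linarith
  have key : ∀ {p q : ℝ}, 0 < p → 0 < q → 0 < α * p + (1 - α) * q := by
    intro p q hp hq
    rcases hα.eq_or_lt with rfl | h
    · simpa using hq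
    · have := mul_pos h hp
      have := mul_nonneg hβ hq.le
      linarith
  refine ⟨α * r + (1 - α) * r', α * s + (1 - α) * s', key h1 h1', ?_, key h3 h3', ?_, by module⟩
  · have := key (sub_pos.2 h2) (sub_pos.2 h2'); linarith
  · have := key (sub_pos.2 h4) (sub_pos.2 h4'); linarith

theorem mem_para_iff {b u w : Plane} (h : cross u w ≠ 0) (x : Plane) :
    x ∈ para b u w ↔ 0 ≤ cross (x - b) w / cross u w ∧ cross (x - b) w / cross u w ≤ 1 ∧
      0 ≤ cross u (x - b) / cross u w ∧ cross u (x - b) / cross u w ≤ 1 := by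
  constructor
  · rintro ⟨r, s, h1, h2, h3, h4, rfl⟩
    have e : b + r • u + s • w - b = r • u + s • w := by abel
    rw [e, add_cross, cross_add, smul_cross, cross_smul, smul_cross, cross_smul, cross_self,
      cross_self]
    simp [h, h1, h2, h3, h4]
  · rintro ⟨h1, h2, h3, h4⟩
    refine ⟨_, _, h1, h2, h3, h4, ?_⟩
    have := eq_coords h (x - b)
    rw [add_assoc, ← this]
    abel

theorem isClosed_para {b u w : Plane} (h : cross u w ≠ 0) : IsClosed (para b u w) := by
  have : para b u w = {x | 0 ≤ cross (x - b) w / cross u w} ∩ {x | cross (x - b) w / cross u w ≤ 1} ∩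
      ({x | 0 ≤ cross u (x - b) / cross u w} ∩ {x | cross u (x - b) / cross u w ≤ 1}) := by
    ext x
    simp only [mem_para_iff h, Set.mem_inter_iff, Set.mem_ofPred_eq]
    tauto
  rw [this]
  have c1 : Continuous fun x => cross (x - b) w / cross u w :=
    ((continuous_cross_left w).comp (continuous_id.sub continuous_const)).div_const _
  have c2 : Continuous fun x => cross u (x - b) / cross u w :=
    ((continuous_cross u).comp (continuous_id.sub continuous_const)).div_const _
  exact ((isClosed_le continuous_const c1).inter (isClosed_le c1 continuous_const)).inter
    ((isClosed_le continuous_const c2).inter (isClosed_le c2 continuous_const))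

/-! ### Tiles seen from one of their two directions -/

variable (v : Fin n → Plane)

/-- The interior of a tile. -/
def Tile.inner (t : Tile n) : Set Plane := openPara t.base (v t.i) (v t.j)

/-- The tile `t` has edges parallel to `v k`. -/
def Tile.HasDir (t : Tile n) (k : Fin n) : Prop := t.i = k ∨ t.j = k

/-- The direction of a tile other than `k`. -/
def Tile.other (t : Tile n) (k : Fin n) : Fin n := if t.i = k then t.j else t.i

open scoped Classical in
/-- The origin of the edge parallel to `v k` on which `cross (v k)` is minimal. -/
def Tile.lft (t : Tile n) (k : Fin n) : Plane :=
  if 0 < cross (v k) (v (t.other k)) then t.base else t.base + v (t.other k)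

open scoped Classical in
/-- The translation from the left to the right edge parallel to `v k`. -/
def Tile.stp (t : Tile n) (k : Fin n) : Plane :=
  if 0 < cross (v k) (v (t.other k)) then v (t.other k) else -v (t.other k)

/-- The origin of the edge parallel to `v k` on which `cross (v k)` is maximal. -/
def Tile.rgt (t : Tile n) (k : Fin n) : Plane := t.lft v k + t.stp v k

variable {v}

/-- The vectors are pairwise non-collinear. -/
def General (v : Fin n → Plane) : Prop := ∀ i j, i ≠ j → cross (v i) (v j) ≠ 0

theorem Tile.other_ne {t : Tile n} {k : Fin n} (_h : t.HasDir k) : t.other k ≠ k := by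
  unfold Tile.other
  split_ifs with h1
  · rw [← h1]; exact t.lt.ne'
  · exact h1

theorem Tile.hasDir_other (t : Tile n) (k : Fin n) : t.HasDir (t.other k) := by
  unfold Tile.other Tile.HasDir
  split_ifs <;> simp

theorem Tile.other_other {t : Tile n} {k : Fin n} (h : t.HasDir k) : t.other (t.other k) = k := by
  have := t.lt.ne
  unfold Tile.other Tile.HasDir at *
  split_ifs <;> grind

theorem Tile.hasDir_iff {t : Tile n} {k j : Fin n} (h : t.HasDir k) :
    t.HasDir j ↔ j = k ∨ j = t.other k := by
  unfold Tile.other Tile.HasDir at *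
  split_ifs <;> grind

theorem Tile.carrier_eq_base {t : Tile n} {k : Fin n} (h : t.HasDir k) :
    t.carrier v = para t.base (v k) (v (t.other k)) := by
  unfold Tile.other
  split_ifs with h1
  · subst h1; rfl
  · rw [← h.resolve_left h1, para_swap]; rfl

theorem Tile.inner_eq_base {t : Tile n} {k : Fin n} (h : t.HasDir k) :
    t.inner v = openPara t.base (v k) (v (t.other k)) := by
  unfold Tile.other
  split_ifs with h1
  · subst h1; rfl
  · rw [← h.resolve_left h1, openPara_swap]; rfl

theorem Tile.carrier_eq {t : Tile n} {k : Fin n} (h : t.HasDir k) :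
    t.carrier v = para (t.lft v k) (v k) (t.stp v k) := by
  rw [Tile.carrier_eq_base h, Tile.lft, Tile.stp]
  split_ifs
  · rfl
  · exact para_flip _ _ _

theorem Tile.inner_eq {t : Tile n} {k : Fin n} (h : t.HasDir k) :
    t.inner v = openPara (t.lft v k) (v k) (t.stp v k) := by
  rw [Tile.inner_eq_base h, Tile.lft, Tile.stp]
  split_ifs
  · rfl
  · exact openPara_flip _ _ _

theorem Tile.inner_eq_rgt {t : Tile n} {k : Fin n} (h : t.HasDir k) :
    t.inner v = openPara (t.rgt v k) (v k) (-t.stp v k) := by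
  rw [Tile.inner_eq h, openPara_flip]; rfl

theorem Tile.stp_pos (hc : General v) {t : Tile n} {k : Fin n} (h : t.HasDir k) :
    0 < cross (v k) (t.stp v k) := by
  unfold Tile.stp
  split_ifs with h1
  · exact h1
  · rw [cross_neg]
    have := hc k (t.other k) (Tile.other_ne h).symm
    rcases lt_or_gt_of_ne this with h2 | h2
    · linarith
    · exact absurd h2 h1

theorem Tile.mem_edges {t : Tile n} {k : Fin n} {b : Plane} :
    (b, k) ∈ t.edges v ↔ t.HasDir k ∧ (b = t.lft v k ∨ b = t.rgt v k) := by
  have := t.lt.ne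
  unfold Tile.rgt Tile.lft Tile.stp Tile.other Tile.HasDir Tile.edges
  simp only [Set.mem_insert_iff, Set.mem_singleton_iff, Prod.mk.injEq]
  split_ifs <;> (try simp only [add_neg_cancel_right]) <;> grind

theorem Tile.inner_subset (t : Tile n) : t.inner v ⊆ t.carrier v := openPara_subset _ _ _

theorem Tile.convex_carrier (t : Tile n) : Convex ℝ (t.carrier v) := convex_para _ _ _

theorem Tile.convex_inner (t : Tile n) : Convex ℝ (t.inner v) := convex_openPara _ _ _

theorem Tile.isClosed_carrier (hc : General v) (t : Tile n) : IsClosed (t.carrier v) :=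
  isClosed_para (hc _ _ t.lt.ne)

theorem mem_edgeCarrier {e : Plane × Fin n} {x : Plane} :
    x ∈ edgeCarrier v e ↔ ∃ r : ℝ, 0 ≤ r ∧ r ≤ 1 ∧ x = e.1 + r • v e.2 := by
  unfold edgeCarrier
  rw [segment_eq_image']
  constructor
  · rintro ⟨r, hr, rfl⟩; exact ⟨r, hr.1, hr.2, by simp⟩
  · rintro ⟨r, h1, h2, rfl⟩; exact ⟨r, ⟨h1, h2⟩, by simp⟩

theorem Tile.inner_not_vertex (hc : General v) {t : Tile n} {x : Plane} (hx : x ∈ t.inner v) :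
    x ∉ t.vertices v := by
  obtain ⟨r, s, h1, h2, h3, h4, rfl⟩ := hx
  have h := hc _ _ t.lt.ne
  have key : ∀ r' s' : ℝ, (r' = 0 ∨ r' = 1) →
      t.base + r • v t.i + s • v t.j ≠ t.base + r' • v t.i + s' • v t.j := by
    intro r' s' hr' e
    have := (coords_unique h (by simpa [add_assoc] using e)).1
    rcases hr' with rfl | rfl <;> linarith
  rintro (e | e | e | e)
  · exact key 0 0 (by simp) (by simpa using e)
  · exact key 1 0 (by simp) (by simpa using e)
  · exact key 0 1 (by simp) (by simpa using e)
  · exact key 1 1 (by simp) (by simpa using e)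

theorem Tile.inner_not_edge (hc : General v) {t : Tile n} {x : Plane} (hx : x ∈ t.inner v)
    {e : Plane × Fin n} (he : e ∈ t.edges v) : x ∉ edgeCarrier v e := by
  obtain ⟨b, k⟩ := e
  obtain ⟨hk, hb⟩ := Tile.mem_edges.1 he
  rw [mem_edgeCarrier]
  rintro ⟨r, -, -, rfl⟩
  rw [Tile.inner_eq hk] at hx
  obtain ⟨r', s', h1, h2, h3, h4, e⟩ := hx
  have hp := Tile.stp_pos hc hk
  have := congrArg (fun x => cross (v k) x) e
  rcases hb with rfl | rfl <;>
  · simp only [cross_add, cross_smul, cross_self, Tile.rgt] at this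
    nlinarith

/-! ### The zonotope -/

theorem convex_zonotope (v : Fin n → Plane) (a : Fin n → ℕ) : Convex ℝ (zonotope v a) := by
  rintro x ⟨c, hc, rfl⟩ y ⟨d, hd, rfl⟩ α β hα hβ hαβ
  refine ⟨fun k => α * c k + β * d k, fun k => ⟨?_, ?_⟩, ?_⟩
  · have := (hc k).1; have := (hd k).1; positivity
  · have := (hc k).2; have := (hd k).2
    obtain rfl : β = 1 - α := by linarith
    nlinarith
  · simp only [Finset.smul_sum, ← Finset.sum_add_distrib]
    exact Finset.sum_congr rfl fun k _ => by module

/-- The least value of `cross (v k)` on the zonotope. -/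
def lo (v : Fin n → Plane) (a : Fin n → ℕ) (k : Fin n) : ℝ :=
  ∑ j, (a j : ℝ) * min 0 (cross (v k) (v j))

/-- The greatest value of `cross (v k)` on the zonotope. -/
def hi (v : Fin n → Plane) (a : Fin n → ℕ) (k : Fin n) : ℝ :=
  ∑ j, (a j : ℝ) * max 0 (cross (v k) (v j))

variable {a : Fin n → ℕ}

theorem le_hi {x : Plane} (hx : x ∈ zonotope v a) (k : Fin n) : cross (v k) x ≤ hi v a k := by
  obtain ⟨c, hc, rfl⟩ := hx
  rw [cross_sum]
  refine Finset.sum_le_sum fun j _ => ?_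
  rw [cross_smul]
  calc c j * cross (v k) (v j) ≤ c j * max 0 (cross (v k) (v j)) :=
        mul_le_mul_of_nonneg_left (le_max_right _ _) (hc j).1
    _ ≤ _ := mul_le_mul_of_nonneg_right (hc j).2 (le_max_left _ _)

theorem lo_le {x : Plane} (hx : x ∈ zonotope v a) (k : Fin n) : lo v a k ≤ cross (v k) x := by
  obtain ⟨c, hc, rfl⟩ := hx
  rw [cross_sum]
  refine Finset.sum_le_sum fun j _ => ?_
  rw [cross_smul]
  calc (a j : ℝ) * min 0 (cross (v k) (v j)) ≤ c j * min 0 (cross (v k) (v j)) :=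
        mul_le_mul_of_nonpos_right (hc j).2 (min_le_left _ _)
    _ ≤ _ := mul_le_mul_of_nonneg_left (min_le_right _ _) (hc j).1

theorem exists_hi (v : Fin n → Plane) (a : Fin n → ℕ) (k : Fin n) :
    ∃ x ∈ zonotope v a, cross (v k) x = hi v a k := by
  classical
  refine ⟨∑ j, (if 0 < cross (v k) (v j) then (a j : ℝ) else 0) • v j, ⟨_, fun j => ?_, rfl⟩, ?_⟩
  · split_ifs <;> simp
  · rw [cross_sum]
    refine Finset.sum_congr rfl fun j _ => ?_
    rw [cross_smul]
    split_ifs with h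
    · rw [max_eq_right h.le]
    · rw [max_eq_left (not_lt.1 h)]; simp

theorem corner_add_eq (k : Fin n) (c : ℝ) : corner v a k + c • v k =
    ∑ j, (open scoped Classical in if j = k then c else if cross (v k) (v j) < 0 then (a j : ℝ) else 0) • v j := by
  classical
  unfold corner
  rw [Finset.sum_filter, ← Finset.add_sum_erase _ _ (Finset.mem_univ k),
    ← Finset.add_sum_erase (Finset.univ) (fun j => (if j = k then c else if cross (v k) (v j) < 0
      then (a j : ℝ) else 0) • v j) (Finset.mem_univ k)]
  simp only [cross_self, lt_irrefl, if_false, if_true, zero_add]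
  rw [add_comm]
  congr 1
  refine Finset.sum_congr rfl fun j hj => ?_
  rw [if_neg (Finset.ne_of_mem_erase hj)]
  split_ifs <;> simp

theorem corner_add_mem (k : Fin n) {c : ℝ} (h0 : 0 ≤ c) (h1 : c ≤ a k) :
    corner v a k + c • v k ∈ zonotope v a := by
  classical
  refine ⟨_, fun j => ?_, corner_add_eq k c⟩
  split_ifs with h
  · subst h; exact ⟨h0, h1⟩
  · simp
  · simp

theorem cross_corner_add (k : Fin n) (c : ℝ) : cross (v k) (corner v a k + c • v k) = lo v a k := by
  classical
  rw [corner_add_eq, cross_sum]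
  refine Finset.sum_congr rfl fun j _ => ?_
  rw [cross_smul]
  split_ifs with h h1
  · subst h; simp [cross_self]
  · rw [min_eq_right h1.le]
  · rw [min_eq_left (not_lt.1 h1)]; simp

/-- Equality in a sum of termwise inequalities fixes every coefficient except that of `v k`, whose
contribution to `cross (v k)` is zero. -/
theorem eq_corner_add (hc : General v) {x : Plane} (hx : x ∈ zonotope v a) {k : Fin n}
    (h : cross (v k) x = lo v a k) : ∃ c : ℝ, 0 ≤ c ∧ c ≤ a k ∧ x = corner v a k + c • v k := by
  classical
  obtain ⟨c, hca, rfl⟩ := hx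
  refine ⟨c k, (hca k).1, (hca k).2, ?_⟩
  rw [corner_add_eq]
  rw [cross_sum] at h
  have hle : ∀ j ∈ Finset.univ, (a j : ℝ) * min 0 (cross (v k) (v j)) ≤ cross (v k) (c j • v j) := by
    intro j _
    rw [cross_smul]
    calc (a j : ℝ) * min 0 (cross (v k) (v j)) ≤ c j * min 0 (cross (v k) (v j)) :=
          mul_le_mul_of_nonpos_right (hca j).2 (min_le_left _ _)
      _ ≤ _ := mul_le_mul_of_nonneg_left (min_le_right _ _) (hca j).1
  have heq := (Finset.sum_eq_sum_iff_of_le hle).1 h.symm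
  refine Finset.sum_congr rfl fun j _ => ?_
  have := heq j (Finset.mem_univ j)
  rw [cross_smul] at this
  split_ifs with hjk h1
  · rw [hjk]
  · rw [min_eq_right h1.le] at this
    rw [mul_right_cancel₀ h1.ne this]
  · have h2 := lt_of_le_of_ne (not_lt.1 h1) (hc k j (Ne.symm hjk)).symm
    rw [min_eq_left h2.le, mul_zero] at this
    rw [(mul_eq_zero.1 this.symm).resolve_right h2.ne']

end RhombusTiling

end

/-! ### Tiles of a tiling: overlaps, finiteness, neighbours -/

noncomputable section

namespace RhombusTiling
variable {n : ℕ} {v : Fin n → Plane} {a : Fin n → ℕ}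

theorem Tile.lft_mem {t : Tile n} {k : Fin n} (h : t.HasDir k) : t.lft v k ∈ t.carrier v := by
  rw [Tile.carrier_eq h]
  exact ⟨0, 0, by simp⟩

theorem Tile.rgt_mem {t : Tile n} {k : Fin n} (h : t.HasDir k) : t.rgt v k ∈ t.carrier v := by
  rw [Tile.carrier_eq h]
  exact ⟨0, 1, by simp [Tile.rgt]⟩

theorem Tile.cross_mem (hc : General v) {t : Tile n} {k : Fin n} (h : t.HasDir k) {x : Plane}
    (hx : x ∈ t.carrier v) :
    cross (v k) (t.lft v k) ≤ cross (v k) x ∧ cross (v k) x ≤ cross (v k) (t.rgt v k) := by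
  rw [Tile.carrier_eq h] at hx
  obtain ⟨r, s, h1, h2, h3, h4, rfl⟩ := hx
  have := Tile.stp_pos hc h
  simp only [Tile.rgt, cross_add, cross_smul, cross_self]
  constructor <;> nlinarith

namespace Tiling

variable (T : Tiling v a)

theorem subset_zonotope {t : Tile n} (ht : t ∈ T.tiles) : t.carrier v ⊆ zonotope v a := by
  rw [← T.covers]
  exact Set.subset_biUnion_of_mem (u := fun t => Tile.carrier v t) ht

theorem inner_unique (hc : General v) {s t : Tile n} (hs : s ∈ T.tiles) (ht : t ∈ T.tiles)
    {x : Plane} (hx : x ∈ s.inner v) (hx' : x ∈ t.carrier v) : s = t := by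
  by_contra hne
  have hmem : x ∈ s.carrier v ∩ t.carrier v := ⟨s.inner_subset hx, hx'⟩
  rcases T.meets s hs t ht hne with h | ⟨y, hy, h⟩ | ⟨e, he, h⟩
  · rw [h] at hmem; exact hmem
  · rw [h] at hmem
    rw [Set.mem_singleton_iff.1 hmem] at hx
    exact Tile.inner_not_vertex hc hx hy.1
  · rw [h] at hmem
    exact Tile.inner_not_edge hc hx he.1 hmem

/-- Two tiles with the same directions overlap if the coordinates of their bases have the same
integer parts. So the integer parts, which are bounded, tell them apart. -/
theorem finite_tiles (hc : General v) : T.tiles.Finite := by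
  have : T.tiles = ⋃ i : Fin n, ⋃ j : Fin n, {t | t ∈ T.tiles ∧ t.i = i ∧ t.j = j} := by
    ext t; simp
  rw [this]
  refine Set.finite_iUnion fun i => Set.finite_iUnion fun j => ?_
  by_cases hij : i = j
  · refine Set.Finite.subset Set.finite_empty ?_
    rintro t ⟨-, rfl, h⟩
    exact absurd (hij.trans h.symm) (by rw [h, ← hij]; exact fun _ => (t.lt.ne (hij.trans h.symm ▸ rfl)))
  have hcij := hc i j hij
  let α : Plane → ℝ := fun x => cross x (v j) / cross (v i) (v j)
  let β : Plane → ℝ := fun x => cross (v i) x / cross (v i) (v j)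
  let g : Tile n → ℤ × ℤ := fun t => (⌊α t.base⌋, ⌊β t.base⌋)
  have bound : ∀ m M x c : ℝ, m ≤ x → x ≤ M → |x / c| ≤ (|m| + |M|) / |c| := by
    intro m M x c h1 h2
    rw [abs_div]
    gcongr
    rw [abs_le]
    constructor
    · linarith [neg_abs_le m, abs_nonneg M]
    · linarith [le_abs_self M, abs_nonneg m]
  obtain ⟨M, hM⟩ : ∃ M : ℝ, ∀ x ∈ zonotope v a, |α x| ≤ M := by
    refine ⟨_, fun x hx => bound (-hi v a j) (-lo v a j) _ _ ?_ ?_⟩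
    · rw [cross_comm]; exact neg_le_neg (le_hi hx j)
    · rw [cross_comm]; exact neg_le_neg (lo_le hx j)
  obtain ⟨N, hN⟩ : ∃ N : ℝ, ∀ x ∈ zonotope v a, |β x| ≤ N :=
    ⟨_, fun x hx => bound _ _ _ _ (lo_le hx i) (le_hi hx i)⟩
  refine Set.Finite.of_injOn (f := g) (t := Set.Icc ⌊-M⌋ ⌊M⌋ ×ˢ Set.Icc ⌊-N⌋ ⌊N⌋) ?_ ?_
    ((Set.finite_Icc _ _).prod (Set.finite_Icc _ _))
  · rintro t ⟨ht, rfl, rfl⟩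
    have hb : t.base ∈ zonotope v a := T.subset_zonotope ht ⟨0, 0, by simp⟩
    have h1 := abs_le.1 (hM _ hb)
    have h2 := abs_le.1 (hN _ hb)
    exact ⟨⟨Int.floor_mono h1.1, Int.floor_mono h1.2⟩, ⟨Int.floor_mono h2.1, Int.floor_mono h2.2⟩⟩
  · rintro s ⟨hs, hsi, hsj⟩ t ⟨ht, hti, htj⟩ hst
    obtain ⟨h1, h2⟩ := Prod.mk.injEq _ _ _ _ ▸ hst
    have d1 := abs_lt.1 (Int.abs_sub_lt_one_of_floor_eq_floor h1)
    have d2 := abs_lt.1 (Int.abs_sub_lt_one_of_floor_eq_floor h2)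
    have e : s.base - t.base = (α s.base - α t.base) • v i + (β s.base - β t.base) • v j := by
      have := eq_coords hcij (s.base - t.base)
      simp only [sub_cross, cross_sub, sub_div] at this
      exact this
    set A := α s.base - α t.base
    set B := β s.base - β t.base
    -- The point is the midpoint of the two centres; it is inner because the offsets `A`, `B` have
    -- absolute value below one.
    refine T.inner_unique hc hs ht (x := s.base + ((1 - A) / 2) • v i + ((1 - B) / 2) • v j) ?_ ?_
    · exact ⟨(1 - A) / 2, (1 - B) / 2, by linarith, by linarith, by linarith, by linarith,
        by rw [hsi, hsj]⟩
    · refine ⟨(1 + A) / 2, (1 + B) / 2, by linarith, by linarith, by linarith, by linarith, ?_⟩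
      rw [hti, htj, show s.base = t.base + (A • v i + B • v j) by rw [← e]; abel]
      module

/-- Some tile contains a whole beginning of a segment of the zonotope. -/
theorem germ (hc : General v) {y z : Plane} (hy : y ∈ zonotope v a) (hz : z ∈ zonotope v a) :
    ∃ t ∈ T.tiles, ∃ ε : ℝ, 0 < ε ∧ ε ≤ 1 ∧
      ∀ s : ℝ, 0 ≤ s → s ≤ ε → y + s • (z - y) ∈ t.carrier v := by
  have hcov : ∀ m : ℕ, ∃ t ∈ T.tiles, y + (1 / ((m : ℝ) + 1)) • (z - y) ∈ t.carrier v := by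
    intro m
    have h1 : (1 : ℝ) / ((m : ℝ) + 1) ≤ 1 := by
      rw [div_le_one (by positivity)]; linarith [Nat.cast_nonneg (α := ℝ) m]
    have hmem : y + (1 / ((m : ℝ) + 1)) • (z - y) ∈ zonotope v a :=
      (convex_zonotope v a).add_smul_sub_mem hy hz ⟨by positivity, h1⟩
    rw [← T.covers] at hmem
    simpa using hmem
  choose f hf hfm using hcov
  have : Finite T.tiles := T.finite_tiles hc
  -- By the pigeonhole principle one tile contains infinitely many points of a sequence that tends
  -- to `y`. Being closed and convex, it contains `y` and an initial piece of the segment.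
  obtain ⟨⟨t, ht⟩, hinf⟩ := Finite.exists_infinite_fiber (fun m => (⟨f m, hf m⟩ : T.tiles))
  have hinf' : {m | f m = t}.Infinite := by
    convert Set.infinite_coe_iff.1 hinf using 1
    ext m; simp
  have hfr : ∃ᶠ m in Filter.atTop, f m = t := Nat.frequently_atTop_iff_infinite.2 hinf'
  have hlim : Filter.Tendsto (fun m : ℕ => y + (1 / ((m : ℝ) + 1)) • (z - y)) Filter.atTop
      (nhds (y + (0 : ℝ) • (z - y))) :=
    tendsto_const_nhds.add (tendsto_one_div_add_atTop_nhds_zero_nat.smul_const _)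
  have hyt : y ∈ t.carrier v := by
    have := (Tile.isClosed_carrier hc t).mem_of_frequently_of_tendsto
      (hfr.mono fun m hm => hm ▸ hfm m) hlim
    simpa using this
  obtain ⟨m, hm⟩ := hfr.exists
  refine ⟨t, ht, 1 / ((m : ℝ) + 1), by positivity, ?_, fun s h0 h1 => ?_⟩
  · rw [div_le_one (by positivity)]; linarith [Nat.cast_nonneg (α := ℝ) m]
  · have h2 : y + (1 / ((m : ℝ) + 1)) • (z - y) ∈ t.carrier v := hm ▸ hfm m
    have h3 := (Tile.convex_carrier (v := v) t).add_smul_sub_mem hyt h2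
      (t := s * ((m : ℝ) + 1)) ⟨by positivity, ?_⟩
    · convert h3 using 2
      rw [add_sub_cancel_left, smul_smul]
      congr 1
      field_simp
    · rwa [le_div_iff₀ (by positivity)] at h1

end Tiling

/-- Two parallelograms on the same side of overlapping edges overlap. -/
theorem openPara_overlap {b u w w' : Plane} {c : ℝ} (hcu : |c| < 1) (h : 0 < cross u w)
    (h' : 0 < cross u w') : ∃ x, x ∈ openPara b u w ∧ x ∈ openPara (b + c • u) u w' := by
  have hc := abs_lt.1 hcu
  -- `A` and `B` are the coordinates of `w` in the basis `u`, `w'`. The witness starts in the middle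
  -- of the common part of the two edges and makes a step `ε • w` so short that it stays inside both
  -- parallelograms.
  set A := cross w w' / cross u w'
  set B := cross u w / cross u w'
  have hB : 0 < B := by positivity
  have e : w = A • u + B • w' := eq_coords h'.ne' w
  set δ := (1 - |c|) / 2
  have hδ : 0 < δ := by simp only [δ]; linarith
  have hδ1 : δ ≤ 1 / 2 := by simp only [δ]; linarith [abs_nonneg c]
  set ε := δ / (1 + |A| + B)
  have hε : 0 < ε := by positivity
  have hden : ε * (1 + |A| + B) = δ := by simp only [ε]; field_simp
  have k1 : 0 ≤ ε * |A| := by positivity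
  have k2 : 0 < ε * B := by positivity
  have k4 : ε * A ≤ ε * |A| := by gcongr; exact le_abs_self A
  have k5 : -(ε * |A|) ≤ ε * A := by rw [← mul_neg]; gcongr; exact neg_abs_le A
  have m1 : δ ≤ (1 + c) / 2 ∧ δ ≤ (1 - c) / 2 := by
    simp only [δ]; constructor <;> linarith [neg_abs_le c, le_abs_self c]
  have hsum : ε + ε * |A| + ε * B = δ := by rw [← hden]; ring
  refine ⟨b + ((1 + c) / 2) • u + ε • w, ⟨_, _, by linarith, by linarith, hε, by linarith, rfl⟩,
    ⟨(1 - c) / 2 + ε * A, ε * B, by linarith, by linarith, k2, by linarith, ?_⟩⟩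
  rw [e]
  module

namespace Tiling
variable (T : Tiling v a)

theorem lft_unique (hc : General v) {s t : Tile n} (hs : s ∈ T.tiles) (ht : t ∈ T.tiles)
    {k : Fin n} (hsk : s.HasDir k) (htk : t.HasDir k) {c : ℝ} (h1 : |c| < 1)
    (h : t.lft v k = s.lft v k + c • v k) : s = t := by
  obtain ⟨x, hx, hx'⟩ := openPara_overlap (b := s.lft v k) h1 (Tile.stp_pos hc hsk)
    (Tile.stp_pos hc htk)
  rw [← h, ← Tile.inner_eq htk] at hx'
  rw [← Tile.inner_eq hsk] at hx
  exact T.inner_unique hc hs ht hx (t.inner_subset hx')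

theorem lft_inj (hc : General v) {s t : Tile n} (hs : s ∈ T.tiles) (ht : t ∈ T.tiles)
    {k : Fin n} (hsk : s.HasDir k) (htk : t.HasDir k) (h : t.lft v k = s.lft v k) : s = t :=
  T.lft_unique hc hs ht hsk htk (c := 0) (by simp) (by simpa using h)

theorem rgt_inj (hc : General v) {s t : Tile n} (hs : s ∈ T.tiles) (ht : t ∈ T.tiles)
    {k : Fin n} (hsk : s.HasDir k) (htk : t.HasDir k) (h : t.rgt v k = s.rgt v k) : s = t := by
  obtain ⟨x, hx, hx'⟩ := openPara_overlap (b := s.rgt v k + v k) (u := -v k) (w := -s.stp v k)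
    (w' := -t.stp v k) (c := 0) (by simp) (by simpa [cross_neg, neg_cross] using Tile.stp_pos hc hsk)
    (by simpa [cross_neg, neg_cross] using Tile.stp_pos hc htk)
  have flip : ∀ b u w : Plane, openPara (b + u) (-u) w = openPara b u w := fun b u w => by
    rw [openPara_swap, ← openPara_flip, openPara_swap]
  rw [zero_smul, add_zero, ← h, flip, ← Tile.inner_eq_rgt htk] at hx'
  rw [flip, ← Tile.inner_eq_rgt hsk] at hx
  exact T.inner_unique hc hs ht hx (t.inner_subset hx')

/-- A tile on the other side of an edge. -/
theorem exists_neighbour (hc : General v) {t : Tile n} (ht : t ∈ T.tiles) {k : Fin n} {b z : Plane}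
    (hb : (b, k) ∈ t.edges v) (hz : z ∈ zonotope v a) {σ : ℝ}
    (hσ : 0 < σ * (cross (v k) z - cross (v k) b))
    (hσt : ∀ x ∈ t.carrier v, σ * (cross (v k) x - cross (v k) b) ≤ 0) :
    ∃ s ∈ T.tiles, (b, k) ∈ s.edges v ∧
      ∃ x ∈ s.carrier v, 0 < σ * (cross (v k) x - cross (v k) b) := by
  obtain ⟨htk, hbl⟩ := Tile.mem_edges.1 hb
  -- The midpoint of the edge is no vertex of `t` and lies on no other edge of `t`. So a tile that
  -- contains it and reaches beyond the edge can only share this very edge with `t`. Such a tile is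
  -- supplied by `germ` in the direction of `z`.
  set y := b + (1 / 2 : ℝ) • v k with hy
  have hyt : y ∈ t.carrier v := by
    rw [Tile.carrier_eq htk]
    rcases hbl with rfl | rfl
    · exact ⟨1 / 2, 0, by norm_num, by norm_num, by norm_num, by norm_num, by simp [y]⟩
    · refine ⟨1 / 2, 1, by norm_num, by norm_num, by norm_num, by norm_num, ?_⟩
      simp only [y, Tile.rgt, one_smul]; abel
  have hyc : cross (v k) y = cross (v k) b := by
    simp [y, cross_add, cross_smul, cross_self]
  obtain ⟨s, hs, ε, hε, -, hseg⟩ := T.germ hc (T.subset_zonotope ht hyt) hz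
  have hys : y ∈ s.carrier v := by simpa using hseg 0 le_rfl hε.le
  have hx := hseg ε hε.le le_rfl
  have hpos : 0 < σ * (cross (v k) (y + ε • (z - y)) - cross (v k) b) := by
    rw [cross_add, cross_smul, cross_sub, hyc]
    have : σ * (cross (v k) b + ε * (cross (v k) z - cross (v k) b) - cross (v k) b) =
      ε * (σ * (cross (v k) z - cross (v k) b)) := by ring
    rw [this]
    positivity
  refine ⟨s, hs, ?_, _, hx, hpos⟩
  have hne : t ≠ s := by
    rintro rfl
    exact absurd (hσt _ hx) (not_le.2 hpos)
  have hmem : y ∈ t.carrier v ∩ s.carrier v := ⟨hyt, hys⟩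
  have hvk : v k ≠ 0 := by
    intro h0
    have := Tile.stp_pos hc htk
    rw [h0] at this
    simp [cross] at this
  have hstp := Tile.stp_pos hc htk
  have hyl : ∀ r q : ℝ, q = 0 ∨ q = 1 → y = t.lft v k + r • v k + q • t.stp v k →
      (b = t.lft v k ∧ q = 0 ∧ r = 1 / 2) ∨ (b = t.rgt v k ∧ q = 1 ∧ r = 1 / 2) := by
    intro r q hq e
    rcases hbl with h | h <;> rw [h] at hy
    · left
      have := coords_unique hstp.ne' (r := 1 / 2) (s := 0) (r' := r) (s' := q) (by
        have := hy.symm.trans e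
        rw [add_assoc] at this
        simpa using add_left_cancel this)
      exact ⟨h, this.2.symm, this.1.symm⟩
    · right
      have := coords_unique hstp.ne' (r := 1 / 2) (s := 1) (r' := r) (s' := q) (by
        have := hy.symm.trans e
        rw [Tile.rgt, add_assoc, add_assoc] at this
        rw [add_comm, one_smul]
        exact add_left_cancel this)
      exact ⟨h, this.2.symm, this.1.symm⟩
  rcases T.meets t ht s hs hne with h | ⟨p, hp, h⟩ | ⟨e, he, h⟩
  · rw [h] at hmem; exact hmem.elim
  · exfalso
    rw [h] at hmem
    have hpe : p = y := (Set.mem_singleton_iff.1 hmem).symm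
    have hpv := hp.1
    rw [hpe] at hpv
    have hcase : ∃ r q : ℝ, (r = 0 ∨ r = 1) ∧ (q = 0 ∨ q = 1) ∧
        y = t.lft v k + r • v k + q • t.stp v k := by
      have hb4 : ∃ r q : ℝ, (r = 0 ∨ r = 1) ∧ (q = 0 ∨ q = 1) ∧
          y = t.base + r • v k + q • v (t.other k) := by
        have hi : (t.i = k ∧ t.other k = t.j) ∨ (t.j = k ∧ t.other k = t.i) := by
          unfold Tile.other
          rcases htk with h1 | h1
          · left; simp [h1]
          · right; exact ⟨h1, if_neg (fun h2 => t.lt.ne (h2.trans h1.symm))⟩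
        rcases hi with ⟨h1, h2⟩ | ⟨h1, h2⟩ <;> rw [h2, ← h1] <;>
          rcases hpv with h3 | h3 | h3 | h3
        · exact ⟨0, 0, by simp, by simp, by simpa using h3⟩
        · exact ⟨1, 0, by simp, by simp, by simpa using h3⟩
        · exact ⟨0, 1, by simp, by simp, by simpa using h3⟩
        · exact ⟨1, 1, by simp, by simp, by simpa using h3⟩
        · exact ⟨0, 0, by simp, by simp, by simpa using h3⟩
        · exact ⟨0, 1, by simp, by simp, by simpa using h3⟩
        · exact ⟨1, 0, by simp, by simp, by simpa using h3⟩
        · exact ⟨1, 1, by simp, by simp, by rw [h3]; simp; abel⟩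
      obtain ⟨r, q, hr, hq, e⟩ := hb4
      unfold Tile.lft Tile.stp
      split_ifs
      · exact ⟨r, q, hr, hq, e⟩
      · refine ⟨r, 1 - q, hr, by rcases hq with rfl | rfl <;> simp, ?_⟩
        rw [e]; module
    obtain ⟨r, q, hr, hq, e⟩ := hcase
    rcases hyl r q hq e with h1 | h1 <;> rcases hr with h2 | h2 <;> linarith [h1.2.2]
  · rw [h] at hmem
    obtain ⟨b', k'⟩ := e
    suffices hbk : b' = b ∧ k' = k by rw [← hbk.1, ← hbk.2]; exact he.2
    obtain ⟨r, h1, h2, hr⟩ := mem_edgeCarrier.1 hmem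
    obtain ⟨hk', hb'⟩ := Tile.mem_edges.1 he.1
    rcases (Tile.hasDir_iff htk).1 hk' with rfl | hk''
    · refine ⟨?_, rfl⟩
      rcases hb' with h3 | h3
      · rcases hyl r 0 (by simp) (by rw [hr, h3]; simp) with h4 | h4
        · rw [h3, h4.1]
        · norm_num at h4
      · rcases hyl r 1 (by simp) (by rw [hr, h3, Tile.rgt]; simp only [one_smul]; abel) with h4 | h4
        · norm_num at h4
        · rw [h3, h4.1]
    · exfalso
      have hin : ∃ p q : ℝ, (p = 0 ∨ p = 1) ∧ y = t.base + p • v k + q • v (t.other k) := by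
        have ho : (k = t.i ∧ t.other k = t.j) ∨ (k = t.j ∧ t.other k = t.i) := by
          unfold Tile.other
          rcases htk with h1 | h1
          · left; simp [h1]
          · right; exact ⟨h1.symm, if_neg (fun h2 => t.lt.ne (h2.trans h1.symm))⟩
        have hee := he.1
        subst hk''
        have hij := t.lt.ne
        simp only [Tile.edges, Set.mem_insert_iff, Set.mem_singleton_iff, Prod.mk.injEq] at hee
        rcases ho with ⟨o1, o2⟩ | ⟨o1, o2⟩ <;> rw [o2] at hee hr ⊢ <;> rw [o1] <;>
          rcases hee with h3 | h3 | h3 | h3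
        · exact absurd h3.2.symm hij
        · exact absurd h3.2.symm hij
        · exact ⟨0, r, by simp, by rw [hr, h3.1]; simp⟩
        · exact ⟨1, r, by simp, by rw [hr, h3.1]; simp⟩
        · exact ⟨0, r, by simp, by rw [hr, h3.1]; simp⟩
        · exact ⟨1, r, by simp, by rw [hr, h3.1]; simp⟩
        · exact absurd h3.2 hij
        · exact absurd h3.2 hij
      obtain ⟨p, q, hp, e⟩ := hin
      have hbb : ∃ q' : ℝ, b = t.base + q' • v (t.other k) := by
        rcases hbl with h | h <;> rw [h]
        · unfold Tile.lft; split_ifs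
          · exact ⟨0, by simp⟩
          · exact ⟨1, by simp⟩
        · unfold Tile.rgt Tile.lft Tile.stp; split_ifs
          · exact ⟨1, by simp⟩
          · exact ⟨0, by simp⟩
      obtain ⟨q', hq'⟩ := hbb
      have := coords_unique (hc k (t.other k) (Tile.other_ne htk).symm) (r := 1 / 2) (s := q')
        (r' := p) (s' := q) (by
          have := hy.symm.trans e
          rw [hq', add_assoc, add_assoc] at this
          rw [add_comm]
          exact add_left_cancel this)
      rcases hp with rfl | rfl <;> linarith [this.1]

end Tiling
end RhombusTiling

end

/-! ### Ribbons as chains of tiles, and their level functions -/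

noncomputable section

namespace RhombusTiling
variable {n : ℕ} {v : Fin n → Plane} {a : Fin n → ℕ}

theorem Tile.ne_zero (hc : General v) {t : Tile n} {k : Fin n} (h : t.HasDir k) : v k ≠ 0 := by
  intro h0
  have := Tile.stp_pos hc h
  rw [h0] at this
  simp [cross] at this

theorem Tile.cross_lft_lt_rgt (hc : General v) {t : Tile n} {k : Fin n} (h : t.HasDir k) :
    cross (v k) (t.lft v k) < cross (v k) (t.rgt v k) := by
  rw [Tile.rgt, cross_add]
  linarith [Tile.stp_pos hc h]

/-- The origin of the first edge of the ribbon of a line. -/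
def startPt (v : Fin n → Plane) (a : Fin n → ℕ) (l : Line a) : Plane :=
  corner v a l.1 + (l.2 : ℝ) • v l.1

namespace Tiling
variable (T : Tiling v a)

/-- Some tile has `b` and `b'` as origins of its left and right edge parallel to `v k`. -/
def Nxt (k : Fin n) (b b' : Plane) : Prop :=
  ∃ t ∈ T.tiles, t.HasDir k ∧ t.lft v k = b ∧ t.rgt v k = b'

/-- There is a chain of tiles from one edge parallel to `v k` to another one. -/
def Reach (k : Fin n) (b b' : Plane) : Prop := Relation.ReflTransGen (T.Nxt k) b b'

variable {T}

theorem Nxt.lt (hc : General v) {k : Fin n} {b b' : Plane} (h : T.Nxt k b b') :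
    cross (v k) b < cross (v k) b' := by
  obtain ⟨t, -, ht, rfl, rfl⟩ := h
  exact Tile.cross_lft_lt_rgt hc ht

theorem Nxt.right_unique (hc : General v) {k : Fin n} {b c d : Plane} (h : T.Nxt k b c)
    (h' : T.Nxt k b d) : c = d := by
  obtain ⟨t, ht, htk, h1, rfl⟩ := h
  obtain ⟨s, hs, hsk, h2, rfl⟩ := h'
  rw [T.lft_inj hc ht hs htk hsk (h2.trans h1.symm)]

theorem Nxt.left_unique (hc : General v) {k : Fin n} {b c d : Plane} (h : T.Nxt k c b)
    (h' : T.Nxt k d b) : c = d := by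
  obtain ⟨t, ht, htk, rfl, h1⟩ := h
  obtain ⟨s, hs, hsk, rfl, h2⟩ := h'
  rw [T.rgt_inj hc ht hs htk hsk (h2.trans h1.symm)]

theorem Reach.le (hc : General v) {k : Fin n} {b b' : Plane} (h : T.Reach k b b') :
    cross (v k) b ≤ cross (v k) b' := by
  induction h with
  | refl => exact le_rfl
  | tail _ h ih => exact ih.trans (h.lt hc).le

theorem Reach.total (hc : General v) {k : Fin n} {b c d : Plane} (h : T.Reach k b c)
    (h' : T.Reach k b d) : T.Reach k c d ∨ T.Reach k d c :=
  Relation.ReflTransGen.total_of_right_unique (fun _ _ _ h1 h2 => h1.right_unique hc h2) h h'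

theorem Reach.total_left (hc : General v) {k : Fin n} {b c d : Plane} (h : T.Reach k c b)
    (h' : T.Reach k d b) : T.Reach k c d ∨ T.Reach k d c := by
  have := Relation.ReflTransGen.total_of_right_unique (r := Function.swap (T.Nxt k))
    (fun _ _ _ h1 h2 => Nxt.left_unique hc h1 h2) (Relation.reflTransGen_swap.2 h)
    (Relation.reflTransGen_swap.2 h')
  rcases this with h | h
  · exact Or.inr (Relation.reflTransGen_swap.1 h)
  · exact Or.inl (Relation.reflTransGen_swap.1 h)

variable (T)

theorem exists_right (hc : General v) {t : Tile n} (ht : t ∈ T.tiles) {k : Fin n}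
    (hk : t.HasDir k) (h : cross (v k) (t.rgt v k) < hi v a k) :
    ∃ s ∈ T.tiles, s.HasDir k ∧ s.lft v k = t.rgt v k := by
  obtain ⟨z, hz, hzc⟩ := exists_hi v a k
  obtain ⟨s, hs, hse, x, hx, hpos⟩ := T.exists_neighbour hc ht (Tile.mem_edges.2 ⟨hk, Or.inr rfl⟩)
    hz (σ := 1) (by linarith) (fun x hx => by linarith [(Tile.cross_mem hc hk hx).2])
  obtain ⟨hsk, h1⟩ := Tile.mem_edges.1 hse
  refine ⟨s, hs, hsk, (h1.resolve_right fun h2 => ?_).symm⟩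
  have := (Tile.cross_mem hc hsk hx).2
  rw [← h2] at this
  linarith

theorem exists_left (hc : General v) {t : Tile n} (ht : t ∈ T.tiles) {k : Fin n}
    (hk : t.HasDir k) (h : lo v a k < cross (v k) (t.lft v k)) :
    ∃ s ∈ T.tiles, s.HasDir k ∧ s.rgt v k = t.lft v k := by
  have hz : corner v a k + (0 : ℝ) • v k ∈ zonotope v a := corner_add_mem k le_rfl (by positivity)
  have hzc := cross_corner_add (v := v) (a := a) k 0
  obtain ⟨s, hs, hse, x, hx, hpos⟩ := T.exists_neighbour hc ht (Tile.mem_edges.2 ⟨hk, Or.inl rfl⟩)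
    hz (σ := -1) (by linarith) (fun x hx => by linarith [(Tile.cross_mem hc hk hx).1])
  obtain ⟨hsk, h1⟩ := Tile.mem_edges.1 hse
  refine ⟨s, hs, hsk, (h1.resolve_left fun h2 => ?_).symm⟩
  have := (Tile.cross_mem hc hsk hx).1
  rw [← h2] at this
  linarith

/-- On a tile without edges parallel to `v k`, the function `cross (v k)` has its minimum at one
vertex only, whereas here it is minimal on a whole segment. -/
theorem left_face (hc : General v) {t : Tile n} (ht : t ∈ T.tiles) {k : Fin n} {x : Plane} {ε : ℝ}
    (hε : 0 < ε) (hx : x ∈ t.carrier v) (hx' : x + ε • v k ∈ t.carrier v)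
    (hlo : cross (v k) x = lo v a k) (hvk : v k ≠ 0) :
    t.HasDir k ∧ ∃ r, 0 ≤ r ∧ r + ε ≤ 1 ∧ x = t.lft v k + r • v k := by
  have hmin : ∀ y ∈ t.carrier v, lo v a k ≤ cross (v k) y :=
    fun y hy => lo_le (T.subset_zonotope ht hy) k
  have hlo' : cross (v k) (x + ε • v k) = lo v a k := by
    rw [cross_add, cross_smul, cross_self]; linarith
  by_cases hk : t.HasDir k
  · refine ⟨hk, ?_⟩
    have hl := hmin _ (Tile.lft_mem hk)
    have hst := Tile.stp_pos hc hk
    rw [Tile.carrier_eq hk] at hx hx'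
    obtain ⟨r, s, h1, h2, h3, h4, e⟩ := hx
    obtain ⟨r', s', h1', h2', h3', h4', e'⟩ := hx'
    have hs : s = 0 := by
      have := congrArg (cross (v k)) e
      simp only [cross_add, cross_smul, cross_self] at this
      nlinarith
    have hs' : s' = 0 := by
      have := congrArg (cross (v k)) e'
      rw [hlo'] at this
      simp only [cross_add, cross_smul, cross_self] at this
      nlinarith
    subst hs hs'
    refine ⟨r, h1, ?_, by simpa using e⟩
    have h5 : (r + ε) • v k + (0 : ℝ) • t.stp v k = r' • v k + (0 : ℝ) • t.stp v k := by
      rw [e] at e'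
      have : t.lft v k + ((r + ε) • v k + (0 : ℝ) • t.stp v k) =
        t.lft v k + (r' • v k + (0 : ℝ) • t.stp v k) := by
        rw [← add_assoc _ (r' • v k), ← e']; module
      exact add_left_cancel this
    rw [(coords_unique hst.ne' h5).1]
    exact h2'
  · exfalso
    have hki : k ≠ t.i := fun h => hk (Or.inl h.symm)
    have hkj : k ≠ t.j := fun h => hk (Or.inr h.symm)
    have hci := hc k _ hki
    have hcj := hc k _ hkj
    obtain ⟨r, s, h1, h2, h3, h4, e⟩ := hx
    obtain ⟨r', s', h1', h2', h3', h4', e'⟩ := hx'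
    have key : ∀ p q : ℝ, 0 ≤ p → p ≤ 1 → 0 ≤ q → q ≤ 1 →
        lo v a k ≤ cross (v k) t.base + p * cross (v k) (v t.i) + q * cross (v k) (v t.j) := by
      intro p q hp hp' hq hq'
      have := hmin _ ⟨p, q, hp, hp', hq, hq', rfl⟩
      simpa only [cross_add, cross_smul] using this
    have a1 := congrArg (cross (v k)) e
    have a2 := congrArg (cross (v k)) e'
    rw [hlo'] at a2
    rw [hlo] at a1
    simp only [cross_add, cross_smul] at a1 a2
    have hrr : r = r' := by
      rcases lt_or_gt_of_ne hci with h | h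
      · have b1 := key 1 s (by simp) (by simp) h3 h4
        have b2 := key 1 s' (by simp) (by simp) h3' h4'
        have : r = 1 := by nlinarith
        have : r' = 1 := by nlinarith
        linarith
      · have b1 := key 0 s (by simp) (by simp) h3 h4
        have b2 := key 0 s' (by simp) (by simp) h3' h4'
        have : r = 0 := by nlinarith
        have : r' = 0 := by nlinarith
        linarith
    have hss : s = s' := by
      subst hrr
      exact mul_right_cancel₀ hcj (by linarith)
    rw [e, hrr, hss] at e'
    have : ε • v k = 0 := by simpa using e'
    rcases smul_eq_zero.1 this with h | h
    · exact hε.ne' h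
    · exact hvk h

/-- By induction along the side of the zonotope. A tile that contains the beginning of the next unit
has its left edge on the side; if that edge began earlier, it would overlap the edge of the
preceding tile, or, for `m = 0`, leave the zonotope. -/
theorem exists_corner_tile (hc : General v) {k : Fin n} (hv : v k ≠ 0) (m : ℕ)
    (hma : (m : ℝ) + 1 ≤ a k) :
    ∃ t ∈ T.tiles, t.HasDir k ∧ t.lft v k = corner v a k + (m : ℝ) • v k := by
  have hc' : ∀ c d : ℝ, corner v a k + c • v k = corner v a k + d • v k → c = d := fun c d h =>
    smul_left_injective ℝ hv (add_left_cancel h)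
  have hseg : ∀ m : ℕ, (m : ℝ) + 1 ≤ a k → ∃ t ∈ T.tiles, t.HasDir k ∧ ∃ r ε : ℝ, 0 < ε ∧
      0 ≤ r ∧ r + ε ≤ 1 ∧ corner v a k + (m : ℝ) • v k = t.lft v k + r • v k := by
    intro m hma
    obtain ⟨t, ht, ε, hε, hε1, hseg⟩ := T.germ hc
      (corner_add_mem (v := v) k (by positivity : (0 : ℝ) ≤ m) (by linarith))
      (corner_add_mem (v := v) k (by positivity : (0 : ℝ) ≤ m + 1) hma)
    have e : corner v a k + ((m : ℝ) + 1) • v k - (corner v a k + (m : ℝ) • v k) = v k := by module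
    rw [e] at hseg
    obtain ⟨htk, r, h1, h2, h3⟩ := T.left_face hc ht hε (by simpa using hseg 0 le_rfl hε.le)
      (hseg ε hε.le le_rfl) (cross_corner_add k _) hv
    exact ⟨t, ht, htk, r, ε, hε, h1, h2, h3⟩
  induction m with
  | zero =>
    obtain ⟨t, ht, htk, r, ε, hε, h1, h2, h3⟩ := hseg _ hma
    refine ⟨t, ht, htk, ?_⟩
    suffices hr : r = 0 by rw [h3, hr]; simp
    have hl : cross (v k) (t.lft v k) = lo v a k := by
      have := congrArg (cross (v k)) h3
      rw [cross_corner_add, cross_add, cross_smul, cross_self] at this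
      linarith
    obtain ⟨c, c0, -, hcc⟩ := eq_corner_add hc (T.subset_zonotope ht (Tile.lft_mem htk)) hl
    rw [hcc, add_assoc, ← add_smul] at h3
    have := hc' _ _ h3
    push_cast at this
    linarith
  | succ m ih =>
    obtain ⟨t, ht, htk, r, ε, hε, h1, h2, h3⟩ := hseg _ hma
    refine ⟨t, ht, htk, ?_⟩
    suffices hr : r = 0 by rw [h3, hr]; simp
    by_contra hr
    have hr' : 0 < r := lt_of_le_of_ne h1 (Ne.symm hr)
    obtain ⟨s, hs, hsk, hsl⟩ := ih (by push_cast at hma; linarith)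
    have e : t.lft v k = s.lft v k + (1 - r) • v k := by
      rw [hsl, eq_sub_of_add_eq h3.symm]
      push_cast
      module
    have hst := T.lft_unique hc hs ht hsk htk (abs_lt.2 ⟨by linarith, by linarith⟩) e
    subst hst
    have : (1 - r) • v k = 0 := by simpa using e
    rcases smul_eq_zero.1 this with h | h
    · linarith
    · exact hv h

theorem exists_start_tile (hc : General v) (l : Line a) (hv : v l.1 ≠ 0) :
    ∃ t ∈ T.tiles, t.HasDir l.1 ∧ t.lft v l.1 = startPt v a l :=
  T.exists_corner_tile hc hv l.2 (by exact_mod_cast l.2.2)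

/-- The number is the integer part of the position on the side: the tile already known to start
there has an overlapping left edge, hence is the same tile. -/
theorem exists_startPt (hc : General v) {t : Tile n} (ht : t ∈ T.tiles) {k : Fin n}
    (hk : t.HasDir k) (h : cross (v k) (t.lft v k) = lo v a k) :
    ∃ m : Fin (a k), t.lft v k = startPt v a ⟨k, m⟩ := by
  have hv := Tile.ne_zero hc hk
  obtain ⟨c, c0, -, hcc⟩ := eq_corner_add hc (T.subset_zonotope ht (Tile.lft_mem hk)) h
  have hmem : t.lft v k + v k ∈ t.carrier v := by
    rw [Tile.carrier_eq hk]
    exact ⟨1, 0, by simp⟩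
  obtain ⟨d, -, d1, hd⟩ := eq_corner_add hc (k := k) (T.subset_zonotope ht hmem)
    (by rw [cross_add, cross_self, h, add_zero])
  have hcd : c + 1 = d := by
    rw [hcc, add_assoc] at hd
    have := add_left_cancel hd
    refine smul_left_injective ℝ hv ?_
    simp only [← this]
    module
  have hfl := Nat.floor_le c0
  have hlt := Nat.lt_floor_add_one c
  have hm : ⌊c⌋₊ < a k := by
    have : (⌊c⌋₊ : ℝ) < a k := by linarith
    exact_mod_cast this
  refine ⟨⟨_, hm⟩, ?_⟩
  obtain ⟨s, hs, hsk, hsl⟩ := T.exists_corner_tile hc hv ⌊c⌋₊ (by exact_mod_cast hm)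
  have hst := T.lft_unique hc hs ht hsk hk (c := c - ⌊c⌋₊)
    (abs_lt.2 ⟨by linarith, by linarith⟩) (by rw [hcc, hsl]; module)
  subst hst
  exact hsl

/-- Every edge can be traced back to the start of a ribbon. -/
theorem exists_reach (hc : General v) {t : Tile n} (ht : t ∈ T.tiles) {k : Fin n}
    (hk : t.HasDir k) : ∃ m : Fin (a k), T.Reach k (startPt v a ⟨k, m⟩) (t.lft v k) := by
  have hfin := T.finite_tiles hc
  induction hN : {s | s ∈ T.tiles ∧ cross (v k) (s.lft v k) < cross (v k) (t.lft v k)}.ncard using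
    Nat.strong_induction_on generalizing t with
  | _ N ih =>
    rcases (lo_le (T.subset_zonotope ht (Tile.lft_mem hk)) k).eq_or_lt with h | h
    · obtain ⟨m, hm⟩ := T.exists_startPt hc ht hk h.symm
      exact ⟨m, by rw [hm]; exact Relation.ReflTransGen.refl⟩
    · obtain ⟨s, hs, hsk, hsr⟩ := T.exists_left hc ht hk h
      have hlt := Tile.cross_lft_lt_rgt hc hsk
      rw [hsr] at hlt
      obtain ⟨m, hm⟩ := ih _ (by
        rw [← hN]
        refine Set.ncard_lt_ncard ⟨fun u hu => ⟨hu.1, hu.2.trans hlt⟩, fun hsub => ?_⟩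
          (hfin.subset fun u hu => hu.1)
        exact lt_irrefl _ (hsub ⟨hs, hlt⟩ : s ∈ _ ∧ _).2) hs hsk rfl
      exact ⟨m, hm.tail ⟨s, hs, hsk, rfl, hsr⟩⟩

/-- The edge of a ribbon determines the line. -/
theorem reach_unique (hc : General v) {k : Fin n} (hv : v k ≠ 0) {m m' : Fin (a k)} {b : Plane}
    (h : T.Reach k (startPt v a ⟨k, m⟩) b) (h' : T.Reach k (startPt v a ⟨k, m'⟩) b) : m = m' := by
  have key : ∀ {m m' : Fin (a k)}, T.Reach k (startPt v a ⟨k, m⟩) (startPt v a ⟨k, m'⟩) →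
      m = m' := by
    intro m m' h
    rcases Relation.ReflTransGen.cases_head h with h1 | ⟨c, h1, h2⟩
    · have := smul_left_injective ℝ hv (add_left_cancel h1)
      exact Fin.ext (by exact_mod_cast this)
    · have h3 := h1.lt hc
      have h4 := Reach.le hc h2
      simp only [startPt, cross_corner_add] at h3 h4
      exact absurd h4 (not_le.2 h3)
  rcases Reach.total_left hc h h' with h1 | h1
  · exact key h1
  · exact (key h1).symm

/-- The position of a point in direction `v k`, relative to a tile. -/
def tileLevel (v : Fin n → Plane) (t : Tile n) (k : Fin n) (x : Plane) : ℝ :=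
  cross (x - t.lft v k) (t.stp v k) / cross (v k) (t.stp v k)

theorem continuous_tileLevel (t : Tile n) (k : Fin n) : Continuous (tileLevel v t k) :=
  ((continuous_cross_left _).comp (continuous_id.sub continuous_const)).div_const _

theorem tileLevel_add (hc : General v) {t : Tile n} {k : Fin n} (hk : t.HasDir k) (x : Plane)
    (c : ℝ) : tileLevel v t k (x + c • v k) = tileLevel v t k x + c := by
  have := (Tile.stp_pos hc hk).ne'
  unfold tileLevel
  rw [add_sub_right_comm, add_cross, smul_cross]
  field_simp

theorem tileLevel_stp (t : Tile n) (k : Fin n) (s : ℝ) :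
    tileLevel v t k (t.lft v k + s • t.stp v k) = 0 := by
  unfold tileLevel
  rw [add_sub_cancel_left, smul_cross, cross_self]
  simp

/-- The affine functions `tileLevel` are glued from right to left along the ribbon. On the line
through a common edge two neighbouring ones agree, since both grow with unit speed along `v k` and
vanish at the origin of the edge. With such a function the two sides of a ribbon become a sublevel
and a superlevel set. -/
theorem exists_level (hc : General v) {t : Tile n} (ht : t ∈ T.tiles) {k : Fin n}
    (hk : t.HasDir k) : ∃ A : Plane → ℝ, Continuous A ∧ (∀ x c, A (x + c • v k) = A x + c) ∧
      (∀ s ∈ T.tiles, s.HasDir k → T.Reach k (t.lft v k) (s.lft v k) →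
        ∀ c : ℝ, 0 ≤ c → c ≤ 1 → A (s.lft v k + c • s.stp v k) = 0) ∧
      (∀ x, cross (v k) (t.lft v k) ≤ cross (v k) x → cross (v k) x ≤ hi v a k →
        ∃ s ∈ T.tiles, s.HasDir k ∧ T.Reach k (t.lft v k) (s.lft v k) ∧
          cross (v k) (s.lft v k) ≤ cross (v k) x ∧ cross (v k) x ≤ cross (v k) (s.rgt v k)) := by
  have hfin := T.finite_tiles hc
  induction hN : {s | s ∈ T.tiles ∧ cross (v k) (t.lft v k) < cross (v k) (s.lft v k)}.ncard using
    Nat.strong_induction_on generalizing t with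
  | _ N ih =>
    have hlt := Tile.cross_lft_lt_rgt hc hk
    have hst := Tile.stp_pos hc hk
    have hcase : ∀ s ∈ T.tiles, s.HasDir k → T.Reach k (t.lft v k) (s.lft v k) →
        s = t ∨ T.Reach k (t.rgt v k) (s.lft v k) := by
      intro s hs hsk h
      rcases Relation.ReflTransGen.cases_head h with h1 | ⟨c, h1, h2⟩
      · exact Or.inl (T.lft_inj hc ht hs hk hsk h1.symm).symm
      · rw [h1.right_unique hc ⟨t, ht, hk, rfl, rfl⟩] at h2
        exact Or.inr h2
    rcases (le_hi (T.subset_zonotope ht (Tile.rgt_mem hk)) k).eq_or_lt with h | h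
    · refine ⟨tileLevel v t k, continuous_tileLevel t k, tileLevel_add hc hk, ?_, ?_⟩
      · intro s hs hsk hr c _ _
        rcases hcase s hs hsk hr with rfl | h1
        · exact tileLevel_stp s k c
        · have h2 := Reach.le hc h1
          have h3 := Tile.cross_lft_lt_rgt hc hsk
          have h4 := le_hi (T.subset_zonotope hs (Tile.rgt_mem hsk)) k
          linarith
      · intro x h1 h2
        exact ⟨t, ht, hk, Relation.ReflTransGen.refl, h1, h2.trans h.ge⟩
    · obtain ⟨s, hs, hsk, hsr⟩ := T.exists_right hc ht hk h
      rw [← hsr] at hlt hcase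
      have hnx : T.Nxt k (t.lft v k) (s.lft v k) := ⟨t, ht, hk, rfl, hsr.symm⟩
      obtain ⟨A, A1, A2, A3, A4⟩ := ih _ (by
        rw [← hN]
        refine Set.ncard_lt_ncard ⟨fun u hu => ⟨hu.1, hlt.trans hu.2⟩, fun hsub => ?_⟩
          (hfin.subset fun u hu => hu.1)
        exact lt_irrefl _ (hsub ⟨hs, hlt⟩ : s ∈ _ ∧ _).2) hs hsk rfl
      have A0 : A (s.lft v k) = 0 := by
        simpa using A3 s hs hsk Relation.ReflTransGen.refl 0 le_rfl zero_le_one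
      have hagree : ∀ x, cross (v k) x = cross (v k) (s.lft v k) → tileLevel v t k x = A x := by
        intro x hx
        have e := eq_coords hst.ne' (x - s.lft v k)
        rw [cross_sub, hx, sub_self, zero_div, zero_smul, add_zero] at e
        set c := cross (x - s.lft v k) (t.stp v k) / cross (v k) (t.stp v k)
        have ex : x = s.lft v k + c • v k := by rw [← e]; abel
        rw [ex, A2, A0, tileLevel_add hc hk, hsr, Tile.rgt]
        have := tileLevel_stp (v := v) t k 1
        rw [one_smul] at this
        rw [this]
      refine ⟨fun x => if cross (v k) x ≤ cross (v k) (s.lft v k) then tileLevel v t k x else A x,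
        ?_, ?_, ?_, ?_⟩
      · exact Continuous.if_le (continuous_tileLevel t k) A1 (continuous_cross _) continuous_const
          hagree
      · intro x c
        have : cross (v k) (x + c • v k) = cross (v k) x := by
          rw [cross_add, cross_smul, cross_self]; ring
        simp only [this]
        split_ifs
        · exact tileLevel_add hc hk x c
        · exact A2 x c
      · intro u hu huk hr c c0 c1
        beta_reduce
        rcases hcase u hu huk hr with rfl | h1
        · rw [if_pos]
          · exact tileLevel_stp u k c
          · rw [hsr, Tile.rgt, cross_add, cross_add, cross_smul]
            nlinarith
        · have h2 := Reach.le hc h1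
          have h3 := Tile.stp_pos hc huk
          split_ifs with h4
          · rw [hagree]
            · exact A3 u hu huk h1 c c0 c1
            · refine le_antisymm h4 ?_
              rw [cross_add, cross_smul]
              nlinarith
          · exact A3 u hu huk h1 c c0 c1
      · intro x h1 h2
        by_cases h3 : cross (v k) x ≤ cross (v k) (s.lft v k)
        · exact ⟨t, ht, hk, Relation.ReflTransGen.refl, h1, by rwa [← hsr]⟩
        · obtain ⟨u, hu, huk, hr, h4⟩ := A4 x (not_le.1 h3).le h2
          exact ⟨u, hu, huk, Relation.ReflTransGen.head hnx hr, h4⟩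

end Tiling
end RhombusTiling

end

/-! ### The tiles on a line -/

noncomputable section

namespace RhombusTiling
variable {n : ℕ} {v : Fin n → Plane} {a : Fin n → ℕ}

theorem General.ne_zero [Nontrivial (Fin n)] (hc : General v) (k : Fin n) : v k ≠ 0 := by
  obtain ⟨j, hj⟩ := exists_ne k
  intro h
  have := hc k j hj.symm
  rw [h] at this
  simp [cross] at this

theorem cross_startPt (l : Line a) : cross (v l.1) (startPt v a l) = lo v a l.1 :=
  cross_corner_add _ _

theorem startPt_mem (l : Line a) : startPt v a l ∈ zonotope v a :=
  corner_add_mem _ (by positivity) (by exact_mod_cast l.2.2.le)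

theorem para_subset_closure (b u w : Plane) : para b u w ⊆ closure (openPara b u w) := by
  rintro x ⟨r, s, h1, h2, h3, h4, rfl⟩
  have hlim : Filter.Tendsto (fun m : ℕ => (b + r • u + s • w) + (1 / ((m : ℝ) + 1)) •
      ((b + (1 / 2 : ℝ) • u + (1 / 2 : ℝ) • w) - (b + r • u + s • w))) Filter.atTop
      (nhds ((b + r • u + s • w) + (0 : ℝ) •
        ((b + (1 / 2 : ℝ) • u + (1 / 2 : ℝ) • w) - (b + r • u + s • w)))) :=
    tendsto_const_nhds.add (tendsto_one_div_add_atTop_nhds_zero_nat.smul_const _)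
  rw [zero_smul, add_zero] at hlim
  refine mem_closure_of_tendsto hlim (Filter.Eventually.of_forall fun m => ?_)
  have p1 : (0 : ℝ) < 1 / ((m : ℝ) + 1) := by positivity
  have p2 : (1 : ℝ) / ((m : ℝ) + 1) ≤ 1 := by
    rw [div_le_one (by positivity)]; linarith [Nat.cast_nonneg (α := ℝ) m]
  set ε := (1 : ℝ) / ((m : ℝ) + 1)
  refine ⟨r + ε * (1 / 2 - r), s + ε * (1 / 2 - s), ?_, ?_, ?_, ?_, by module⟩ <;> nlinarith

namespace Tiling
variable (T : Tiling v a)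

/-- The tile `t` of `T` belongs to the ribbon of the line `l`. -/
def On (l : Line a) (t : Tile n) : Prop :=
  t ∈ T.tiles ∧ t.HasDir l.1 ∧ T.Reach l.1 (startPt v a l) (t.lft v l.1)

variable {T}

theorem On.reach_rgt {l : Line a} {t : Tile n} (h : T.On l t) :
    T.Reach l.1 (startPt v a l) (t.rgt v l.1) := h.2.2.tail ⟨t, h.1, h.2.1, rfl, rfl⟩

theorem On.next {l : Line a} {t s : Tile n} (h : T.On l t) (hs : s ∈ T.tiles)
    (hsl : s.HasDir l.1) (e : s.lft v l.1 = t.rgt v l.1) : T.On l s :=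
  ⟨hs, hsl, by rw [e]; exact h.reach_rgt⟩

theorem On.prev (hc : General v) {l : Line a} {t s : Tile n} (h : T.On l t) (hs : s ∈ T.tiles)
    (hsl : s.HasDir l.1) (e : s.rgt v l.1 = t.lft v l.1) : T.On l s := by
  refine ⟨hs, hsl, ?_⟩
  rcases Relation.ReflTransGen.cases_tail h.2.2 with h1 | ⟨c, h1, h2⟩
  · have h3 := Tile.cross_lft_lt_rgt hc hsl
    have h4 := lo_le (T.subset_zonotope hs (Tile.lft_mem hsl)) l.1
    rw [e, h1, cross_startPt] at h3
    linarith
  · rwa [Nxt.left_unique hc ⟨s, hs, hsl, rfl, e⟩ h2]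

theorem On.eq_of_fst_eq (hc : General v) {l m : Line a} {t : Tile n} (h : T.On l t)
    (h' : T.On m t) (e : l.1 = m.1) : l = m := by
  obtain ⟨k, l⟩ := l
  obtain ⟨k', m⟩ := m
  obtain rfl : k = k' := e
  rw [T.reach_unique hc (Tile.ne_zero hc h.2.1) h.2.2 h'.2.2]

theorem On.reach_or (hc : General v) {l : Line a} {t s : Tile n} (h : T.On l t) (h' : T.On l s) :
    t = s ∨ T.Reach l.1 (t.rgt v l.1) (s.lft v l.1) ∨ T.Reach l.1 (s.rgt v l.1) (t.lft v l.1) := by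
  have key : ∀ {t s : Tile n}, T.On l t → T.On l s → T.Reach l.1 (t.lft v l.1) (s.lft v l.1) →
      t = s ∨ T.Reach l.1 (t.rgt v l.1) (s.lft v l.1) := by
    intro t s h h' h1
    rcases Relation.ReflTransGen.cases_head h1 with h2 | ⟨c, h2, h3⟩
    · exact Or.inl (T.lft_inj hc h.1 h'.1 h.2.1 h'.2.1 h2.symm)
    · rw [h2.right_unique hc ⟨t, h.1, h.2.1, rfl, rfl⟩] at h3
      exact Or.inr h3
  rcases Reach.total hc h.2.2 h'.2.2 with h1 | h1
  · rcases key h h' h1 with h2 | h2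
    · exact Or.inl h2
    · exact Or.inr (Or.inl h2)
  · rcases key h' h h1 with h2 | h2
    · exact Or.inl h2.symm
    · exact Or.inr (Or.inr h2)

theorem On.reach_rgt_of_lt (hc : General v) {l : Line a} {t s : Tile n} (h : T.On l t)
    (h' : T.On l s) (hlt : cross (v l.1) (t.lft v l.1) < cross (v l.1) (s.lft v l.1)) :
    T.Reach l.1 (t.rgt v l.1) (s.lft v l.1) := by
  rcases h.reach_or hc h' with rfl | h1 | h1
  · exact absurd hlt (lt_irrefl _)
  · exact h1
  · have := Reach.le hc h1
    have := Tile.cross_lft_lt_rgt hc h'.2.1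
    linarith

theorem On.eq_of_cross_eq (hc : General v) {l : Line a} {t s : Tile n} (h : T.On l t)
    (h' : T.On l s) (e : cross (v l.1) (t.lft v l.1) = cross (v l.1) (s.lft v l.1)) : t = s := by
  rcases h.reach_or hc h' with h1 | h1 | h1
  · exact h1
  · have := Reach.le hc h1
    have := Tile.cross_lft_lt_rgt hc h.2.1
    linarith
  · have := Reach.le hc h1
    have := Tile.cross_lft_lt_rgt hc h'.2.1
    linarith

theorem not_on_of_ne {l m r : Line a} (hlm : l.1 ≠ m.1) (hlr : l.1 ≠ r.1) (hmr : m.1 ≠ r.1)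
    {t : Tile n} (h1 : T.On l t) (h2 : T.On m t) : ¬ T.On r t := by
  intro h3
  have e1 := ((Tile.hasDir_iff h1.2.1).1 h2.2.1).resolve_left hlm.symm
  have e2 := ((Tile.hasDir_iff h1.2.1).1 h3.2.1).resolve_left hlr.symm
  exact hmr (e1.trans e2.symm)

theorem exists_on (hc : General v) {t : Tile n} (ht : t ∈ T.tiles) {k : Fin n} (hk : t.HasDir k) :
    ∃ m : Fin (a k), T.On ⟨k, m⟩ t := by
  obtain ⟨m, hm⟩ := T.exists_reach hc ht hk
  exact ⟨m, ht, hk, hm⟩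

variable [Nontrivial (Fin n)]

/-- Adjacency is symmetric, while `Reach` only moves towards larger `cross (v l.1)`. They give the
same tiles because an edge has at most one tile on each side and a chain cannot be continued
backwards beyond its start. -/
theorem mem_ribbon (hc : General v) {l : Line a} {t : Tile n} : t ∈ ribbon T l ↔ T.On l t := by
  constructor
  · rintro ⟨s, hs, hse, h⟩
    obtain ⟨hsk, hb⟩ := Tile.mem_edges.1 hse
    have hlt := Tile.cross_lft_lt_rgt hc hsk
    have hlo := lo_le (T.subset_zonotope hs (Tile.lft_mem hsk)) l.1
    have hs0 : T.On l s := by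
      refine ⟨hs, hsk, ?_⟩
      rcases hb with hb | hb
      · rw [← hb]; exact Relation.ReflTransGen.refl
      · rw [← hb] at hlt
        have : cross (v l.1) (corner v a l.1 + (l.2 : ℝ) • v l.1) = lo v a l.1 := cross_startPt l
        linarith
    induction h with
    | refl => exact hs0
    | @tail t t' _ h ih =>
      obtain ⟨ht, ht', hne, b, hb, hb'⟩ := h
      obtain ⟨h1, h2⟩ := Tile.mem_edges.1 hb
      obtain ⟨h1', h2'⟩ := Tile.mem_edges.1 hb'
      rcases h2 with h2 | h2 <;> rcases h2' with h2' | h2'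
      · exact absurd (T.lft_inj hc ht ht' h1 h1' (h2'.symm.trans h2)) hne
      · exact ih.prev hc ht' h1' (h2'.symm.trans h2)
      · exact ih.next ht' h1' (h2'.symm.trans h2)
      · exact absurd (T.rgt_inj hc ht ht' h1 h1' (h2'.symm.trans h2)) hne
  · rintro ⟨ht, hk, hr⟩
    obtain ⟨s, hs, hsk, hsl⟩ := T.exists_start_tile hc l (hc.ne_zero _)
    refine ⟨s, hs, Tile.mem_edges.2 ⟨hsk, Or.inl hsl.symm⟩, ?_⟩
    generalize hb : t.lft v l.1 = b at hr
    induction hr generalizing t with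
    | refl =>
      rw [T.lft_inj hc hs ht hsk hk (hb.trans hsl.symm)]
    | tail _ h ih =>
      obtain ⟨u, hu, huk, hul, hur⟩ := h
      refine (ih hu huk hul).tail ⟨hu, ht, ?_, _, Tile.mem_edges.2 ⟨huk, Or.inr rfl⟩,
        Tile.mem_edges.2 ⟨hk, Or.inl (hur.trans hb.symm)⟩⟩
      rintro rfl
      have := Tile.cross_lft_lt_rgt hc huk
      rw [hur, hb] at this
      exact lt_irrefl _ this

/-! ### The level function of a line -/

theorem exists_level_line (T : Tiling v a) (hc : General v) (l : Line a) :
    ∃ A : Plane → ℝ, Continuous A ∧ (∀ x c, A (x + c • v l.1) = A x + c) ∧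
      (∀ t, T.On l t → ∀ c : ℝ, 0 ≤ c → c ≤ 1 → A (t.lft v l.1 + c • t.stp v l.1) = 0) ∧
      (∀ x ∈ zonotope v a, ∃ t, T.On l t ∧ cross (v l.1) (t.lft v l.1) ≤ cross (v l.1) x ∧
        cross (v l.1) x ≤ cross (v l.1) (t.rgt v l.1)) := by
  obtain ⟨s, hs, hsk, hsl⟩ := T.exists_start_tile hc l (hc.ne_zero _)
  obtain ⟨A, h1, h2, h3, h4⟩ := T.exists_level hc hs hsk
  rw [hsl] at h3 h4
  refine ⟨A, h1, h2, fun t ht => h3 t ht.1 ht.2.1 ht.2.2, fun x hx => ?_⟩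
  obtain ⟨t, ht, htk, hr, h5⟩ := h4 x (by rw [cross_startPt]; exact lo_le hx _) (le_hi hx _)
  exact ⟨t, ⟨ht, htk, hr⟩, h5⟩

variable (T) in
/-- The position of a point in direction `v l.1` relative to the ribbon of `l`: it is between `0`
and `1` in the ribbon. -/
def level (hc : General v) (l : Line a) : Plane → ℝ := Classical.choose (T.exists_level_line hc l)

theorem continuous_level (hc : General v) (l : Line a) : Continuous (T.level hc l) :=
  (Classical.choose_spec (T.exists_level_line hc l)).1

theorem level_add (hc : General v) (l : Line a) (x : Plane) (c : ℝ) :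
    T.level hc l (x + c • v l.1) = T.level hc l x + c :=
  (Classical.choose_spec (T.exists_level_line hc l)).2.1 x c

theorem On.level_eq (hc : General v) {l : Line a} {t : Tile n} (h : T.On l t) {r s : ℝ}
    (h0 : 0 ≤ s) (h1 : s ≤ 1) : T.level hc l (t.lft v l.1 + r • v l.1 + s • t.stp v l.1) = r := by
  have := (Classical.choose_spec (T.exists_level_line hc l)).2.2.1 t h s h0 h1
  rw [add_right_comm, level_add]
  exact add_eq_right.2 this

theorem On.level_base (hc : General v) {l : Line a} {t : Tile n} (h : T.On l t) {r s : ℝ}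
    (h0 : 0 ≤ s) (h1 : s ≤ 1) :
    T.level hc l (t.base + r • v l.1 + s • v (t.other l.1)) = r := by
  by_cases hp : 0 < cross (v l.1) (v (t.other l.1))
  · have := h.level_eq hc (r := r) h0 h1
    rwa [Tile.lft, Tile.stp, if_pos hp, if_pos hp] at this
  · have := h.level_eq hc (r := r) (s := 1 - s) (by linarith) (by linarith)
    rw [Tile.lft, Tile.stp, if_neg hp, if_neg hp] at this
    convert this using 2
    module

theorem level_repr (hc : General v) (l : Line a) {x : Plane} (hx : x ∈ zonotope v a) :
    ∃ t, T.On l t ∧ ∃ s : ℝ, 0 ≤ s ∧ s ≤ 1 ∧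
      x = t.lft v l.1 + T.level hc l x • v l.1 + s • t.stp v l.1 := by
  obtain ⟨t, ht, h1, h2⟩ := (Classical.choose_spec (T.exists_level_line hc l)).2.2.2 x hx
  have hp := Tile.stp_pos hc ht.2.1
  have e := eq_coords hp.ne' (x - t.lft v l.1)
  rw [Tile.rgt, cross_add] at h2
  set s := cross (v l.1) (x - t.lft v l.1) / cross (v l.1) (t.stp v l.1) with hs
  have s0 : 0 ≤ s := div_nonneg (by rw [cross_sub]; linarith) hp.le
  have s1 : s ≤ 1 := by rw [hs, div_le_one hp, cross_sub]; linarith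
  have e' : x = t.lft v l.1 + (cross (x - t.lft v l.1) (t.stp v l.1) /
      cross (v l.1) (t.stp v l.1)) • v l.1 + s • t.stp v l.1 := by
    rw [add_assoc, ← e]; abel
  have hl := ht.level_eq hc (r := cross (x - t.lft v l.1) (t.stp v l.1) /
      cross (v l.1) (t.stp v l.1)) s0 s1
  rw [← e'] at hl
  exact ⟨t, ht, s, s0, s1, by rw [hl]; exact e'⟩

theorem level_cover (hc : General v) (l : Line a) {x : Plane} (hx : x ∈ zonotope v a)
    (h0 : 0 ≤ T.level hc l x) (h1 : T.level hc l x ≤ 1) : ∃ t, T.On l t ∧ x ∈ t.carrier v := by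
  obtain ⟨t, ht, s, s0, s1, e⟩ := T.level_repr hc l hx
  refine ⟨t, ht, ?_⟩
  rw [Tile.carrier_eq ht.2.1]
  exact ⟨_, _, h0, h1, s0, s1, e⟩

/-- The zonotope thus contains points displaced along `v l.1` by a known amount. In `side_start` and
`side_end` these are compared with the extreme values of `cross`. -/
theorem sub_level_mem (hc : General v) (l : Line a) {x : Plane} (hx : x ∈ zonotope v a) {c : ℝ}
    (h0 : 0 ≤ c) (h1 : c ≤ 1) : x + (c - T.level hc l x) • v l.1 ∈ zonotope v a := by
  obtain ⟨t, ht, s, s0, s1, e⟩ := T.level_repr hc l hx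
  refine T.subset_zonotope ht.1 ?_
  rw [Tile.carrier_eq ht.2.1]
  refine ⟨c, s, h0, h1, s0, s1, ?_⟩
  nth_rewrite 1 [e]
  module

/-- The interior of `t` is connected and misses the ribbon, which covers all points of the zonotope
with level between 0 and 1. So it stays on one side, and `t` lies in its closure. -/
theorem side_dichotomy (hc : General v) {l : Line a} {t : Tile n} (ht : t ∈ T.tiles)
    (hl : ¬ T.On l t) :
    (∀ x ∈ t.carrier v, T.level hc l x ≤ 0) ∨ (∀ x ∈ t.carrier v, 1 ≤ T.level hc l x) := by
  have hno : ∀ x ∈ t.inner v, 0 ≤ T.level hc l x → T.level hc l x ≤ 1 → False := by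
    intro x hx h0 h1
    obtain ⟨s, hs, hxs⟩ := T.level_cover hc l (T.subset_zonotope ht (t.inner_subset hx)) h0 h1
    exact hl (T.inner_unique hc ht hs.1 hx hxs ▸ hs)
  have hcont := T.continuous_level hc l
  have hcl : t.carrier v ⊆ closure (t.inner v) := para_subset_closure _ _ _
  have hpre : IsPreconnected (t.inner v) := (Tile.convex_inner t).isPreconnected
  by_cases h : ∃ x ∈ t.inner v, T.level hc l x < 0
  · left
    obtain ⟨x, hx, hx0⟩ := h
    have : t.inner v ⊆ {y | T.level hc l y ≤ 0} := by
      intro y hy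
      by_contra hy0
      obtain ⟨z, hz, hz0⟩ := hpre.intermediate_value hx hy hcont.continuousOn
        ⟨hx0.le, (not_le.1 hy0).le⟩
      exact hno z hz hz0.ge (hz0.trans_le zero_le_one)
    exact fun y hy => closure_minimal this (isClosed_le hcont continuous_const) (hcl hy)
  · right
    push Not at h
    have : t.inner v ⊆ {y | 1 ≤ T.level hc l y} := by
      intro y hy
      by_contra hy0
      exact hno y hy (h y hy) (not_le.1 hy0).le
    exact fun y hy => closure_minimal this (isClosed_le continuous_const hcont) (hcl hy)

/-! ### Sides along a line of another direction -/

variable (T) in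
open scoped Classical in
/-- The level function of `r`, turned so that it increases along lines of direction `i`. -/
def side (hc : General v) (i : Fin n) (r : Line a) (x : Plane) : ℝ :=
  if 0 < cross (v i) (v r.1) then T.level hc r x else 1 - T.level hc r x

theorem side_dichotomy' (hc : General v) (i : Fin n) {l : Line a} {t : Tile n} (ht : t ∈ T.tiles)
    (hl : ¬ T.On l t) :
    (∀ x ∈ t.carrier v, T.side hc i l x ≤ 0) ∨ (∀ x ∈ t.carrier v, 1 ≤ T.side hc i l x) := by
  unfold side
  split_ifs
  · exact side_dichotomy hc ht hl
  · rcases side_dichotomy hc ht hl with h | h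
    · exact Or.inr fun x hx => by linarith [h x hx]
    · exact Or.inl fun x hx => by linarith [h x hx]

theorem On.side_eq (hc : General v) {i : Fin n} {r : Line a} (hir : i ≠ r.1) {t : Tile n}
    (h : T.On r t) (hi : t.HasDir i) :
    T.side hc i r (t.lft v i) = 0 ∧ T.side hc i r (t.rgt v i) = 1 := by
  have hr : t.other r.1 = i := ((Tile.hasDir_iff h.2.1).1 hi |>.resolve_left hir).symm
  have hi' : t.other i = r.1 := by rw [← hr]; exact Tile.other_other h.2.1
  have h0 := h.level_base hc (r := 0) (s := 0) le_rfl zero_le_one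
  have h1 := h.level_base hc (r := 1) (s := 0) le_rfl zero_le_one
  simp only [zero_smul, one_smul, add_zero] at h0 h1
  unfold side Tile.rgt Tile.lft Tile.stp
  rw [hi']
  split_ifs
  · exact ⟨h0, h1⟩
  · rw [h1, add_neg_cancel_right, h0]
    norm_num

/-- No return: a tile on `r` leads from the value 0 to the value 1, and any other tile lies entirely
on one side of `r`. -/
theorem Reach.side (hc : General v) {i : Fin n} {r : Line a} (hir : i ≠ r.1) {b b' : Plane}
    (h : T.Reach i b b') (hb : 1 ≤ T.side hc i r b) : 1 ≤ T.side hc i r b' := by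
  induction h with
  | refl => exact hb
  | tail _ h ih =>
    obtain ⟨t, ht, hi, rfl, rfl⟩ := h
    by_cases hr : T.On r t
    · exact (hr.side_eq hc hir hi).2.ge
    · rcases side_dichotomy' hc i ht hr with h | h
      · linarith [h _ (Tile.lft_mem hi)]
      · exact h _ (Tile.rgt_mem hi)

/-- Moving along `v r.1` from the start of `l` to either border of the ribbon of `r` does not leave
the zonotope, so it cannot lower `cross (v l.1)`, which is minimal at the start. This gives the sign
of the displacement. -/
theorem side_start (hc : General v) (l : Line a) (r : Line a) (hir : l.1 ≠ r.1) :
    T.side hc l.1 r (startPt v a l) ≤ 0 := by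
  have h0 := lo_le (T.sub_level_mem hc r (startPt_mem l) le_rfl zero_le_one) l.1
  have h1 := lo_le (T.sub_level_mem hc r (startPt_mem l) zero_le_one le_rfl) l.1
  rw [cross_add, cross_smul, cross_startPt] at h0 h1
  have hn := hc _ _ hir
  unfold side
  split_ifs with hp
  · nlinarith
  · have := lt_of_le_of_ne (not_lt.1 hp) hn
    nlinarith

theorem side_end (hc : General v) (l : Line a) (r : Line a) (hir : l.1 ≠ r.1) {x : Plane}
    (hx : x ∈ zonotope v a) (hxe : cross (v l.1) x = hi v a l.1) : 1 ≤ T.side hc l.1 r x := by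
  have h0 := le_hi (T.sub_level_mem hc r hx le_rfl zero_le_one) l.1
  have h1 := le_hi (T.sub_level_mem hc r hx zero_le_one le_rfl) l.1
  rw [cross_add, cross_smul, hxe] at h0 h1
  have hn := hc _ _ hir
  unfold side
  split_ifs with hp
  · nlinarith
  · have := lt_of_le_of_ne (not_lt.1 hp) hn
    nlinarith

/-- The side value with respect to `r` is at most 0 at the start of `l` and at least 1 at its end,
and only a tile on `r` can change it. -/
theorem exists_cross (T : Tiling v a) (hc : General v) {l r : Line a} (hlr : l.1 ≠ r.1) :
    ∃ t, T.On l t ∧ T.On r t := by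
  by_contra hno
  push Not at hno
  obtain ⟨x, hx, hxe⟩ := exists_hi v a l.1
  obtain ⟨t, ht, s, s0, s1, e⟩ := T.level_repr hc l hx
  have hend : cross (v l.1) (t.rgt v l.1) = hi v a l.1 := by
    refine le_antisymm (le_hi (T.subset_zonotope ht.1 (Tile.rgt_mem ht.2.1)) _) ?_
    rw [← hxe, e, Tile.rgt, cross_add, cross_add, cross_add, cross_smul, cross_smul, cross_self]
    nlinarith [Tile.stp_pos hc ht.2.1]
  have h1 := T.side_end hc l r hlr (T.subset_zonotope ht.1 (Tile.rgt_mem ht.2.1)) hend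
  have key : ∀ b, T.Reach l.1 (startPt v a l) b → T.side hc l.1 r b ≤ 0 := by
    intro b hb
    induction hb with
    | refl => exact T.side_start hc l r hlr
    | tail h h' ih =>
      obtain ⟨u, hu, huk, rfl, rfl⟩ := h'
      rcases side_dichotomy' hc l.1 hu (hno u ⟨hu, huk, h⟩) with h2 | h2
      · exact h2 _ (Tile.rgt_mem huk)
      · linarith [h2 _ (Tile.lft_mem huk)]
  linarith [key _ ht.reach_rgt]

/-- After one common tile the side value is at least 1; at the left edge of a second one it would be
0. -/
theorem cross_unique (hc : General v) {l r : Line a} (hlr : l.1 ≠ r.1) {s t : Tile n}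
    (h1 : T.On l s) (h2 : T.On r s) (h3 : T.On l t) (h4 : T.On r t) : s = t := by
  have a1 := h2.side_eq hc hlr h1.2.1
  have a2 := h4.side_eq hc hlr h3.2.1
  rcases h1.reach_or hc h3 with h | h | h
  · exact h
  · linarith [h.side hc hlr a1.2.ge]
  · linarith [h.side hc hlr a2.2.ge]

theorem On.side_after (hc : General v) {l r : Line a} (hlr : l.1 ≠ r.1) {s t : Tile n}
    (h1 : T.On l s) (h2 : T.On r s) (h3 : T.On l t)
    (h : cross (v l.1) (s.lft v l.1) < cross (v l.1) (t.lft v l.1)) :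
    ∀ x ∈ t.carrier v, 1 ≤ T.side hc l.1 r x := by
  have hr := h1.reach_rgt_of_lt hc h3 h
  have hside := hr.side hc hlr (h2.side_eq hc hlr h1.2.1).2.ge
  have hne : ¬ T.On r t := fun h4 => by
    rw [cross_unique hc hlr h1 h2 h3 h4] at h
    exact lt_irrefl _ h
  rcases side_dichotomy' hc l.1 h3.1 hne with h5 | h5
  · linarith [h5 _ (Tile.lft_mem h3.2.1)]
  · exact h5

theorem On.side_before (hc : General v) {l r : Line a} (hlr : l.1 ≠ r.1) {s t : Tile n}
    (h1 : T.On l s) (h2 : T.On r s) (h3 : T.On l t)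
    (h : cross (v l.1) (t.lft v l.1) < cross (v l.1) (s.lft v l.1)) :
    ∀ x ∈ t.carrier v, T.side hc l.1 r x ≤ 0 := by
  have hr := h3.reach_rgt_of_lt hc h1 h
  have hne : ¬ T.On r t := fun h4 => by
    rw [cross_unique hc hlr h1 h2 h3 h4] at h
    exact lt_irrefl _ h
  rcases side_dichotomy' hc l.1 h3.1 hne with h5 | h5
  · exact h5
  · have := hr.side hc hlr (h5 _ (Tile.rgt_mem h3.2.1))
    linarith [(h2.side_eq hc hlr h1.2.1).1]

/-- The starts of the two ribbons are at least one unit apart, and as the lines share no tile, the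
side does not change along the ribbon. -/
theorem On.level_parallel (hc : General v) {k : Fin n} {m m' : Fin (a k)} (hm : m < m')
    {t : Tile n} (h : T.On ⟨k, m'⟩ t) : ∀ x ∈ t.carrier v, 1 ≤ T.level hc ⟨k, m⟩ x := by
  obtain ⟨s, hs, hsk, hsl⟩ := T.exists_start_tile hc ⟨k, m⟩ (hc.ne_zero k)
  have h0 : T.level hc ⟨k, m⟩ (startPt v a ⟨k, m⟩) = 0 := by
    have hon : T.On ⟨k, m⟩ s := ⟨hs, hsk, by rw [hsl]; exact Relation.ReflTransGen.refl⟩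
    have := hon.level_eq hc (r := 0) (s := 0) le_rfl zero_le_one
    simpa [hsl] using this
  have h1 : 1 ≤ T.level hc ⟨k, m⟩ (startPt v a ⟨k, m'⟩) := by
    have e : startPt v a ⟨k, m'⟩ = startPt v a ⟨k, m⟩ + ((m' : ℝ) - m) • v k := by
      simp only [startPt]; module
    have := T.level_add hc ⟨k, m⟩ (startPt v a ⟨k, m⟩) ((m' : ℝ) - m)
    rw [e, this, h0]
    have : (m : ℝ) + 1 ≤ m' := by exact_mod_cast hm
    linarith
  have hno : ∀ u, T.On ⟨k, m'⟩ u → ¬ T.On ⟨k, m⟩ u := fun u hu hu' => by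
    have := hu.eq_of_fst_eq hc hu' rfl
    simp only [Sigma.mk.injEq, heq_eq_eq, true_and] at this
    exact hm.ne' this
  have key : ∀ b, T.Reach k (startPt v a ⟨k, m'⟩) b → 1 ≤ T.level hc ⟨k, m⟩ b := by
    intro b hb
    induction hb with
    | refl => exact h1
    | tail h h' ih =>
      obtain ⟨u, hu, huk, rfl, rfl⟩ := h'
      rcases side_dichotomy hc hu (hno u ⟨hu, huk, h⟩) with h2 | h2
      · linarith [h2 _ (Tile.lft_mem huk)]
      · exact h2 _ (Tile.rgt_mem huk)
  rcases side_dichotomy hc h.1 (hno t h) with h2 | h2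
  · linarith [h2 _ (Tile.lft_mem h.2.1), key _ h.2.2]
  · exact h2

/-! ### The order of the crossings on a line -/

variable (T) in
/-- On `l`, the crossing with `m` precedes the crossing with `r`. -/
def Before (l m r : Line a) : Prop :=
  m.1 ≠ l.1 ∧ r.1 ≠ l.1 ∧ ∃ s t, T.On l s ∧ T.On m s ∧ T.On l t ∧ T.On r t ∧
    cross (v l.1) (s.lft v l.1) < cross (v l.1) (t.lft v l.1)

theorem Before.lt (hc : General v) {l m r : Line a} (h : T.Before l m r) {s t : Tile n}
    (h1 : T.On l s) (h2 : T.On m s) (h3 : T.On l t) (h4 : T.On r t) :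
    cross (v l.1) (s.lft v l.1) < cross (v l.1) (t.lft v l.1) := by
  obtain ⟨n1, n2, s', t', h1', h2', h3', h4', hlt⟩ := h
  rwa [cross_unique hc n1.symm h1 h2 h1' h2', cross_unique hc n2.symm h3 h4 h3' h4']

theorem Before.irrefl (hc : General v) (l m : Line a) : ¬ T.Before l m m := by
  intro h
  obtain ⟨t, h1, h2⟩ := T.exists_cross hc h.1.symm
  exact lt_irrefl _ (h.lt hc h1 h2 h1 h2)

theorem Before.trans (hc : General v) {l m q r : Line a} (h : T.Before l m q)
    (h' : T.Before l q r) : T.Before l m r := by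
  have hh := h'
  obtain ⟨n1, n2, s, t, h1, h2, h3, h4, hlt⟩ := h
  obtain ⟨n1', n2', s', t', h1', h2', h3', h4', hlt'⟩ := h'
  exact ⟨n1, n2', s, t', h1, h2, h3', h4', hlt.trans (hh.lt hc h3 h4 h3' h4')⟩

theorem Before.total (T : Tiling v a) (hc : General v) {l m r : Line a} (hm : m.1 ≠ l.1)
    (hr : r.1 ≠ l.1) (hmr : m ≠ r) : T.Before l m r ∨ T.Before l r m := by
  obtain ⟨s, h1, h2⟩ := T.exists_cross hc hm.symm
  obtain ⟨t, h3, h4⟩ := T.exists_cross hc hr.symm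
  rcases lt_trichotomy (cross (v l.1) (s.lft v l.1)) (cross (v l.1) (t.lft v l.1)) with h | h | h
  · exact Or.inl ⟨hm, hr, s, t, h1, h2, h3, h4, h⟩
  · exfalso
    obtain rfl := h1.eq_of_cross_eq hc h3 h
    refine hmr (h2.eq_of_fst_eq hc h4 ?_)
    have e1 := ((Tile.hasDir_iff h1.2.1).1 h2.2.1).resolve_left hm
    have e2 := ((Tile.hasDir_iff h1.2.1).1 h4.2.1).resolve_left hr
    rw [e1, e2]
  · exact Or.inr ⟨hr, hm, t, s, h3, h4, h1, h2, h⟩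

theorem Before.not_iff (T : Tiling v a) (hc : General v) {l m r : Line a} (hm : m.1 ≠ l.1)
    (hr : r.1 ≠ l.1) (hmr : m ≠ r) : ¬ T.Before l m r ↔ T.Before l r m := by
  constructor
  · exact (Before.total T hc hm hr hmr).resolve_left
  · exact fun h h' => Before.irrefl hc _ _ (h.trans hc h')

/-- The order on a line is determined by the sides. -/
theorem before_iff_above (hc : General v) {l m r : Line a} (hlm : l.1 ≠ m.1) (hlr : l.1 ≠ r.1)
    (hmr : m ≠ r) {t : Tile n} (h1 : T.On l t) (h2 : T.On m t) :
    T.Before l r m ↔ (0 < cross (v l.1) (v r.1) ↔ ∀ x ∈ t.carrier v, 1 ≤ T.level hc r x) := by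
  obtain ⟨s, h3, h4⟩ := T.exists_cross hc hlr
  have hb : t.base ∈ t.carrier v := ⟨0, 0, by simp⟩
  constructor
  · intro h
    have hs := h3.side_after hc hlr h4 h1 (h.lt hc h3 h4 h1 h2)
    unfold side at hs
    split_ifs at hs with hp
    · exact iff_of_true hp hs
    · refine iff_of_false hp fun h' => ?_
      linarith [h' _ hb, hs _ hb]
  · intro h
    by_contra hn
    have h' := (Before.not_iff T hc hlr.symm hlm.symm (Ne.symm hmr)).1 hn
    have hs := h3.side_before hc hlr h4 h1 (h'.lt hc h1 h2 h3 h4)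
    unfold side at hs
    split_ifs at hs with hp
    · linarith [h.1 hp _ hb, hs _ hb]
    · exact hp (h.2 fun x hx => by linarith [hs x hx])

theorem before_parallel (hc : General v) {l : Line a} {k : Fin n} (hlk : l.1 ≠ k)
    {m r : Fin (a k)} (hmr : m < r) : T.Before l ⟨k, m⟩ ⟨k, r⟩ ↔ 0 < cross (v l.1) (v k) := by
  obtain ⟨t, h1, h2⟩ := T.exists_cross hc (l := l) (r := ⟨k, r⟩) hlk
  rw [before_iff_above hc (m := ⟨k, r⟩) hlk hlk (by simpa using hmr.ne') h1 h2]
  simp only [iff_true_intro (h2.level_parallel hc hmr), iff_true]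

/-- Both orders are read off from the same fact: on which side of `r` the common tile of `l` and `m`
lies. -/
theorem before_triangle (hc : General v) {l m r : Line a} (hlm : l.1 ≠ m.1) (hlr : l.1 ≠ r.1)
    (hmr : m.1 ≠ r.1) : T.Before l r m ↔ (T.Before m r l ↔
      (0 < cross (v l.1) (v r.1) ↔ 0 < cross (v m.1) (v r.1))) := by
  obtain ⟨t, h1, h2⟩ := T.exists_cross hc hlm
  rw [before_iff_above hc hlm hlr (fun h => hmr (congrArg _ h)) h1 h2,
    before_iff_above hc hlm.symm hmr (fun h => hlr (congrArg _ h)) h2 h1]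
  tauto

end Tiling
end RhombusTiling

end

/-! ### Pseudolines, crossing points and signs in terms of levels and orders -/

noncomputable section

namespace RhombusTiling
variable {n : ℕ} {v : Fin n → Plane} {a : Fin n → ℕ}

/-- The centre of a tile. -/
def Tile.center (v : Fin n → Plane) (t : Tile n) : Plane :=
  t.base + (1 / 2 : ℝ) • v t.i + (1 / 2 : ℝ) • v t.j

theorem Tile.center_mem (t : Tile n) : t.center v ∈ t.carrier v :=
  ⟨1 / 2, 1 / 2, by norm_num, by norm_num, by norm_num, by norm_num, rfl⟩

theorem Tile.center_eq {t : Tile n} {k : Fin n} (h : t.HasDir k) :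
    t.center v = t.base + (1 / 2 : ℝ) • v k + (1 / 2 : ℝ) • v (t.other k) := by
  unfold Tile.other Tile.center
  split_ifs with h1
  · rw [h1]
  · rw [← h.resolve_left h1]; abel

namespace Tiling
variable {T : Tiling v a} [Nontrivial (Fin n)]

theorem On.level_center (hc : General v) {l : Line a} {t : Tile n} (h : T.On l t) :
    T.level hc l (t.center v) = 1 / 2 := by
  rw [Tile.center_eq h.2.1]
  exact h.level_base hc (by norm_num) (by norm_num)

theorem mem_midline {t : Tile n} {k : Fin n} (h : t.HasDir k) {x : Plane} :
    x ∈ midline v k t ↔ ∃ s : ℝ, 0 ≤ s ∧ s ≤ 1 ∧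
      x = t.lft v k + (1 / 2 : ℝ) • v k + s • t.stp v k := by
  have : {x | ∃ b : Plane, (b, k) ∈ t.edges v ∧ x = b + (1 / 2 : ℝ) • v k} =
      {t.lft v k + (1 / 2 : ℝ) • v k, t.rgt v k + (1 / 2 : ℝ) • v k} := by
    ext x
    simp only [Tile.mem_edges, Set.mem_ofPred_eq, Set.mem_insert_iff, Set.mem_singleton_iff]
    constructor
    · rintro ⟨b, ⟨-, rfl | rfl⟩, rfl⟩ <;> simp
    · rintro (rfl | rfl)
      · exact ⟨_, ⟨h, Or.inl rfl⟩, rfl⟩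
      · exact ⟨_, ⟨h, Or.inr rfl⟩, rfl⟩
  rw [midline, this, convexHull_pair, segment_eq_image']
  constructor
  · rintro ⟨s, hs, rfl⟩
    exact ⟨s, hs.1, hs.2, by simp only [Tile.rgt]; module⟩
  · rintro ⟨s, h0, h1, rfl⟩
    exact ⟨s, ⟨h0, h1⟩, by simp only [Tile.rgt]; module⟩

theorem mem_curve (hc : General v) {l : Line a} {x : Plane} :
    x ∈ curve T l ↔ x ∈ zonotope v a ∧ T.level hc l x = 1 / 2 := by
  simp only [curve, Set.mem_iUnion, exists_prop, mem_ribbon hc]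
  constructor
  · rintro ⟨t, ht, hx⟩
    obtain ⟨s, h0, h1, rfl⟩ := (mem_midline ht.2.1).1 hx
    refine ⟨T.subset_zonotope ht.1 ?_, ht.level_eq hc h0 h1⟩
    rw [Tile.carrier_eq ht.2.1]
    exact ⟨_, _, by norm_num, by norm_num, h0, h1, rfl⟩
  · rintro ⟨hx, hl⟩
    obtain ⟨t, ht, s, h0, h1, e⟩ := T.level_repr hc l hx
    rw [hl] at e
    exact ⟨t, ht, (mem_midline ht.2.1).2 ⟨s, h0, h1, e⟩⟩

theorem mem_posSide (hc : General v) {l : Line a} {x : Plane} :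
    x ∈ posSide T l ↔ x ∈ zonotope v a ∧ 1 / 2 < T.level hc l x := by
  simp only [posSide, Set.mem_ofPred_eq, mem_curve hc]
  refine and_congr_right fun hx => ⟨?_, fun h => ?_⟩
  · rintro ⟨y, ⟨-, hy⟩, c, hc0, rfl⟩
    rw [level_add, hy]; linarith
  · refine ⟨_, ⟨T.sub_level_mem hc l hx (c := 1 / 2) (by norm_num) (by norm_num), ?_⟩,
      T.level hc l x - 1 / 2, by linarith, by module⟩
    rw [level_add]; ring

theorem mem_negSide (hc : General v) {l : Line a} {x : Plane} :
    x ∈ negSide T l ↔ x ∈ zonotope v a ∧ T.level hc l x < 1 / 2 := by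
  simp only [negSide, Set.mem_ofPred_eq, mem_curve hc]
  refine and_congr_right fun hx => ⟨?_, fun h => ?_⟩
  · rintro ⟨y, ⟨-, hy⟩, c, hc0, rfl⟩
    rw [sub_eq_add_neg, ← neg_smul, level_add, hy]; linarith
  · refine ⟨_, ⟨T.sub_level_mem hc l hx (c := 1 / 2) (by norm_num) (by norm_num), ?_⟩,
      1 / 2 - T.level hc l x, by linarith, by module⟩
    rw [level_add]; ring

/-- A tile off the ribbon of `m` has no points of `m`-level strictly between 0 and 1. In the common
tile the two levels are the two coordinates, and both are `1 / 2` only at the centre. -/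
theorem crossing_eq (hc : General v) {l m : Line a} (hlm : l.1 ≠ m.1) {t : Tile n}
    (h1 : T.On l t) (h2 : T.On m t) : crossing T l m = {t.center v} := by
  ext x
  simp only [crossing, Set.mem_inter_iff, mem_curve hc, Set.mem_singleton_iff]
  constructor
  · rintro ⟨⟨hx, hl⟩, -, hm⟩
    obtain ⟨s, hs, hxs⟩ := T.level_cover hc l hx (by rw [hl]; norm_num) (by rw [hl]; norm_num)
    have hms : T.On m s := by
      by_contra hn
      rcases side_dichotomy hc hs.1 hn with h | h
      · have := h _ hxs; rw [hm] at this; norm_num at this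
      · have := h _ hxs; rw [hm] at this; norm_num at this
    rw [cross_unique hc hlm h1 h2 hs hms]
    rw [Tile.carrier_eq_base hs.2.1] at hxs
    obtain ⟨p, q, p0, p1, q0, q1, rfl⟩ := hxs
    have hmo := ((Tile.hasDir_iff hs.2.1).1 hms.2.1).resolve_left hlm.symm
    have ho : s.other m.1 = l.1 := by rw [hmo]; exact Tile.other_other hs.2.1
    have e1 := hs.level_base hc (r := p) q0 q1
    have e2 := hms.level_base hc (r := q) p0 p1
    rw [ho, add_right_comm] at e2
    rw [e1] at hl
    rw [← hmo] at hm
    have hq : q = 1 / 2 := e2.symm.trans hm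
    rw [Tile.center_eq hs.2.1, hl, hq]
  · rintro rfl
    have := T.subset_zonotope h1.1 (Tile.center_mem t)
    exact ⟨⟨this, h1.level_center hc⟩, this, h2.level_center hc⟩

theorem isTriangle (hc : General v) (T : Tiling v a) (t : Triple a) : IsTriangle T t := by
  have key : ∀ {l m : Line a}, l.1 ≠ m.1 → (crossing T l m).Nonempty := by
    intro l m h
    obtain ⟨s, h1, h2⟩ := T.exists_cross hc h
    rw [crossing_eq hc h h1 h2]
    exact Set.singleton_nonempty _
  exact ⟨key t.lt₁₂.ne, key (t.lt₁₂.trans t.lt₂₃).ne, key t.lt₂₃.ne⟩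

variable (T) in
/-- The tile is on the positive side of the line `r`. -/
def Above (hc : General v) (r : Line a) (t : Tile n) : Prop :=
  ∀ x ∈ t.carrier v, 1 ≤ T.level hc r x

theorem above_iff (hc : General v) {r : Line a} {t : Tile n} (ht : t ∈ T.tiles)
    (hr : ¬ T.On r t) : T.Above hc r t ↔ 1 / 2 < T.level hc r (t.center v) := by
  constructor
  · intro h
    linarith [h _ (Tile.center_mem t)]
  · intro h
    rcases side_dichotomy hc ht hr with h1 | h1
    · linarith [h1 _ (Tile.center_mem t)]
    · exact h1

theorem not_above_iff (hc : General v) {r : Line a} {t : Tile n} (ht : t ∈ T.tiles)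
    (hr : ¬ T.On r t) : ¬ T.Above hc r t ↔ T.level hc r (t.center v) < 1 / 2 := by
  rw [above_iff hc ht hr, not_lt]
  refine ⟨fun h => ?_, le_of_lt⟩
  rcases side_dichotomy hc ht hr with h1 | h1
  · linarith [h1 _ (Tile.center_mem t)]
  · linarith [h1 _ (Tile.center_mem t)]

theorem isPositive_iff (hc : General v) {t : Triple a} {s : Tile n} (h1 : T.On t.l₁ s)
    (h2 : T.On t.l₂ s) : IsPositive T t ↔ T.Above hc t.l₃ s := by
  have hn : ¬ T.On t.l₃ s :=
    not_on_of_ne t.lt₁₂.ne (t.lt₁₂.trans t.lt₂₃).ne t.lt₂₃.ne h1 h2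
  rw [IsPositive, crossing_eq hc t.lt₁₂.ne h1 h2, Set.singleton_subset_iff, mem_posSide hc,
    above_iff hc h1.1 hn]
  exact ⟨fun h => h.2, fun h => ⟨T.subset_zonotope h1.1 (Tile.center_mem s), h⟩⟩

/-- The triangle of three lines of different bundles has different signs in two tilings. -/
def Inv (T T' : Tiling v a) (l m r : Line a) : Prop :=
  (l.1 ≠ m.1 ∧ l.1 ≠ r.1 ∧ m.1 ≠ r.1) ∧ (T.Before l m r ↔ ¬ T'.Before l m r)

/-- By `before_iff_above`, the side of `l₃` on which `l₁` and `l₂` cross is the order of `l₃` and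
`l₂` on `l₁`, up to the sign of a `cross` that is the same for both tilings. -/
theorem isInverted_iff (hc : General v) {T T' : Tiling v a} {t : Triple a} :
    IsInverted T T' t ↔ Inv T T' t.l₁ t.l₃ t.l₂ := by
  obtain ⟨s, h1, h2⟩ := T.exists_cross hc t.lt₁₂.ne
  obtain ⟨s', h1', h2'⟩ := T'.exists_cross hc t.lt₁₂.ne
  have h13 := (t.lt₁₂.trans t.lt₂₃).ne
  have hne : t.l₂ ≠ t.l₃ := fun h => t.lt₂₃.ne (congrArg _ h)
  simp only [IsInverted, isTriangle hc, true_and, Inv, isPositive_iff hc h1 h2,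
    isPositive_iff hc h1' h2', before_iff_above hc t.lt₁₂.ne h13 hne h1 h2,
    before_iff_above hc t.lt₁₂.ne h13 hne h1' h2', Above]
  have := t.lt₁₂.ne
  have := t.lt₂₃.ne
  tauto

/-- `Inv` speaks only of triples from three bundles. For two lines of one bundle, `before_parallel`
gives the same order on `l` in every tiling. -/
theorem same_of_not_inv (hc : General v) {T T' : Tiling v a} {l m r : Line a} (hm : m.1 ≠ l.1)
    (hr : r.1 ≠ l.1) (hmr : m ≠ r) (h : ¬ Inv T T' l m r) :
    T.Before l m r ↔ T'.Before l m r := by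
  by_cases e : m.1 = r.1
  · obtain ⟨k, m⟩ := m
    obtain ⟨k', r⟩ := r
    obtain rfl : k = k' := e
    have hne : m ≠ r := fun h => hmr (by rw [h])
    rcases lt_or_gt_of_ne hne with h | h
    · rw [before_parallel hc (T := T) hm.symm h, before_parallel hc (T := T') hm.symm h]
    · rw [← Before.not_iff T hc hr hm hmr.symm, ← Before.not_iff T' hc hr hm hmr.symm,
        before_parallel hc (T := T) hm.symm h, before_parallel hc (T := T') hm.symm h]
  · unfold Inv at h
    have := hm.symm
    have := hr.symm
    tauto

theorem Inv.swap₂ (hc : General v) {T T' : Tiling v a} {p q r : Line a} (h : Inv T T' p q r) :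
    Inv T T' p r q := by
  obtain ⟨⟨h1, h2, h3⟩, h⟩ := h
  have hne : q ≠ r := fun h => h3 (congrArg _ h)
  refine ⟨⟨h2, h1, h3.symm⟩, ?_⟩
  rw [← Before.not_iff T hc h1.symm h2.symm hne, ← Before.not_iff T' hc h1.symm h2.symm hne]
  tauto

/-- The orders on the three lines of a triangle determine one another by `before_triangle`, in a way
that does not depend on the tiling. -/
theorem Inv.swap₁ (hc : General v) {T T' : Tiling v a} {p q r : Line a} (h : Inv T T' p q r) :
    Inv T T' q p r := by
  refine Inv.swap₂ hc ?_
  obtain ⟨⟨h1, h2, h3⟩, h⟩ := h.swap₂ hc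
  refine ⟨⟨h3.symm, h2.symm, h1.symm⟩, ?_⟩
  have e1 := before_triangle hc (T := T) h2 h1 h3.symm
  have e2 := before_triangle hc (T := T') h2 h1 h3.symm
  tauto

/-! ### Minimality of triangles that no line crosses -/

/-- Sides are positions on `p`: seen along `p`, the crossing with `l` is on the same side of `q` as
the crossing with `r`, and on the same side of `r` as the crossing with `q`. -/
theorem between_of_inside (hc : General v) {p q r l : Line a} (hpq : p.1 ≠ q.1) (hpr : p.1 ≠ r.1)
    (hqr : q.1 ≠ r.1) (hlp : p.1 ≠ l.1) (hlq : l ≠ q) (hlr : l ≠ r) {s sq sr : Tile n}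
    (h1 : T.On p s) (h2 : T.On l s) (h3 : T.On p sq) (h4 : T.On q sq) (h5 : T.On p sr)
    (h6 : T.On r sr) (hq : T.Above hc q s ↔ T.Above hc q sr)
    (hr : T.Above hc r s ↔ T.Above hc r sq) : IsArr.Bt T.Before p q l r := by
  have hne : q ≠ r := fun h => hqr (congrArg _ h)
  have e1 := before_iff_above hc hlp hpq hlq h1 h2
  have e2 := before_iff_above hc hpr hpq hne.symm h5 h6
  have e3 := before_iff_above hc hlp hpr hlr h1 h2
  have e4 := before_iff_above hc hpq hpr hne h3 h4
  have n1 := Before.not_iff T hc hpq.symm hlp.symm hlq.symm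
  have n2 := Before.not_iff T hc hpr.symm hlp.symm hlr.symm
  have n3 := Before.not_iff T hc hpq.symm hpr.symm hne
  unfold Above at hq hr
  unfold IsArr.Bt
  generalize (∀ x ∈ s.carrier v, 1 ≤ T.level hc q x) = A at *
  generalize (∀ x ∈ s.carrier v, 1 ≤ T.level hc r x) = B at *
  generalize (∀ x ∈ sr.carrier v, 1 ≤ T.level hc q x) = C at *
  generalize (∀ x ∈ sq.carrier v, 1 ≤ T.level hc r x) = D at *
  rw [hq] at e1
  rw [hr] at e3
  have f1 := e1.trans e2.symm
  have f2 := e3.trans e4.symm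
  by_cases b1 : T.Before p q r
  · have b2 : ¬ T.Before p r q := fun h => n3.2 h b1
    exact Or.inl ⟨f1.2 b1, n2.1 fun h => b2 (f2.1 h)⟩
  · exact Or.inr ⟨f2.2 (n3.1 b1), n1.1 fun h => b1 (f1.1 h)⟩

theorem On.level_parallel' (hc : General v) {k : Fin n} {m m' : Fin (a k)} (hm : m' < m)
    {t : Tile n} (h : T.On ⟨k, m'⟩ t) : ∀ x ∈ t.carrier v, T.level hc ⟨k, m⟩ x ≤ 0 := by
  obtain ⟨s, hs, hsk, hsl⟩ := T.exists_start_tile hc ⟨k, m⟩ (hc.ne_zero k)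
  have h0 : T.level hc ⟨k, m⟩ (startPt v a ⟨k, m⟩) = 0 := by
    have hon : T.On ⟨k, m⟩ s := ⟨hs, hsk, by rw [hsl]; exact Relation.ReflTransGen.refl⟩
    have := hon.level_eq hc (r := 0) (s := 0) le_rfl zero_le_one
    simpa [hsl] using this
  have h1 : T.level hc ⟨k, m⟩ (startPt v a ⟨k, m'⟩) ≤ 0 := by
    have e : startPt v a ⟨k, m'⟩ = startPt v a ⟨k, m⟩ + ((m' : ℝ) - m) • v k := by
      simp only [startPt]; module
    have := T.level_add hc ⟨k, m⟩ (startPt v a ⟨k, m⟩) ((m' : ℝ) - m)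
    rw [e, this, h0]
    have : (m' : ℝ) + 1 ≤ m := by exact_mod_cast hm
    linarith
  have hno : ∀ u, T.On ⟨k, m'⟩ u → ¬ T.On ⟨k, m⟩ u := fun u hu hu' => by
    have := hu.eq_of_fst_eq hc hu' rfl
    simp only [Sigma.mk.injEq, heq_eq_eq, true_and] at this
    exact hm.ne this
  have key : ∀ b, T.Reach k (startPt v a ⟨k, m'⟩) b → T.level hc ⟨k, m⟩ b ≤ 0 := by
    intro b hb
    induction hb with
    | refl => exact h1
    | tail h h' ih =>
      obtain ⟨u, hu, huk, rfl, rfl⟩ := h'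
      rcases side_dichotomy hc hu (hno u ⟨hu, huk, h⟩) with h2 | h2
      · exact h2 _ (Tile.rgt_mem huk)
      · linarith [h2 _ (Tile.lft_mem huk)]
  rcases side_dichotomy hc h.1 (hno t h) with h2 | h2
  · exact h2
  · linarith [h2 _ (Tile.lft_mem h.2.1), key _ h.2.2]

theorem On.above_congr_parallel (hc : General v) {l w : Line a} (hw : w.1 = l.1) (hwl : w ≠ l)
    {s t : Tile n} (hs : T.On l s) (ht : T.On l t) : T.Above hc w s ↔ T.Above hc w t := by
  obtain ⟨k, l⟩ := l
  obtain ⟨k', w⟩ := w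
  obtain rfl : k' = k := hw
  have hne : w ≠ l := fun h => hwl (by rw [h])
  rcases lt_or_gt_of_ne hne with h | h
  · exact iff_of_true (hs.level_parallel hc h) (ht.level_parallel hc h)
  · have key : ∀ s, T.On ⟨k', l⟩ s → ¬ T.Above hc ⟨k', w⟩ s := by
      intro s hs hab
      linarith [hs.level_parallel' hc h _ (Tile.lft_mem hs.2.1), hab _ (Tile.lft_mem hs.2.1)]
    exact iff_of_false (key s hs) (key t ht)

end Tiling
end RhombusTiling

end

/-! ### Uncrossed triangles are inclusion-minimal -/

noncomputable section

namespace RhombusTiling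
variable {n : ℕ} {v : Fin n → Plane} {a : Fin n → ℕ}
namespace Tiling
variable {T : Tiling v a} [Nontrivial (Fin n)]

/-- The tile is cut by `p` or lies on the same side of `p` as the crossing of `q` and `r`. -/
def Inside (T : Tiling v a) (hc : General v) (p q r : Line a) (t : Tile n) : Prop :=
  T.On p t ∨ ∀ s, T.On q s → T.On r s → (T.Above hc p t ↔ T.Above hc p s)

theorem Inside.swap {hc : General v} {p q r : Line a} {t : Tile n} (h : T.Inside hc p q r t) :
    T.Inside hc p r q t :=
  h.imp_right fun h s h1 h2 => h s h2 h1

theorem not_on_of_ne' (hc : General v) {l m w : Line a} (hlm : l.1 ≠ m.1) (hl : w ≠ l)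
    (hm : w ≠ m) {t : Tile n} (h1 : T.On l t) (h2 : T.On m t) : ¬ T.On w t := by
  intro h
  by_cases e : w.1 = l.1
  · exact hl (h.eq_of_fst_eq hc h1 e)
  by_cases e' : w.1 = m.1
  · exact hm (h.eq_of_fst_eq hc h2 e')
  exact not_on_of_ne hlm (Ne.symm e) (Ne.symm e') h1 h2 h

theorem bt_of_inside (hc : General v) {p q r l : Line a} (hpq : p.1 ≠ q.1) (hpr : p.1 ≠ r.1)
    (hqr : q.1 ≠ r.1) (hlp : p.1 ≠ l.1) (hlq : l ≠ q) (hlr : l ≠ r) {t : Tile n}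
    (h1 : T.On p t) (h2 : T.On l t) (hq : T.Inside hc q p r t) (hr : T.Inside hc r p q t) :
    IsArr.Bt T.Before p q l r := by
  obtain ⟨sq, a1, a2⟩ := T.exists_cross hc hpq
  obtain ⟨sr, b1, b2⟩ := T.exists_cross hc hpr
  refine between_of_inside hc hpq hpr hqr hlp hlq hlr h1 h2 a1 a2 b1 b2 ?_ ?_
  · exact hq.resolve_left (not_on_of_ne' hc hlp (fun h => hpq (congrArg _ h.symm)) hlq.symm h1 h2)
      _ b1 b2
  · exact hr.resolve_left (not_on_of_ne' hc hlp (fun h => hpr (congrArg _ h.symm)) hlr.symm h1 h2)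
      _ a1 a2

/-- A tile in an uncrossed triangle is only cut by the sides of the triangle. -/
theorem mem_of_inside (hc : General v) {p q r : Line a} (hpq : p.1 ≠ q.1) (hpr : p.1 ≠ r.1)
    (hqr : q.1 ≠ r.1) (hU : IsArr.Uncrossed T.Before p q r) {l m : Line a} (hlm : l.1 ≠ m.1)
    {t : Tile n} (h1 : T.On l t) (h2 : T.On m t) (hp : T.Inside hc p q r t)
    (hq : T.Inside hc q p r t) (hr : T.Inside hc r p q t) : l = p ∨ l = q ∨ l = r := by
  by_contra hl
  push Not at hl
  obtain ⟨lp, lq, lr⟩ := hl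
  -- If `l` crosses a line of the triangle in a tile inside it, it crosses between the two corners
  -- on that line, against `hU`.
  have key : ∀ s w, T.On l s → T.On w s → w.1 ≠ l.1 → (w = p ∨ w = q ∨ w = r) →
      T.Inside hc p q r s → T.Inside hc q p r s → T.Inside hc r p q s → False := by
    rintro s w k1 k2 hwl (rfl | rfl | rfl) i1 i2 i3
    · exact hU.1 l (bt_of_inside hc hpq hpr hqr hwl lq lr k2 k1 i2 i3)
    · exact hU.2.1 l (bt_of_inside hc hpq.symm hqr hpr hwl lp lr k2 k1 i1 i3.swap)
    · exact hU.2.2 l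
        (bt_of_inside hc hpr.symm hqr.symm hpq hwl lp lq k2 k1 i1.swap i2.swap)
  by_cases hm : m = p ∨ m = q ∨ m = r
  · exact key t m h1 h2 hlm.symm hm hp hq hr
  push Not at hm
  obtain ⟨mp, mq, mr⟩ := hm
  have hX : ∀ w : Line a, ∃ s, w.1 ≠ l.1 → T.On l s ∧ T.On w s := by
    intro w
    by_cases h : w.1 ≠ l.1
    · obtain ⟨s, h⟩ := T.exists_cross hc h.symm
      exact ⟨s, fun _ => h⟩
    · exact ⟨t, fun h' => absurd h' h⟩
  choose X hX using hX
  -- Now both lines are foreign to the triangle. Going along `l` to the nearest crossing with a line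
  -- `w` of the triangle, no other line of the triangle is passed. So that crossing is still inside,
  -- and `key` applies to it.
  obtain ⟨w, hw, hmin⟩ := Finset.exists_min_image
    (({p, q, r} : Finset (Line a)).filter fun w => w.1 ≠ l.1)
    (fun w => |cross (v l.1) ((X w).lft v l.1) - cross (v l.1) (t.lft v l.1)|) (by
      by_cases h : p.1 = l.1
      · exact ⟨q, by simp [← h, hpq.symm]⟩
      · exact ⟨p, by simp [h]⟩)
  simp only [Finset.mem_filter, Finset.mem_insert, Finset.mem_singleton] at hw hmin
  obtain ⟨hwS, hwl⟩ := hw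
  obtain ⟨k1, k2⟩ := hX w hwl
  have wl : w ≠ l := fun h => hwl (congrArg _ h)
  have wm : w ≠ m := by rintro rfl; tauto
  have side : ∀ w' : Line a, (w' = p ∨ w' = q ∨ w' = r) → w' = w ∨
      (T.Above hc w' t ↔ T.Above hc w' (X w)) := by
    intro w' hw'S
    by_cases hww : w' = w
    · exact Or.inl hww
    refine Or.inr ?_
    have wl' : w' ≠ l := by rintro rfl; tauto
    have wm' : w' ≠ m := by rintro rfl; tauto
    by_cases hwl' : w'.1 = l.1
    · exact On.above_congr_parallel hc hwl' wl' h1 k1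
    have e1 := before_iff_above hc hlm (Ne.symm hwl') wm'.symm h1 h2
    have e2 := before_iff_above hc hwl.symm (Ne.symm hwl') (Ne.symm hww) k1 k2
    obtain ⟨j1, j2⟩ := hX w' hwl'
    have hle := hmin w' ⟨hw'S, hwl'⟩
    have : T.Before l w' m ↔ T.Before l w' w := by
      constructor
      · intro h
        by_contra h'
        rw [Before.not_iff T hc hwl' hwl hww] at h'
        have f1 := h.lt hc j1 j2 h1 h2
        have f2 := h'.lt hc k1 k2 j1 j2
        rw [abs_of_neg (by linarith), abs_of_neg (by linarith)] at hle
        linarith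
      · intro h
        by_contra h'
        rw [Before.not_iff T hc hwl' hlm.symm wm'] at h'
        have f1 := h.lt hc j1 j2 k1 k2
        have f2 := h'.lt hc h1 h2 j1 j2
        rw [abs_of_pos (by linarith), abs_of_pos (by linarith)] at hle
        linarith
    rw [e1, e2] at this
    unfold Above
    by_cases hcr : 0 < cross (v l.1) (v w'.1)
    · simpa only [hcr, true_iff] using this
    · simpa only [hcr, false_iff, not_iff_not] using this
  have trans : ∀ p q r, (p = w ∨ (T.Above hc p t ↔ T.Above hc p (X w))) → p ≠ l → p ≠ m →
      T.Inside hc p q r t → T.Inside hc p q r (X w) := by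
    intro p q r h pl pm hp
    rcases h with rfl | h
    · exact Or.inl k2
    · exact Or.inr fun s i1 i2 => h.symm.trans
        (hp.resolve_left (not_on_of_ne' hc hlm pl pm h1 h2) s i1 i2)
  exact key (X w) w k1 k2 hwl hwS (trans p q r (side p (by simp)) lp.symm mp.symm hp)
    (trans q p r (side q (by simp)) lq.symm mq.symm hq)
    (trans r p q (side r (by simp)) lr.symm mr.symm hr)

theorem center_mem_closedSide (hc : General v) {l m p : Line a} {s t : Tile n}
    (hlm : l.1 ≠ m.1) (hl : l.1 ≠ p.1) (hm : m.1 ≠ p.1)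
    (ht : t ∈ T.tiles) (h1 : T.On l s) (h2 : T.On m s) :
    t.center v ∈ closedSide T p (crossing T l m) ↔ T.On p t ∨ (T.Above hc p t ↔ T.Above hc p s) := by
  have hps := not_on_of_ne hlm hl hm h1 h2
  have ht' := T.subset_zonotope ht (Tile.center_mem t)
  have hs' := T.subset_zonotope h1.1 (Tile.center_mem s)
  simp only [closedSide, Set.mem_union, Set.mem_ofPred_eq, crossing_eq hc hlm h1 h2,
    Set.singleton_subset_iff, mem_posSide hc, mem_negSide hc, mem_curve hc, ht', hs', true_and]
  by_cases hpt : T.On p t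
  · simp [hpt, hpt.level_center hc]
  · have b1 := not_above_iff hc h1.1 hps
    have b2 := not_above_iff hc ht hpt
    have b3 := above_iff hc h1.1 hps
    have b4 := above_iff hc ht hpt
    have : T.level hc p (t.center v) ≠ 1 / 2 := by
      intro h
      rw [h] at b2 b4
      exact lt_irrefl _ (b2.1 fun h' => lt_irrefl _ (b4.1 h'))
    simp only [this, false_or, hpt, ← b1, ← b2, ← b3, ← b4]
    tauto

theorem center_mem_region (hc : General v) (t : Tile n) (ht : t ∈ T.tiles) (S : Triple a) :
    t.center v ∈ region T S ↔ T.Inside hc S.l₁ S.l₂ S.l₃ t ∧ T.Inside hc S.l₂ S.l₁ S.l₃ t ∧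
      T.Inside hc S.l₃ S.l₁ S.l₂ t := by
  have h12 := S.lt₁₂.ne
  have h23 := S.lt₂₃.ne
  have h13 := (S.lt₁₂.trans S.lt₂₃).ne
  have key : ∀ {p l m : Line a}, l.1 ≠ m.1 → l.1 ≠ p.1 → m.1 ≠ p.1 →
      (t.center v ∈ closedSide T p (crossing T l m) ↔ T.Inside hc p l m t) := by
    intro p l m hlm hl hm
    obtain ⟨s, h1, h2⟩ := T.exists_cross hc hlm
    rw [center_mem_closedSide hc hlm hl hm ht h1 h2]
    refine or_congr_right ⟨fun h s' h1' h2' => ?_, fun h => h s h1 h2⟩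
    rwa [cross_unique hc hlm h1' h2' h1 h2]
  rw [region, Set.mem_inter_iff, Set.mem_inter_iff, key h23 h12.symm h13.symm, key h13 h12 h23.symm,
    key h12 h13 h23, and_assoc]

theorem inside_of_on (hc : General v) {l m p : Line a} (hlm : l.1 ≠ m.1) {t : Tile n}
    (h1 : T.On l t) (h2 : T.On m t) : T.Inside hc p l m t :=
  Or.inr fun s h1' h2' => by rw [cross_unique hc hlm h1' h2' h1 h2]

/-- If the region of `s` is contained in that of `t`, then so are the crossings of `s`. By
`mem_of_inside` the lines of `s` are lines of `t`, and the order of the bundles gives `s = t`. Two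
crossings of `s` involve all three of its lines. -/
theorem isMinimalTriangle_of_uncrossed (hc : General v) {t : Triple a}
    (hU : IsArr.Uncrossed T.Before t.l₁ t.l₂ t.l₃) : IsMinimalTriangle T t := by
  refine ⟨isTriangle hc T t, fun s _ hs => hs.2 ?_⟩
  suffices s = t by rw [this]
  have h12 := t.lt₁₂.ne
  have h23 := t.lt₂₃.ne
  have h13 := (t.lt₁₂.trans t.lt₂₃).ne
  have key : ∀ {l m : Line a} {u : Tile n}, l.1 ≠ m.1 → T.On l u → T.On m u →
      u.center v ∈ region T s → l = t.l₁ ∨ l = t.l₂ ∨ l = t.l₃ := by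
    intro l m u hlm h1 h2 hu
    obtain ⟨i1, i2, i3⟩ := (center_mem_region hc u h1.1 t).1 (hs.1 hu)
    exact mem_of_inside hc h12 h13 h23 hU hlm h1 h2 i1 i2 i3
  obtain ⟨u, u1, u2⟩ := T.exists_cross hc s.lt₁₂.ne
  obtain ⟨w, w1, w2⟩ := T.exists_cross hc s.lt₂₃.ne
  have hu := (center_mem_region hc u u1.1 s).2 ⟨Or.inl u1, Or.inl u2, inside_of_on hc s.lt₁₂.ne u1 u2⟩
  have hw := (center_mem_region hc w w1.1 s).2 ⟨inside_of_on hc s.lt₂₃.ne w1 w2, Or.inl w1, Or.inl w2⟩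
  have e1 := key s.lt₁₂.ne u1 u2 hu
  have e2 := key s.lt₁₂.ne.symm u2 u1 hu
  have e3 := key s.lt₂₃.ne.symm w2 w1 hw
  have f1 := s.lt₁₂
  have f2 := s.lt₂₃
  have g1 := t.lt₁₂
  have g2 := t.lt₂₃
  ext1
  · rcases e1 with e | e | e <;> rcases e2 with e' | e' | e' <;> rcases e3 with e'' | e'' | e'' <;>
      rw [e, e'] at f1 <;> rw [e', e''] at f2 <;> first | exact e | omega
  · rcases e1 with e | e | e <;> rcases e2 with e' | e' | e' <;> rcases e3 with e'' | e'' | e'' <;>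
      rw [e, e'] at f1 <;> rw [e', e''] at f2 <;> first | exact e' | omega
  · rcases e1 with e | e | e <;> rcases e2 with e' | e' | e' <;> rcases e3 with e'' | e'' | e'' <;>
      rw [e, e'] at f1 <;> rw [e', e''] at f2 <;> first | exact e'' | omega

end Tiling
end RhombusTiling

end

/-! ### Ranking of the directions, and the arrangement of a tiling -/

noncomputable section

namespace RhombusTiling
variable {n : ℕ} {v : Fin n → Plane} {a : Fin n → ℕ}

/-- The half-open upper half plane. -/
def Upper (x : Plane) : Prop := 0 < x 1 ∨ (x 1 = 0 ∧ 0 < x 0)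

theorem upper_or_neg {x : Plane} (hx : x ≠ 0) : Upper x ∨ Upper (-x) := by
  unfold Upper
  have : x 0 ≠ 0 ∨ x 1 ≠ 0 := by
    by_contra h
    push Not at h
    exact hx (by ext i; fin_cases i <;> simp [h.1, h.2])
  simp only [PiLp.neg_apply, neg_pos, neg_eq_zero]
  rcases lt_trichotomy (x 1) 0 with h | h | h
  · exact Or.inr (Or.inl h)
  · rcases lt_or_gt_of_ne (this.resolve_right (fun h' => h' h)) with h' | h'
    · exact Or.inr (Or.inr ⟨h, h'⟩)
    · exact Or.inl (Or.inr ⟨h, h'⟩)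
  · exact Or.inl (Or.inl h)

theorem Upper.cross_trans {x y z : Plane} (hx : Upper x) (hy : Upper y) (hz : Upper z)
    (h1 : 0 < cross x y) (h2 : 0 < cross y z) : 0 < cross x z := by
  unfold Upper cross at *
  have e : y 1 * (x 0 * z 1 - x 1 * z 0) = z 1 * (x 0 * y 1 - x 1 * y 0)
    + x 1 * (y 0 * z 1 - y 1 * z 0) := by ring
  have hz1 : 0 ≤ z 1 := hz.elim le_of_lt fun h => h.1.ge
  have hx1 : 0 ≤ x 1 := hx.elim le_of_lt fun h => h.1.ge
  rcases hy with hy | ⟨hy, hy'⟩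
  · rcases hz with hz | ⟨hz, hz'⟩
    · have : 0 < y 1 * (x 0 * z 1 - x 1 * z 0) := by
        rw [e]
        have := mul_pos hz h1
        have := mul_nonneg hx1 h2.le
        linarith
      exact pos_of_mul_pos_right this hy.le
    · rw [hz] at h2; nlinarith
  · rw [hy] at h1; nlinarith

/-- After reflections, the directions can be ranked counterclockwise. -/
theorem exists_rank [Nontrivial (Fin n)] (hc : General v) :
    ∃ (ε : Fin n → Prop) (β : Fin n → Fin n), Function.Injective β ∧
    ∀ i j, i ≠ j → (0 < cross (v i) (v j) ↔ ((ε i ↔ ε j) ↔ β i < β j)) := by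
  classical
  -- In the half-open upper half plane the sign of `cross` orders the directions linearly. The rank
  -- of a direction is the number of directions before it, and `ε` tells which vectors were not
  -- reflected.
  set u : Fin n → Plane := fun i => if Upper (v i) then v i else -v i with hu
  have hup : ∀ i, Upper (u i) := fun i => by
    simp only [hu]
    split_ifs with h
    · exact h
    · exact (upper_or_neg (hc.ne_zero i)).resolve_left h
  have hcu : ∀ i j, i ≠ j → cross (u i) (u j) ≠ 0 := fun i j h => by
    have := hc i j h
    simp only [hu]
    split_ifs <;> simpa [cross_neg, neg_cross] using this
  have hlt : ∀ i j, 0 < cross (u i) (u j) →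
      (Finset.univ.filter fun k => 0 < cross (u k) (u i)).card <
        (Finset.univ.filter fun k => 0 < cross (u k) (u j)).card := by
    intro i j h
    refine Finset.card_lt_card ⟨fun k hk => ?_, fun hs => ?_⟩
    · simp only [Finset.mem_filter, Finset.mem_univ, true_and] at *
      exact (hup k).cross_trans (hup i) (hup j) hk h
    · have := hs (Finset.mem_filter.2 ⟨Finset.mem_univ i, h⟩)
      simp [cross_self] at this
  have hcard : ∀ i, (Finset.univ.filter fun k => 0 < cross (u k) (u i)).card < n := fun i => by
    have : (Finset.univ.filter fun k => 0 < cross (u k) (u i)).card <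
        (Finset.univ : Finset (Fin n)).card :=
      Finset.card_lt_card ⟨Finset.subset_univ _, fun hs => by
        simpa [cross_self] using hs (Finset.mem_univ i)⟩
    simpa using this
  refine ⟨fun i => Upper (v i), fun i => ⟨_, hcard i⟩, fun i j h => ?_, fun i j hij => ?_⟩
  · by_contra hij
    have h' := congrArg Fin.val h
    rcases lt_or_gt_of_ne (hcu i j hij) with h1 | h1
    · rw [cross_comm] at h1
      exact (hlt j i (by linarith)).ne' h'
    · exact (hlt i j h1).ne h'
  · have key : 0 < cross (u i) (u j) ↔
        (Finset.univ.filter fun k => 0 < cross (u k) (u i)).card <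
        (Finset.univ.filter fun k => 0 < cross (u k) (u j)).card := by
      refine ⟨hlt i j, fun h => ?_⟩
      rcases lt_or_gt_of_ne (hcu i j hij) with h1 | h1
      · rw [cross_comm] at h1
        exact absurd (hlt j i (by linarith)) h.asymm
      · exact h1
    rw [Fin.mk_lt_mk, ← key]
    have h0 := hc i j hij
    have hneg : 0 < -cross (v i) (v j) ↔ ¬ 0 < cross (v i) (v j) := by
      rw [neg_pos, not_lt]
      exact ⟨le_of_lt, fun h => lt_of_le_of_ne h h0⟩
    simp only [hu]
    by_cases hi : Upper (v i) <;> by_cases hj : Upper (v j) <;>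
      simp only [hi, hj, if_true, if_false, cross_neg, neg_cross, neg_neg, hneg, iff_self, true_iff,
        iff_false, false_iff, not_not, iff_true, not_true]

theorem IsArr.Uncrossed.swap₁ {L : Type*} {nb : L → L → L → Prop} {p q r : L}
    (h : IsArr.Uncrossed nb p q r) : IsArr.Uncrossed nb q p r :=
  ⟨h.2.1, h.1, fun u hu => h.2.2 u hu.symm⟩

theorem IsArr.Uncrossed.swap₂ {L : Type*} {nb : L → L → L → Prop} {p q r : L}
    (h : IsArr.Uncrossed nb p q r) : IsArr.Uncrossed nb p r q :=
  ⟨fun u hu => h.1 u hu.symm, h.2.2, h.2.1⟩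

namespace Tiling

theorem before_parallel' [Nontrivial (Fin n)] {T : Tiling v a} (hc : General v) {l m r : Line a}
    (h : m.1 = r.1) (hlm : l.1 ≠ m.1) (hmr : m ≠ r) :
    T.Before l m r ↔ (0 < cross (v l.1) (v m.1) ↔ m.2.val < r.2.val) := by
  obtain ⟨k, m⟩ := m
  obtain ⟨k', r⟩ := r
  obtain rfl : k = k' := h
  have hne : m ≠ r := fun h => hmr (by rw [h])
  rcases lt_or_gt_of_ne hne with h | h
  · rw [before_parallel hc hlm h]
    simp only [Fin.val_fin_lt, h, iff_true]
  · have h' : ¬ m < r := h.asymm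
    rw [← Before.not_iff T hc (m := ⟨k, r⟩) (r := ⟨k, m⟩) hlm.symm hlm.symm hmr.symm, before_parallel hc hlm h]
    simp only [Fin.val_fin_lt, h', iff_false]

variable {v : Fin 4 → Plane} {a : Fin 4 → ℕ} {T T' : Tiling v a}

/-- Reflecting the vectors with `¬ ε i` reverses the traversal of the lines of the bundle as well as
their numbering. Afterwards the signs of `cross` are comparisons of ranks, and the axioms are those
of `Before`. -/
theorem isArr (T : Tiling v a) (hc : General v) {ε : Fin 4 → Prop} {β : Fin 4 → Fin 4}
    (hβ : Function.Injective β)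
    (h : ∀ i j, i ≠ j → (0 < cross (v i) (v j) ↔ ((ε i ↔ ε j) ↔ β i < β j))) :
    IsArr (fun l : Line a => β l.1) (fun m r => (ε m.1 ↔ m.2.val < r.2.val))
      (fun l m r => (ε l.1 ∧ T.Before l m r) ∨ (¬ ε l.1 ∧ T.Before l r m)) where
  ne := by
    rintro l m r (⟨-, h⟩ | ⟨-, h⟩)
    · exact ⟨hβ.ne h.1, hβ.ne h.2.1⟩
    · exact ⟨hβ.ne h.2.1, hβ.ne h.1⟩
  irrefl l m := by
    have := Before.irrefl (T := T) hc l m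
    tauto
  trans := by
    rintro l m q r (⟨e, h⟩ | ⟨e, h⟩) (⟨e', h'⟩ | ⟨e', h'⟩)
    · exact Or.inl ⟨e, h.trans hc h'⟩
    · exact absurd e e'
    · exact absurd e' e
    · exact Or.inr ⟨e, h'.trans hc h⟩
  total := by
    intro l m r hm hr hmr
    have := Before.total T hc (l := l) (m := m) (r := r) (fun h => hm (congrArg β h))
      (fun h => hr (congrArg β h)) hmr
    by_cases e : ε l.1 <;> simp only [e, true_and, false_and, not_true, not_false_iff, or_false,
      false_or]
    · exact this
    · exact this.symm
  par := by
    intro l m r hmr hlm hne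
    have hmr' := hβ hmr
    have hlm' : l.1 ≠ m.1 := fun h => hlm (congrArg β h)
    have e1 := before_parallel' hc (T := T) hmr' hlm' hne
    have e2 := Before.not_iff T hc hlm'.symm (hmr' ▸ hlm'.symm) hne
    rw [← e2, e1, h _ _ hlm']
    by_cases p1 : ε l.1 <;> by_cases p2 : ε m.1 <;> by_cases p3 : β l.1 < β m.1 <;>
      by_cases p4 : m.2.val < r.2.val <;> simp [p1, p2, p3, p4]
  tri := by
    intro l m r hlm hlr hmr
    have hlm' : l.1 ≠ m.1 := fun h => hlm (congrArg β h)
    have hlr' : l.1 ≠ r.1 := fun h => hlr (congrArg β h)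
    have hmr' : m.1 ≠ r.1 := fun h => hmr (congrArg β h)
    have e1 := before_triangle hc (T := T) hlm' hlr' hmr'
    have e2 := Before.not_iff T hc hlr'.symm hlm'.symm (fun h => hmr' (congrArg _ h.symm))
    have e3 := Before.not_iff T hc hmr'.symm hlm' (fun h => hlr' (congrArg _ h.symm))
    rw [← e2, ← e3, e1, h _ _ hlr', h _ _ hmr']
    by_cases p1 : ε l.1 <;> by_cases p2 : ε m.1 <;> by_cases p3 : ε r.1 <;>
      by_cases p4 : T.Before m r l <;> by_cases p5 : β l.1 < β r.1 <;>
      by_cases p6 : β m.1 < β r.1 <;> simp [p1, p2, p3, p4, p5, p6]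

theorem bt_turn {L : Type*} {nb : L → L → L → Prop} {ε : L → Prop} {l x w y : L} :
    IsArr.Bt (fun l m r => (ε l ∧ nb l m r) ∨ (¬ ε l ∧ nb l r m)) l x w y ↔
      IsArr.Bt nb l x w y := by
  unfold IsArr.Bt
  by_cases e : ε l <;> simp only [e, true_and, false_and, not_true, not_false_iff, or_false,
      false_or]
  tauto

/-- If neither part is inverted, both orders hold in `T'` too, and transitivity there contradicts
the inversion of the whole. -/
theorem Inv.split [Nontrivial (Fin n)] {v : Fin n → Plane} {a : Fin n → ℕ} {T T' : Tiling v a}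
    (hc : General v) {l x w y : Line a} (h : IsArr.Bt T.Before l x w y) (hI : Inv T T' l x y) :
    Inv T T' l x w ∨ Inv T T' l w y := by
  by_contra hn
  push Not at hn
  have key : ∀ {x w y}, T.Before l x w → T.Before l w y → ¬ Inv T T' l x w → ¬ Inv T T' l w y →
      T'.Before l x y := by
    intro x w y h1 h2 n1 n2
    have d1 : x ≠ w := by rintro rfl; exact Before.irrefl hc _ _ h1
    have d2 : w ≠ y := by rintro rfl; exact Before.irrefl hc _ _ h2
    exact ((same_of_not_inv hc h1.1 h1.2.1 d1 n1).1 h1).trans hc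
      ((same_of_not_inv hc h2.1 h2.2.1 d2 n2).1 h2)
  rcases h with ⟨h1, h2⟩ | ⟨h1, h2⟩
  · exact hI.2.1 (h1.trans hc h2) (key h1 h2 hn.1 hn.2)
  · exact (hI.swap₂ hc).2.1 (h1.trans hc h2)
      (key h1 h2 (fun h => hn.2 (h.swap₂ hc)) (fun h => hn.1 (h.swap₂ hc)))

/-- Both orders are reversed in `T'`, so by transitivity the composed one is as well. This also
shows that `x` and `y` are not parallel, because the order of parallel lines never changes. -/
theorem Inv.join [Nontrivial (Fin n)] {v : Fin n → Plane} {a : Fin n → ℕ} {T T' : Tiling v a}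
    (hc : General v) {l x w y : Line a} (h : IsArr.Bt T.Before l x w y) (h1 : Inv T T' l x w)
    (h2 : Inv T T' l w y) : Inv T T' l x y := by
  have key : ∀ {x w y}, T.Before l x w → T.Before l w y → Inv T T' l x w → Inv T T' l w y →
      Inv T T' l x y := by
    intro x w y b1 b2 h1 h2
    have c1 := (Before.not_iff T' hc b1.1 b1.2.1 (fun h => h1.1.2.2 (congrArg _ h))).1 (h1.2.1 b1)
    have c2 := (Before.not_iff T' hc b2.1 b2.2.1 (fun h => h2.1.2.2 (congrArg _ h))).1 (h2.2.1 b2)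
    have b := b1.trans hc b2
    have c := c2.trans hc c1
    have hn : x ≠ y := by rintro rfl; exact Before.irrefl hc _ _ b
    have c' : ¬ T'.Before l x y := fun h => Before.irrefl hc _ _ (h.trans hc c)
    by_contra hI
    exact c' ((same_of_not_inv hc b.1 b.2.1 hn hI).1 b)
  rcases h with ⟨b1, b2⟩ | ⟨b1, b2⟩
  · exact key b1 b2 h1 h2
  · exact (key b1 b2 (h2.swap₂ hc) (h1.swap₂ hc)).swap₂ hc

theorem exists_sorted_triple {n : ℕ} {a : Fin n → ℕ} (P : Line a → Line a → Line a → Prop)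
    (h₁ : ∀ {p q r}, P p q r → P q p r) (h₂ : ∀ {p q r}, P p q r → P p r q) {p q r : Line a}
    (hpq : p.1 ≠ q.1) (hpr : p.1 ≠ r.1) (hqr : q.1 ≠ r.1) (h : P p q r) :
    ∃ t : Triple a, P t.l₁ t.l₂ t.l₃ := by
  have key : ∀ {p q r}, p.1 < q.1 → q.1 < r.1 → P p q r → ∃ t : Triple a, P t.l₁ t.l₂ t.l₃ :=
    fun {p q r} h1 h2 h => ⟨⟨p, q, r, h1, h2⟩, h⟩
  rcases lt_or_gt_of_ne hpq with a1 | a1 <;> rcases lt_or_gt_of_ne hpr with a2 | a2 <;>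
    rcases lt_or_gt_of_ne hqr with a3 | a3
  · exact key a1 a3 h
  · exact key a2 a3 (h₂ h)
  · exact absurd a2 (a1.trans a3).asymm
  · exact key a2 a1 (h₁ (h₂ h))
  · exact key a1 a2 (h₁ h)
  · exact absurd a1 (a2.trans a3).asymm
  · exact key a3 a2 (h₂ (h₁ h))
  · exact key a3 a1 (h₁ (h₂ (h₁ h)))

/-- Among the inverted triangles there is one that no line crosses. -/
theorem exists_uncrossed (hc : General v) {p q r : Line a} (h : Inv T T' p q r) :
    ∃ t : Triple a, IsInverted T T' t ∧ IsArr.Uncrossed T.Before t.l₁ t.l₂ t.l₃ := by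
  obtain ⟨ε, β, hβ, hr⟩ := exists_rank hc
  have H := isArr T hc hβ hr
  have HI : IsArr.IsInv (fun l : Line a => β l.1)
      (fun l m r => (ε l.1 ∧ T.Before l m r) ∨ (¬ ε l.1 ∧ T.Before l r m)) (Inv T T') :=
    { ne := fun h => ⟨hβ.ne h.1.1, hβ.ne h.1.2.1, hβ.ne h.1.2.2⟩
      swap₁ := Inv.swap₁ hc
      swap₂ := Inv.swap₂ hc
      split := fun h hI => Inv.split hc ((bt_turn (ε := fun l : Line a => ε l.1)).1 h) hI
      join := fun h h1 h2 => Inv.join hc ((bt_turn (ε := fun l : Line a => ε l.1)).1 h) h1 h2 }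
  obtain ⟨p, q, r, hI, hU⟩ := H.exists_empty HI h
  have hU' : IsArr.Uncrossed T.Before p q r :=
    ⟨fun u hu => hU.1 u ((bt_turn (ε := fun l : Line a => ε l.1)).2 hu),
      fun u hu => hU.2.1 u ((bt_turn (ε := fun l : Line a => ε l.1)).2 hu),
      fun u hu => hU.2.2 u ((bt_turn (ε := fun l : Line a => ε l.1)).2 hu)⟩
  obtain ⟨t, h1, h2⟩ := exists_sorted_triple
    (fun p q r => Inv T T' p q r ∧ IsArr.Uncrossed T.Before p q r)
    (fun h => ⟨h.1.swap₁ hc, h.2.swap₁⟩) (fun h => ⟨h.1.swap₂ hc, h.2.swap₂⟩)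
    hI.1.1 hI.1.2.1 hI.1.2.2 ⟨hI, hU'⟩
  exact ⟨t, (isInverted_iff hc).2 (h1.swap₂ hc), h2⟩

end Tiling
end RhombusTiling

end

/-! ### A tiling is determined by the orders of its crossings -/

noncomputable section

namespace RhombusTiling
variable {n : ℕ} {v : Fin n → Plane} {a : Fin n → ℕ}

open scoped Classical in
/-- The vector `±v j` that points to the positive side of `v i`. -/
def turn (v : Fin n → Plane) (i j : Fin n) : Plane := if 0 < cross (v i) (v j) then v j else -v j

namespace Tiling
variable {T T' : Tiling v a} [Nontrivial (Fin n)]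

theorem On.other (_hc : General v) {l m : Line a} (hlm : l.1 ≠ m.1) {t : Tile n} (h1 : T.On l t)
    (h2 : T.On m t) : t.other l.1 = m.1 :=
  (((Tile.hasDir_iff h1.2.1).1 h2.2.1).resolve_left hlm.symm).symm

theorem exists_on_other (hc : General v) {l : Line a} {t : Tile n} (h : T.On l t) :
    ∃ m : Line a, l.1 ≠ m.1 ∧ T.On m t := by
  obtain ⟨m, hm⟩ := T.exists_on hc h.1 (t.hasDir_other l.1)
  exact ⟨_, (Tile.other_ne h.2.1).symm, hm⟩

open scoped Classical in
/-- The position of a crossing is determined by the lines crossed before. -/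
theorem On.lft_eq (hc : General v) {l m : Line a} (hlm : l.1 ≠ m.1) {t : Tile n} (h1 : T.On l t)
    (h2 : T.On m t) : t.lft v l.1 = startPt v a l +
      ∑ w ∈ Finset.univ.filter (fun w => T.Before l w m), turn v l.1 w.1 := by
  -- Along the ribbon, passing a tile that lies on `w₀` shifts the edge by `turn v l.1 w₀.1` and
  -- adds just `w₀` to the lines crossed so far.
  have key : ∀ b, T.Reach l.1 (startPt v a l) b → b = startPt v a l +
      ∑ w ∈ Finset.univ.filter (fun w : Line a => w.1 ≠ l.1 ∧ ∃ s, T.On l s ∧ T.On w s ∧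
        cross (v l.1) (s.rgt v l.1) ≤ cross (v l.1) b), turn v l.1 w.1 := by
    intro b hb
    induction hb with
    | refl =>
      rw [Finset.filter_eq_empty_iff.2, Finset.sum_empty, add_zero]
      rintro w - ⟨-, s, hs, -, hle⟩
      have h3 := Tile.cross_lft_lt_rgt hc hs.2.1
      have h4 := lo_le (T.subset_zonotope hs.1 (Tile.lft_mem hs.2.1)) l.1
      rw [cross_startPt] at hle
      linarith
    | tail hr hn ih =>
      obtain ⟨t, ht, htl, rfl, rfl⟩ := hn
      have hon : T.On l t := ⟨ht, htl, hr⟩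
      obtain ⟨w₀, hw, hw₀⟩ := exists_on_other hc hon
      have hlt := Tile.cross_lft_lt_rgt hc htl
      have : (Finset.univ.filter (fun w : Line a => w.1 ≠ l.1 ∧ ∃ s, T.On l s ∧ T.On w s ∧
          cross (v l.1) (s.rgt v l.1) ≤ cross (v l.1) (t.rgt v l.1))) =
          insert w₀ (Finset.univ.filter (fun w : Line a => w.1 ≠ l.1 ∧ ∃ s, T.On l s ∧ T.On w s ∧
          cross (v l.1) (s.rgt v l.1) ≤ cross (v l.1) (t.lft v l.1))) := by
        ext w
        simp only [Finset.mem_insert, Finset.mem_filter, Finset.mem_univ, true_and]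
        constructor
        · rintro ⟨hwl, s, hs, hws, hle⟩
          rcases hs.reach_or hc hon with rfl | h | h
          · refine Or.inl (hws.eq_of_fst_eq hc hw₀ ?_)
            rw [← hs.other hc (Ne.symm hwl) hws, ← hs.other hc hw hw₀]
          · exact Or.inr ⟨hwl, s, hs, hws, Reach.le hc h⟩
          · have := Reach.le hc h
            have := Tile.cross_lft_lt_rgt hc hs.2.1
            linarith
        · rintro (rfl | ⟨hwl, s, hs, hws, hle⟩)
          · exact ⟨hw.symm, t, hon, hw₀, le_rfl⟩
          · exact ⟨hwl, s, hs, hws, hle.trans hlt.le⟩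
      rw [this, Finset.sum_insert, ← hon.other hc hw hw₀, add_left_comm, ← ih, add_comm]
      · rfl
      · simp only [Finset.mem_filter, Finset.mem_univ, true_and, not_and, not_exists]
        intro _ s hs hws hle
        rw [cross_unique hc hw hs hws hon hw₀] at hle
        linarith
  rw [key _ h1.2.2]
  congr 2
  ext w
  simp only [Finset.mem_filter, Finset.mem_univ, true_and]
  constructor
  · rintro ⟨hwl, s, hs, hws, hle⟩
    exact ⟨hwl, hlm.symm, s, t, hs, hws, h1, h2, (Tile.cross_lft_lt_rgt hc hs.2.1).trans_le hle⟩
  · intro h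
    obtain ⟨hwl, -, s, t', hs, hws, -⟩ := id h
    refine ⟨hwl, s, hs, hws, ?_⟩
    exact Reach.le hc (hs.reach_rgt_of_lt hc h1 (h.lt hc hs hws h1 h2))

theorem tile_ext {s t : Tile n} {k j : Fin n} (hkj : k ≠ j) (h1 : s.HasDir k) (h2 : s.HasDir j)
    (h3 : t.HasDir k) (h4 : t.HasDir j) (h : s.lft v k = t.lft v k) : s = t := by
  have e1 := ((Tile.hasDir_iff h1).1 h2).resolve_left hkj.symm
  have e2 := ((Tile.hasDir_iff h3).1 h4).resolve_left hkj.symm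
  have hb : s.base = t.base := by
    unfold Tile.lft at h
    rw [← e1, ← e2] at h
    split_ifs at h
    · exact h
    · exact add_right_cancel h
  obtain ⟨sb, si, sj, slt⟩ := s
  obtain ⟨tb, ti, tj, tlt⟩ := t
  unfold Tile.HasDir at *
  simp only at *
  rcases h1 with h1 | h1 <;> rcases h2 with h2 | h2 <;> rcases h3 with h3 | h3 <;>
    rcases h4 with h4 | h4 <;> grind

theorem eq_of_before_iff (hc : General v)
    (h : ∀ l m r : Line a, T.Before l m r ↔ T'.Before l m r) : T = T' := by
  have key : ∀ {T T' : Tiling v a}, (∀ l m r : Line a, T.Before l m r ↔ T'.Before l m r) →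
      T.tiles ⊆ T'.tiles := by
    intro T T' h t ht
    obtain ⟨m, hm⟩ := T.exists_on hc ht (Or.inl rfl : t.HasDir t.i)
    obtain ⟨r, hmr, hr⟩ := exists_on_other hc hm
    obtain ⟨t', h1, h2⟩ := T'.exists_cross hc hmr
    have e1 := On.lft_eq hc hmr hm hr
    have e2 := On.lft_eq hc hmr h1 h2
    have e : t.lft v t.i = t'.lft v t.i := by
      rw [e1, e2]
      exact congrArg (_ + ·) (Finset.sum_congr (by ext w; simp [h]) fun _ _ => rfl)
    rw [tile_ext hmr hm.2.1 hr.2.1 h1.2.1 h2.2.1 e]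
    exact h1.1
  ext1
  exact (key h).antisymm (key fun l m r => (h l m r).symm)

theorem eq_of_not_inv (hc : General v) (h : ∀ l m r : Line a, ¬ Inv T T' l m r) : T = T' := by
  refine eq_of_before_iff hc fun l m r => ?_
  by_cases hm : m.1 ≠ l.1
  · by_cases hr : r.1 ≠ l.1
    · by_cases hmr : m = r
      · subst hmr
        exact iff_of_false (Before.irrefl hc _ _) (Before.irrefl hc _ _)
      · exact same_of_not_inv hc hm hr hmr (h l m r)
    · exact iff_of_false (fun h => hr h.2.1) (fun h => hr h.2.1)
  · exact iff_of_false (fun h => hm h.1) (fun h => hm h.1)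

end Tiling
end RhombusTiling

end

noncomputable section

namespace RhombusTiling
variable {n : ℕ} {v : Fin n → Plane} {a : Fin n → ℕ}

/-! ### Hexagons -/

/-- `t` is the parallelogram with corner `o` spanned by `α • v i` and `β • v j`, for signs
`α` and `β`. -/
structure Fits (v : Fin n → Plane) (t : Tile n) (o : Plane) (α : ℝ) (i : Fin n) (β : ℝ)
    (j : Fin n) : Prop where
  dir : t.HasDir i
  other : t.other i = j
  base : t.base = o + ((α - 1) / 2) • v i + ((β - 1) / 2) • v j

/-- The vectors `α • v i`, `β • v j` and `γ • v k`, for signs `α`, `β`, `γ`, positively span the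
plane. -/
structure IsHex (v : Fin n → Plane) (i j k : Fin n) (α β γ : ℝ) : Prop where
  sα : α = 1 ∨ α = -1
  sβ : β = 1 ∨ β = -1
  sγ : γ = 1 ∨ γ = -1
  opp₁ : cross (v i) (β • v j) * cross (v i) (γ • v k) < 0
  opp₂ : cross (v j) (α • v i) * cross (v j) (γ • v k) < 0
  opp₃ : cross (v k) (α • v i) * cross (v k) (β • v j) < 0

variable {t : Tile n} {o : Plane} {i j k : Fin n} {α β γ : ℝ}

theorem Fits.symm (h : Fits v t o α i β j) : Fits v t o β j α i where
  dir := h.other ▸ t.hasDir_other i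
  other := h.other ▸ Tile.other_other h.dir
  base := by rw [h.base]; abel

theorem Fits.ne (h : Fits v t o α i β j) : i ≠ j := by
  rw [← h.other]
  exact (Tile.other_ne h.dir).symm

theorem Fits.hasDir_iff {d : Fin n} (h : Fits v t o α i β j) : t.HasDir d ↔ d = i ∨ d = j := by
  rw [Tile.hasDir_iff h.dir, h.other]

/-- `(α - 1) / 2` is 0 or -1: a tile is recorded by the corner from which both of its vectors are
added, so a negative sign moves the base back by one edge. -/
theorem Fits.carrier (h : Fits v t o α i β j) (hα : α = 1 ∨ α = -1) (hβ : β = 1 ∨ β = -1) :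
    t.carrier v = para o (α • v i) (β • v j) := by
  rw [Tile.carrier_eq_base h.dir, h.other, h.base]
  rcases hα with rfl | rfl <;> rcases hβ with rfl | rfl
  · norm_num
  · rw [para_flip]; norm_num
  · rw [para_swap, para_flip, para_swap]; norm_num [add_right_comm]
  · rw [para_flip, para_swap, para_flip, para_swap]
    have e : o + v i + v j + -v i + -v j = o := by abel
    norm_num [add_right_comm, e]

theorem Fits.lft (h : Fits v t o α i β j) (hβ : β = 1 ∨ β = -1) (hp : 0 < cross (v i) (β • v j)) :
    t.lft v i = o + ((α - 1) / 2) • v i ∧ t.rgt v i = o + ((α - 1) / 2) • v i + β • v j := by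
  rw [cross_smul] at hp
  unfold Tile.rgt Tile.lft Tile.stp
  rw [h.other, h.base]
  rcases hβ with rfl | rfl
  · rw [if_pos (by linarith), if_pos (by linarith)]
    constructor <;> module
  · rw [if_neg (by linarith), if_neg (by linarith)]
    constructor <;> module

theorem Fits.rgt (h : Fits v t o α i β j) (hβ : β = 1 ∨ β = -1) (hp : cross (v i) (β • v j) < 0) :
    t.lft v i = o + ((α - 1) / 2) • v i + β • v j ∧ t.rgt v i = o + ((α - 1) / 2) • v i := by
  rw [cross_smul] at hp
  unfold Tile.rgt Tile.lft Tile.stp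
  rw [h.other, h.base]
  rcases hβ with rfl | rfl
  · rw [if_neg (by linarith), if_neg (by linarith)]
    constructor <;> module
  · rw [if_pos (by linarith), if_pos (by linarith)]
    constructor <;> module

namespace IsHex

theorem swap₁ (h : IsHex v i j k α β γ) : IsHex v j i k β α γ :=
  ⟨h.sβ, h.sα, h.sγ, h.opp₂, h.opp₁, by rw [mul_comm]; exact h.opp₃⟩

theorem swap₂ (h : IsHex v i j k α β γ) : IsHex v i k j α γ β :=
  ⟨h.sα, h.sγ, h.sβ, by rw [mul_comm]; exact h.opp₁, h.opp₃, h.opp₂⟩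

theorem neg (h : IsHex v i j k α β γ) : IsHex v i j k (-α) (-β) (-γ) where
  sα := by rcases h.sα with rfl | rfl <;> simp
  sβ := by rcases h.sβ with rfl | rfl <;> simp
  sγ := by rcases h.sγ with rfl | rfl <;> simp
  opp₁ := by simpa only [neg_smul, cross_neg, neg_mul_neg] using h.opp₁
  opp₂ := by simpa only [neg_smul, cross_neg, neg_mul_neg] using h.opp₂
  opp₃ := by simpa only [neg_smul, cross_neg, neg_mul_neg] using h.opp₃

/-- The identity `e` holds for any three vectors of the plane. In terms of the signed vectors its
coefficients have a common sign, by the conditions `opp`, and the factor `s` makes them positive. -/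
theorem relation (h : IsHex v i j k α β γ) : ∃ c₁ c₂ c₃ : ℝ, 0 < c₁ ∧ 0 < c₂ ∧ 0 < c₃ ∧
    c₁ • (α • v i) + c₂ • (β • v j) + c₃ • (γ • v k) = 0 := by
  have h1 := h.opp₁
  have h2 := h.opp₂
  have h3 := h.opp₃
  simp only [cross_smul] at h1 h2 h3
  have e : cross (v j) (v k) • v i + cross (v k) (v i) • v j + cross (v i) (v j) • v k = 0 := by
    ext m
    fin_cases m <;> simp [cross] <;> ring
  have sq : ∀ {x : ℝ}, x = 1 ∨ x = -1 → x * x = 1 := by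
    rintro x (rfl | rfl) <;> norm_num
  have qα := sq h.sα
  have qβ := sq h.sβ
  have qγ := sq h.sγ
  rw [cross_comm (v j) (v i)] at h2
  rw [cross_comm (v k) (v j)] at h3
  rw [cross_comm (v i) (v k)] at h1
  have key : ∀ s : ℝ, (s * (α * cross (v j) (v k))) • (α • v i) +
      (s * (β * cross (v k) (v i))) • (β • v j) + (s * (γ * cross (v i) (v j))) • (γ • v k) = 0 := by
    intro s
    have : (s * (α * cross (v j) (v k))) • (α • v i) +
      (s * (β * cross (v k) (v i))) • (β • v j) + (s * (γ * cross (v i) (v j))) • (γ • v k) =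
      s • ((α * α) • (cross (v j) (v k) • v i) + (β * β) • (cross (v k) (v i) • v j) +
        (γ * γ) • (cross (v i) (v j) • v k)) := by module
    rw [this, qα, qβ, qγ, one_smul, one_smul, one_smul, e, smul_zero]
  have p12 : 0 < (α * cross (v j) (v k)) * (β * cross (v k) (v i)) := by nlinarith
  have p13 : 0 < (α * cross (v j) (v k)) * (γ * cross (v i) (v j)) := by nlinarith
  rcases pos_and_pos_or_neg_and_neg_of_mul_pos p12 with ⟨b1, b2⟩ | ⟨b1, b2⟩
  · exact ⟨_, _, _, by linarith, by linarith, by linarith [pos_of_mul_pos_right p13 b1.le], key 1⟩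
  · exact ⟨_, _, _, by linarith, by linarith, by linarith [neg_of_mul_pos_right p13 b1.le], key (-1)⟩

end IsHex

/-- The hexagon spanned by three vectors. -/
def hexSet (o u₁ u₂ u₃ : Plane) : Set Plane :=
  {x | ∃ r s t : ℝ, 0 ≤ r ∧ r ≤ 1 ∧ 0 ≤ s ∧ s ≤ 1 ∧ 0 ≤ t ∧ t ≤ 1 ∧
    x = o + r • u₁ + s • u₂ + t • u₃}

theorem hexagon_eq_hexSet (hα : α = 1 ∨ α = -1) (hβ : β = 1 ∨ β = -1) (hγ : γ = 1 ∨ γ = -1)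
    (o : Plane) : hexagon v (o + ((α - 1) / 2) • v i + ((β - 1) / 2) • v j + ((γ - 1) / 2) • v k)
      i j k = hexSet o (α • v i) (β • v j) (γ • v k) := by
  have key : ∀ α : ℝ, α = 1 ∨ α = -1 → ∃ f : ℝ → ℝ, ∀ r, 0 ≤ r → r ≤ 1 → 0 ≤ f r ∧ f r ≤ 1 ∧
      (α - 1) / 2 + r = f r * α ∧ r * α = (α - 1) / 2 + f r := by
    rintro α (rfl | rfl)
    · exact ⟨fun r => r, fun r h1 h2 => ⟨h1, h2, by ring, by ring⟩⟩
    · exact ⟨fun r => 1 - r, fun r h1 h2 => ⟨by linarith, by linarith, by ring, by ring⟩⟩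
  obtain ⟨f, hf⟩ := key α hα
  obtain ⟨g, hg⟩ := key β hβ
  obtain ⟨h, hh⟩ := key γ hγ
  ext x
  constructor
  · rintro ⟨r, s, t, r0, r1, s0, s1, t0, t1, rfl⟩
    obtain ⟨a1, a2, a3, -⟩ := hf r r0 r1
    obtain ⟨b1, b2, b3, -⟩ := hg s s0 s1
    obtain ⟨c1, c2, c3, -⟩ := hh t t0 t1
    refine ⟨f r, g s, h t, a1, a2, b1, b2, c1, c2, ?_⟩
    rw [smul_smul, smul_smul, smul_smul, ← a3, ← b3, ← c3]
    module
  · rintro ⟨r, s, t, r0, r1, s0, s1, t0, t1, rfl⟩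
    obtain ⟨a1, a2, -, a3⟩ := hf r r0 r1
    obtain ⟨b1, b2, -, b3⟩ := hg s s0 s1
    obtain ⟨c1, c2, -, c3⟩ := hh t t0 t1
    refine ⟨f r, g s, h t, a1, a2, b1, b2, c1, c2, ?_⟩
    rw [smul_smul, smul_smul, smul_smul, a3, b3, c3]
    module

theorem hexSet_swap₁ (o u₁ u₂ u₃ : Plane) : hexSet o u₁ u₂ u₃ = hexSet o u₂ u₁ u₃ := by
  ext x
  constructor <;> rintro ⟨r, s, t, r0, r1, s0, s1, t0, t1, rfl⟩ <;>
    exact ⟨s, r, t, s0, s1, r0, r1, t0, t1, by module⟩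

theorem hexSet_swap₂ (o u₁ u₂ u₃ : Plane) : hexSet o u₁ u₂ u₃ = hexSet o u₁ u₃ u₂ := by
  ext x
  constructor <;> rintro ⟨r, s, t, r0, r1, s0, s1, t0, t1, rfl⟩ <;>
    exact ⟨r, t, s, r0, r1, t0, t1, s0, s1, by module⟩

theorem hexSet_neg (o u₁ u₂ u₃ : Plane) :
    hexSet o u₁ u₂ u₃ = hexSet (o + u₁ + u₂ + u₃) (-u₁) (-u₂) (-u₃) := by
  ext x
  constructor <;> rintro ⟨r, s, t, r0, r1, s0, s1, t0, t1, rfl⟩ <;>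
    exact ⟨1 - r, 1 - s, 1 - t, by linarith, by linarith, by linarith, by linarith, by linarith,
      by linarith, by module⟩

theorem para_subset_hexSet (o u₁ u₂ u₃ : Plane) : para o u₁ u₂ ⊆ hexSet o u₁ u₂ u₃ := by
  rintro x ⟨r, s, r0, r1, s0, s1, rfl⟩
  exact ⟨r, s, 0, r0, r1, s0, s1, le_rfl, zero_le_one, by module⟩

/-- The three coordinates of a point may be changed by multiples of the relation. Subtracting the
largest multiple that keeps them nonnegative makes one of them vanish, and the others do not exceed
1. -/
theorem hexSet_eq {u₁ u₂ u₃ : Plane} {c₁ c₂ c₃ : ℝ} (h₁ : 0 < c₁) (h₂ : 0 < c₂) (h₃ : 0 < c₃)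
    (h : c₁ • u₁ + c₂ • u₂ + c₃ • u₃ = 0) (o : Plane) :
    hexSet o u₁ u₂ u₃ = para o u₁ u₂ ∪ para o u₁ u₃ ∪ para o u₂ u₃ := by
  refine Set.Subset.antisymm ?_ (Set.union_subset (Set.union_subset ?_ ?_) ?_)
  · rintro x ⟨r, s, t, r0, r1, s0, s1, t0, t1, rfl⟩
    have shift : ∀ l : ℝ, o + r • u₁ + s • u₂ + t • u₃ =
        o + (r - l * c₁) • u₁ + (s - l * c₂) • u₂ + (t - l * c₃) • u₃ := by
      intro l
      rw [← sub_eq_zero, ← smul_zero l, ← h]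
      module
    have key : ∀ {c r : ℝ}, 0 < c → r / c * c = r := fun hc => div_mul_cancel₀ _ hc.ne'
    have cmp : ∀ {c d r s : ℝ}, 0 < c → 0 < d → r / c ≤ s / d → 0 ≤ s - r / c * d := by
      intro c d r s _ hd hle
      have := mul_le_mul_of_nonneg_right hle hd.le
      rw [key hd] at this
      linarith
    have up : ∀ {c d r s : ℝ}, 0 < c → 0 < d → 0 ≤ r → s ≤ 1 → s - r / c * d ≤ 1 := by
      intro c d r s hc hd hr hs
      have : 0 ≤ r / c * d := by positivity
      linarith
    by_cases m1 : r / c₁ ≤ s / c₂ ∧ r / c₁ ≤ t / c₃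
    · refine Or.inr ⟨_, _, cmp h₁ h₂ m1.1, up h₁ h₂ r0 s1, cmp h₁ h₃ m1.2, up h₁ h₃ r0 t1, ?_⟩
      rw [shift (r / c₁), key h₁]
      module
    by_cases m2 : s / c₂ ≤ r / c₁ ∧ s / c₂ ≤ t / c₃
    · refine Or.inl (Or.inr ⟨_, _, cmp h₂ h₁ m2.1, up h₂ h₁ s0 r1, cmp h₂ h₃ m2.2,
        up h₂ h₃ s0 t1, ?_⟩)
      rw [shift (s / c₂), key h₂]
      module
    have m3 : t / c₃ ≤ r / c₁ ∧ t / c₃ ≤ s / c₂ := by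
      rw [not_and_or, not_le, not_le] at m1 m2
      rcases m1 with m1 | m1 <;> rcases m2 with m2 | m2 <;> constructor <;> linarith
    refine Or.inl (Or.inl ⟨_, _, cmp h₃ h₁ m3.1, up h₃ h₁ t0 r1, cmp h₃ h₂ m3.2,
        up h₃ h₂ t0 s1, ?_⟩)
    rw [shift (t / c₃), key h₃]
    module
  · exact para_subset_hexSet _ _ _ _
  · rw [hexSet_swap₂]
    exact para_subset_hexSet _ _ _ _
  · rw [hexSet_swap₁, hexSet_swap₂]
    exact para_subset_hexSet _ _ _ _

theorem para_neg (o u w : Plane) : para (o + u + w) (-u) (-w) = para o u w := by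
  rw [← para_flip, para_swap, ← para_flip, para_swap]

/-- The second tiling of the hexagon is the image of the first one under the point reflection in its
centre. -/
theorem hexSet_eq' {u₁ u₂ u₃ : Plane} {c₁ c₂ c₃ : ℝ} (h₁ : 0 < c₁) (h₂ : 0 < c₂) (h₃ : 0 < c₃)
    (h : c₁ • u₁ + c₂ • u₂ + c₃ • u₃ = 0) (o : Plane) : hexSet o u₁ u₂ u₃ =
      para (o + u₃) u₁ u₂ ∪ para (o + u₂) u₁ u₃ ∪ para (o + u₁) u₂ u₃ := by
  rw [hexSet_neg, hexSet_eq h₁ h₂ h₃ (by rw [← neg_zero, ← h]; module),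
    ← para_neg (o + u₃), ← para_neg (o + u₂), ← para_neg (o + u₁)]
  congr! 3 <;> abel

end RhombusTiling

end

noncomputable section

namespace RhombusTiling
variable {n : ℕ} {v : Fin n → Plane} {a : Fin n → ℕ}
namespace Tiling
variable {T T' : Tiling v a} [Nontrivial (Fin n)]

/-! ### Lines after a flip -/

/-- The map `φ` from `T` to `T'` reverses the order of two consecutive tiles `A`, `B` of a ribbon of
direction `v k` and fixes all other tiles of this direction. -/
structure Detour (T T' : Tiling v a) (φ : Tile n → Tile n) (k : Fin n) (A B : Tile n) : Prop where
  mem : ∀ s ∈ T.tiles, s.HasDir k → φ s ∈ T'.tiles ∧ (φ s).HasDir k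
  memA : A ∈ T.tiles ∧ A.HasDir k
  memB : B ∈ T.tiles ∧ B.HasDir k
  mid : A.rgt v k = B.lft v k
  lft : (φ B).lft v k = A.lft v k
  mid' : (φ B).rgt v k = (φ A).lft v k
  rgt : (φ A).rgt v k = B.rgt v k
  fix : ∀ s ∈ T.tiles, s.HasDir k → s ≠ A → s ≠ B → φ s = s

theorem Detour.on (hc : General v) {φ : Tile n → Tile n} {l : Line a} {A B : Tile n}
    (D : Detour T T' φ l.1 A B) {s : Tile n} (hs : T.On l s) : T'.On l (φ s) := by
  have hA := Tile.cross_lft_lt_rgt hc D.memA.2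
  have hφA := D.mem _ D.memA.1 D.memA.2
  have hφB := D.mem _ D.memB.1 D.memB.2
  -- The one edge that may get lost is the common edge of `A` and `B`. At this edge the induction
  -- remembers that the left edge of `A` is reached in `T'`; from there the tiles `φ B` and `φ A`
  -- lead on to the right edge of `B`.
  have key : ∀ b, T.Reach l.1 (startPt v a l) b →
      (b ≠ A.rgt v l.1 ∧ T'.Reach l.1 (startPt v a l) b) ∨
      (b = A.rgt v l.1 ∧ T'.Reach l.1 (startPt v a l) (A.lft v l.1)) := by
    intro b hb
    induction hb with
    | refl =>
      refine Or.inl ⟨fun h => ?_, Relation.ReflTransGen.refl⟩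
      have := lo_le (T.subset_zonotope D.memA.1 (Tile.lft_mem D.memA.2)) l.1
      rw [← h, cross_startPt] at hA
      linarith
    | tail _ hn ih =>
      obtain ⟨t, ht, htl, rfl, rfl⟩ := hn
      rcases ih with ⟨h1, h2⟩ | ⟨h1, h2⟩
      · by_cases htA : t = A
        · subst htA
          exact Or.inr ⟨rfl, h2⟩
        have htB : t ≠ B := by
          rintro rfl
          exact h1 D.mid.symm
        refine Or.inl ⟨fun h => htA (T.rgt_inj hc ht D.memA.1 htl D.memA.2 h.symm), h2.tail ?_⟩
        have hm := D.mem t ht htl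
        rw [D.fix t ht htl htA htB] at hm
        exact ⟨t, hm.1, htl, rfl, rfl⟩
      · obtain rfl := T.lft_inj hc D.memB.1 ht D.memB.2 htl (h1.trans D.mid)
        refine Or.inl ⟨fun h => ?_, (h2.tail ⟨_, hφB.1, hφB.2, D.lft, D.mid'⟩).tail
          ⟨_, hφA.1, hφA.2, rfl, D.rgt⟩⟩
        have := Tile.cross_lft_lt_rgt hc htl
        rw [h, ← D.mid] at this
        exact lt_irrefl _ this
  have hm := D.mem s hs.1 hs.2.1
  refine ⟨hm.1, hm.2, ?_⟩
  rcases key _ hs.2.2 with ⟨h1, h2⟩ | ⟨h1, h2⟩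
  · by_cases hsA : s = A
    · subst hsA
      exact h2.tail ⟨_, hφB.1, hφB.2, D.lft, D.mid'⟩
    have hsB : s ≠ B := by
      rintro rfl
      exact h1 D.mid.symm
    rwa [D.fix s hs.1 hs.2.1 hsA hsB]
  · obtain rfl := T.lft_inj hc D.memB.1 hs.1 D.memB.2 hs.2.1 (h1.trans D.mid)
    rwa [D.lft]

/-- A fixed tile is neither `A` nor `B`, so if these are on `l`, it precedes or follows both of
them, and exchanging the two does not move either of them past it. -/
theorem Detour.lt_iff (hc : General v) {φ : Tile n → Tile n} {l : Line a} {A B : Tile n}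
    (D : Detour T T' φ l.1 A B) {s t : Tile n} (hs : T.On l s) (ht : T.On l t)
    (hf : φ t = t) : cross (v l.1) ((φ s).lft v l.1) < cross (v l.1) (t.lft v l.1) ↔
      cross (v l.1) (s.lft v l.1) < cross (v l.1) (t.lft v l.1) := by
  have hA := Tile.cross_lft_lt_rgt hc D.memA.2
  have hB := Tile.cross_lft_lt_rgt hc D.memB.2
  have hφA := Tile.cross_lft_lt_rgt hc (D.mem _ D.memA.1 D.memA.2).2
  have hφB := Tile.cross_lft_lt_rgt hc (D.mem _ D.memB.1 D.memB.2).2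
  have mid := congrArg (cross (v l.1)) D.mid
  have lft := congrArg (cross (v l.1)) D.lft
  have mid' := congrArg (cross (v l.1)) D.mid'
  have rgt := congrArg (cross (v l.1)) D.rgt
  have htA : t ≠ A := by
    rintro rfl
    rw [hf] at rgt
    linarith
  have htB : t ≠ B := by
    rintro rfl
    rw [hf] at lft
    linarith
  have key : T.On l A ∨ T.On l B → cross (v l.1) (t.lft v l.1) < cross (v l.1) (A.lft v l.1) ∨
      cross (v l.1) (B.rgt v l.1) ≤ cross (v l.1) (t.lft v l.1) := by
    intro h
    have hAB : T.On l A ∧ T.On l B := by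
      rcases h with h | h
      · exact ⟨h, h.next D.memB.1 D.memB.2 D.mid.symm⟩
      · exact ⟨h.prev hc D.memA.1 D.memA.2 D.mid, h⟩
    rcases ht.reach_or hc hAB.1 with h | h | h
    · exact absurd h htA
    · have := Reach.le hc h
      have := Tile.cross_lft_lt_rgt hc ht.2.1
      exact Or.inl (by linarith)
    rcases ht.reach_or hc hAB.2 with h' | h' | h'
    · exact absurd h' htB
    · have h1 := Reach.le hc h
      have h2 := Reach.le hc h'
      have := Tile.cross_lft_lt_rgt hc ht.2.1
      linarith
    · exact Or.inr (Reach.le hc h')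
  by_cases hsA : s = A
  · subst hsA
    rcases key (Or.inl hs) with h | h <;> constructor <;> intro <;> linarith
  by_cases hsB : s = B
  · subst hsB
    rcases key (Or.inr hs) with h | h <;> constructor <;> intro <;> linarith
  rw [D.fix s hs.1 hs.2.1 hsA hsB]

/-- For every direction, `φ` fixes the tiles of this direction or is a detour. -/
def DetourOrFix (T T' : Tiling v a) (φ : Tile n → Tile n) (k : Fin n) : Prop :=
  (∀ s ∈ T.tiles, s.HasDir k → φ s = s ∧ s ∈ T'.tiles) ∨ ∃ A B, Detour T T' φ k A B

theorem DetourOrFix.on (hc : General v) {φ : Tile n → Tile n} {l : Line a}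
    (D : DetourOrFix T T' φ l.1) {s : Tile n} (hs : T.On l s) : T'.On l (φ s) := by
  rcases D with h | ⟨A, B, h⟩
  · rw [(h s hs.1 hs.2.1).1]
    refine ⟨(h s hs.1 hs.2.1).2, hs.2.1, ?_⟩
    have : ∀ b, T.Reach l.1 (startPt v a l) b → T'.Reach l.1 (startPt v a l) b := by
      intro b hb
      induction hb with
      | refl => exact Relation.ReflTransGen.refl
      | tail _ hn ih =>
        obtain ⟨t, ht, htl, h1⟩ := hn
        exact ih.tail ⟨t, (h t ht htl).2, htl, h1⟩
    exact this _ hs.2.2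
  · exact h.on hc hs

theorem DetourOrFix.lt_iff (hc : General v) {φ : Tile n → Tile n} {l : Line a}
    (D : DetourOrFix T T' φ l.1) {s t : Tile n} (hs : T.On l s) (ht : T.On l t)
    (hf : φ t = t) : cross (v l.1) ((φ s).lft v l.1) < cross (v l.1) (t.lft v l.1) ↔
      cross (v l.1) (s.lft v l.1) < cross (v l.1) (t.lft v l.1) := by
  rcases D with h | ⟨A, B, h⟩
  · rw [(h s hs.1 hs.2.1).1]
  · exact h.lt_iff hc hs ht hf

theorem not_inv_of_fix (hc : General v) {φ : Tile n → Tile n} (D : ∀ k, DetourOrFix T T' φ k)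
    {l m r : Line a} {t : Tile n} (h1 : T.On l t) (h2 : T.On r t) (hf : φ t = t) :
    ¬ Inv T T' l m r := by
  intro h
  have hr := h.1.2.1
  have hm := h.1.1
  obtain ⟨s, s1, s2⟩ := T.exists_cross hc hm
  have key : ∀ {T : Tiling v a} {s t : Tile n}, T.On l s → T.On m s → T.On l t → T.On r t →
      (T.Before l m r ↔ cross (v l.1) (s.lft v l.1) < cross (v l.1) (t.lft v l.1)) :=
    fun s1 s2 h1 h2 => ⟨fun h => h.lt hc s1 s2 h1 h2,
      fun h => ⟨hm.symm, hr.symm, _, _, s1, s2, h1, h2, h⟩⟩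
  have t1 := (D l.1).on hc h1
  have t2 := (D r.1).on hc h2
  rw [hf] at t1 t2
  have e := (D l.1).lt_iff hc s1 h1 hf
  have := h.2
  rw [key s1 s2 h1 h2, key ((D l.1).on hc s1) ((D m.1).on hc s2) t1 t2, e] at this
  tauto

/-- An inverted triangle has its crossings in tiles that are moved. -/
theorem ne_of_inv (hc : General v) {φ : Tile n → Tile n} (D : ∀ k, DetourOrFix T T' φ k)
    {l m r : Line a} (h : Inv T T' l m r) {t : Tile n} (h1 : T.On l t) (h2 : T.On r t) :
    φ t ≠ t :=
  fun hf => not_inv_of_fix hc D h1 h2 hf h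

/-- The two tiles with direction `v i` share the edge at `o`, lying on different sides of it by
`opp₁`. After the rotation they have changed places in the ribbon. -/
theorem detour_of_hex {i j k : Fin n} {α β γ : ℝ} (hH : IsHex v i j k α β γ) {o : Plane}
    {t₁ t₂ : Tile n} {φ : Tile n → Tile n} (f₁ : Fits v t₁ o α i β j) (f₂ : Fits v t₂ o α i γ k)
    (f₁' : Fits v (φ t₁) (o + γ • v k) α i β j) (f₂' : Fits v (φ t₂) (o + β • v j) α i γ k)
    (h₁ : t₁ ∈ T.tiles) (h₂ : t₂ ∈ T.tiles) (h₁' : φ t₁ ∈ T'.tiles) (h₂' : φ t₂ ∈ T'.tiles)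
    (hfix : ∀ s ∈ T.tiles, s.HasDir i → s ≠ t₁ → s ≠ t₂ → φ s = s ∧ s ∈ T'.tiles) :
    DetourOrFix T T' φ i := by
  have key : ∀ {j k : Fin n} {β γ : ℝ} {t₁ t₂ : Tile n}, (β = 1 ∨ β = -1) → (γ = 1 ∨ γ = -1) →
      0 < cross (v i) (β • v j) → cross (v i) (γ • v k) < 0 →
      Fits v t₁ o α i β j → Fits v t₂ o α i γ k →
      Fits v (φ t₁) (o + γ • v k) α i β j → Fits v (φ t₂) (o + β • v j) α i γ k →
      t₁ ∈ T.tiles → t₂ ∈ T.tiles → φ t₁ ∈ T'.tiles → φ t₂ ∈ T'.tiles →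
      (∀ s ∈ T.tiles, s.HasDir i → s ≠ t₁ → s ≠ t₂ → φ s = s ∧ s ∈ T'.tiles) →
      Detour T T' φ i t₂ t₁ := by
    intro j k β γ t₁ t₂ sβ sγ pβ pγ f₁ f₂ f₁' f₂' h₁ h₂ h₁' h₂' hfix
    obtain ⟨a1, a2⟩ := f₁.lft sβ pβ
    obtain ⟨b1, b2⟩ := f₂.rgt sγ pγ
    obtain ⟨a1', a2'⟩ := f₁'.lft sβ pβ
    obtain ⟨b1', b2'⟩ := f₂'.rgt sγ pγ
    refine ⟨fun s hs hsi => ?_, ⟨h₂, f₂.dir⟩, ⟨h₁, f₁.dir⟩, by rw [a1, b2], ?_, ?_, ?_,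
      fun s hs hsi n1 n2 => (hfix s hs hsi n2 n1).1⟩
    · by_cases e1 : s = t₁
      · rw [e1]
        exact ⟨h₁', f₁'.dir⟩
      by_cases e2 : s = t₂
      · rw [e2]
        exact ⟨h₂', f₂'.dir⟩
      obtain ⟨c1, c2⟩ := hfix s hs hsi e1 e2
      rw [c1]
      exact ⟨c2, hsi⟩
    · rw [a1', b1]; abel
    · rw [a2', b1']; abel
    · rw [b2', a2]; abel
  right
  rcases mul_neg_iff.1 hH.opp₁ with ⟨p1, p2⟩ | ⟨p1, p2⟩
  · exact ⟨_, _, key hH.sβ hH.sγ p1 p2 f₁ f₂ f₁' f₂' h₁ h₂ h₁' h₂' hfix⟩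
  · exact ⟨_, _, key hH.sγ hH.sβ p2 p1 f₂ f₁ f₂' f₁' h₂ h₁ h₂' h₁'
      fun s hs hsi n1 n2 => hfix s hs hsi n2 n1⟩

/-- If `T'` arises from `T` by rotating a hexagon, then at most one triangle is inverted, the one
formed by the lines through the hexagon. -/
theorem on_of_inv_of_hex (hc : General v) {i j k : Fin n} (hij : i < j) (hjk : j < k) {α β γ : ℝ}
    (hH : IsHex v i j k α β γ) {o : Plane} {t₁ t₂ t₃ t₁' t₂' t₃' : Tile n}
    (f₁ : Fits v t₁ o α i β j) (f₂ : Fits v t₂ o α i γ k) (f₃ : Fits v t₃ o β j γ k)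
    (f₁' : Fits v t₁' (o + γ • v k) α i β j) (f₂' : Fits v t₂' (o + β • v j) α i γ k)
    (f₃' : Fits v t₃' (o + α • v i) β j γ k)
    (h₁ : t₁ ∈ T.tiles) (h₂ : t₂ ∈ T.tiles) (h₃ : t₃ ∈ T.tiles)
    (hT' : T'.tiles = (T.tiles \ {t₁, t₂, t₃}) ∪ {t₁', t₂', t₃'}) {s : Triple a}
    (hs : IsInverted T T' s) : T.On s.l₁ t₁ ∧ T.On s.l₂ t₁ ∧ T.On s.l₃ t₂ := by
  classical
  have hik := hij.trans hjk
  have n12 : t₁ ≠ t₂ := by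
    rintro rfl
    have := f₁.hasDir_iff.1 (f₂.hasDir_iff.2 (Or.inr rfl))
    rcases this with h | h
    · exact hik.ne' h
    · exact hjk.ne' h
  have n13 : t₁ ≠ t₃ := by
    rintro rfl
    have := f₁.hasDir_iff.1 (f₃.hasDir_iff.2 (Or.inr rfl))
    rcases this with h | h
    · exact hik.ne' h
    · exact hjk.ne' h
  have n23 : t₂ ≠ t₃ := by
    rintro rfl
    have := f₂.hasDir_iff.1 (f₃.hasDir_iff.2 (Or.inl rfl))
    rcases this with h | h
    · exact hij.ne' h
    · exact hjk.ne h
  set φ : Tile n → Tile n := fun s => if s = t₁ then t₁' else if s = t₂ then t₂' else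
    if s = t₃ then t₃' else s with hφ
  have φ1 : φ t₁ = t₁' := by simp [hφ]
  have φ2 : φ t₂ = t₂' := by simp [hφ, n12.symm]
  have φ3 : φ t₃ = t₃' := by simp [hφ, n13.symm, n23.symm]
  have m1 : t₁' ∈ T'.tiles := by rw [hT']; simp
  have m2 : t₂' ∈ T'.tiles := by rw [hT']; simp
  have m3 : t₃' ∈ T'.tiles := by rw [hT']; simp
  have hfix : ∀ s ∈ T.tiles, s ≠ t₁ → s ≠ t₂ → s ≠ t₃ → φ s = s ∧ s ∈ T'.tiles := by
    intro s hs e1 e2 e3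
    refine ⟨by simp [hφ, e1, e2, e3], ?_⟩
    rw [hT']
    exact Or.inl ⟨hs, by simp [e1, e2, e3]⟩
  have D : ∀ d, DetourOrFix T T' φ d := by
    intro d
    rw [← φ1] at f₁' m1
    rw [← φ2] at f₂' m2
    rw [← φ3] at f₃' m3
    by_cases di : d = i
    · subst di
      refine detour_of_hex hH f₁ f₂ f₁' f₂' h₁ h₂ m1 m2 fun s hs hd e1 e2 => hfix s hs e1 e2 ?_
      rintro rfl
      rcases f₃.hasDir_iff.1 hd with h | h
      · exact hij.ne h
      · exact hik.ne h
    by_cases dj : d = j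
    · subst dj
      refine detour_of_hex hH.swap₁ f₁.symm f₃ f₁'.symm f₃' h₁ h₃ m1 m3
        fun s hs hd e1 e2 => hfix s hs e1 ?_ e2
      rintro rfl
      rcases f₂.hasDir_iff.1 hd with h | h
      · exact hij.ne' h
      · exact hjk.ne h
    by_cases dk : d = k
    · subst dk
      refine detour_of_hex hH.swap₂.swap₁ f₂.symm f₃.symm f₂'.symm f₃'.symm h₂ h₃ m2 m3
        fun s hs hd e1 e2 => hfix s hs ?_ e1 e2
      rintro rfl
      rcases f₁.hasDir_iff.1 hd with h | h
      · exact hik.ne' h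
      · exact hjk.ne' h
    refine Or.inl fun s hs hd => hfix s hs ?_ ?_ ?_
    · rintro rfl
      exact (f₁.hasDir_iff.1 hd).elim di dj
    · rintro rfl
      exact (f₂.hasDir_iff.1 hd).elim di dk
    · rintro rfl
      exact (f₃.hasDir_iff.1 hd).elim dj dk
  have hI := (isInverted_iff hc).1 hs
  have moved : ∀ {l r : Line a} {t : Tile n}, φ t ≠ t → T.On l t → T.On r t → l.1 < r.1 →
      (t = t₁ ∧ l.1 = i ∧ r.1 = j) ∨ (t = t₂ ∧ l.1 = i ∧ r.1 = k) ∨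
        (t = t₃ ∧ l.1 = j ∧ r.1 = k) := by
    intro l r t ht hl hr hlt
    by_cases e1 : t = t₁
    · subst e1
      refine Or.inl ⟨rfl, ?_⟩
      rcases f₁.hasDir_iff.1 hl.2.1 with h | h <;> rcases f₁.hasDir_iff.1 hr.2.1 with h' | h' <;>
        rw [h, h'] at hlt
      · exact absurd hlt (lt_irrefl _)
      · exact ⟨h, h'⟩
      · exact absurd hlt hij.asymm
      · exact absurd hlt (lt_irrefl _)
    by_cases e2 : t = t₂
    · subst e2
      refine Or.inr (Or.inl ⟨rfl, ?_⟩)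
      rcases f₂.hasDir_iff.1 hl.2.1 with h | h <;> rcases f₂.hasDir_iff.1 hr.2.1 with h' | h' <;>
        rw [h, h'] at hlt
      · exact absurd hlt (lt_irrefl _)
      · exact ⟨h, h'⟩
      · exact absurd hlt hik.asymm
      · exact absurd hlt (lt_irrefl _)
    by_cases e3 : t = t₃
    · subst e3
      refine Or.inr (Or.inr ⟨rfl, ?_⟩)
      rcases f₃.hasDir_iff.1 hl.2.1 with h | h <;> rcases f₃.hasDir_iff.1 hr.2.1 with h' | h' <;>
        rw [h, h'] at hlt
      · exact absurd hlt (lt_irrefl _)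
      · exact ⟨h, h'⟩
      · exact absurd hlt hjk.asymm
      · exact absurd hlt (lt_irrefl _)
    exact absurd (hfix t hl.1 e1 e2 e3).1 ht
  obtain ⟨x, x1, x2⟩ := T.exists_cross hc s.lt₁₂.ne
  obtain ⟨y, y1, y3⟩ := T.exists_cross hc (s.lt₁₂.trans s.lt₂₃).ne
  obtain ⟨z, z2, z3⟩ := T.exists_cross hc s.lt₂₃.ne
  -- All three crossings of an inverted triangle lie in moved tiles. The order of the bundles
  -- decides which crossing lies in which tile.
  have ax := moved (ne_of_inv hc D hI x1 x2) x1 x2 s.lt₁₂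
  have ay := moved (ne_of_inv hc D (hI.swap₂ hc) y1 y3) y1 y3 (s.lt₁₂.trans s.lt₂₃)
  have az := moved (ne_of_inv hc D (((hI.swap₂ hc).swap₁ hc)) z2 z3) z2 z3 s.lt₂₃
  have hx : x = t₁ := by
    rcases ax with h | h | h
    · exact h.1
    · have := s.lt₂₃
      rcases az with g | g | g <;> omega
    · have := s.lt₂₃
      rcases az with g | g | g <;> omega
  have hy : y = t₂ := by
    have := s.lt₁₂
    rcases ay with h | h | h
    · have := s.lt₂₃
      rcases ax with g | g | g <;> rcases az with g' | g' | g' <;> omega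
    · exact h.1
    · rcases ax with g | g | g <;> omega
  rw [hx] at x1 x2
  rw [hy] at y3
  exact ⟨x1, x2, y3⟩

end Tiling
end RhombusTiling

end

noncomputable section

namespace RhombusTiling
variable {n : ℕ} {v : Fin n → Plane} {a : Fin n → ℕ}

/-! ### Tilings of a hexagon by three parallelograms -/

theorem exists_height {u₁ u₂ u₃ : Plane} {c₁ c₂ c₃ : ℝ} (h₁ : 0 < c₁) (h₃ : 0 < c₃)
    (h : c₁ • u₁ + c₂ • u₂ + c₃ • u₃ = 0) (hu : cross u₁ u₂ ≠ 0) (o : Plane) :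
    ∃ (ψ : Plane → ℝ) (κ : ℝ), 0 < κ ∧ ψ o = 0 ∧
      ∀ (x : Plane) (r s t : ℝ), ψ (x + r • u₁ + s • u₂ + t • u₃) = ψ x + r - κ * t := by
  refine ⟨fun x => cross (x - o) u₂ / cross u₁ u₂, c₁ / c₃, by positivity,
    by simp [cross], fun x r s t => ?_⟩
  have e := congrArg (fun x => cross x u₂) h
  simp only [add_cross, smul_cross, cross_self] at e
  have e0 : cross 0 u₂ = 0 := by simp [cross]
  rw [e0] at e
  have e3 : cross u₃ u₂ = -(c₁ / c₃) * cross u₁ u₂ := by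
    field_simp
    linarith
  simp only [sub_cross, add_cross, smul_cross, cross_self, e3]
  field_simp
  ring

/-- The height `ψ` is maximal exactly on the edge of the hexagon from `o + u₁` to `o + u₁ + u₂`. A
parallelogram with sides parallel to `u₂` that touches this edge contains all of it; the third
parallelogram touches it in at most one point and cannot cover both of its ends. -/
theorem hexSet_edge {u₁ u₂ u₃ : Plane} {c₁ c₂ c₃ : ℝ} (h₁ : 0 < c₁) (h₃ : 0 < c₃)
    (h : c₁ • u₁ + c₂ • u₂ + c₃ • u₃ = 0) (hu : cross u₁ u₂ ≠ 0) {o b₁ b₂ b₃ : Plane}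
    (hU : para b₃ u₁ u₂ ∪ para b₂ u₁ u₃ ∪ para b₁ u₂ u₃ = hexSet o u₁ u₂ u₃) :
    b₃ = o ∨ b₁ = o + u₁ := by
  obtain ⟨ψ, κ, hκ, hψo, hψ⟩ := exists_height h₁ h₃ h hu o
  have hu2 : u₂ ≠ 0 := by
    rintro rfl
    exact hu (cross_zero _)
  have hle : ∀ x ∈ hexSet o u₁ u₂ u₃, ψ x ≤ 1 ∧
      (ψ x = 1 → ∃ s : ℝ, 0 ≤ s ∧ s ≤ 1 ∧ x = o + u₁ + s • u₂) := by
    rintro x ⟨r, s, t, r0, r1, s0, s1, t0, t1, rfl⟩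
    have hp := mul_nonneg hκ.le t0
    rw [hψ, hψo]
    refine ⟨by linarith, fun e => ⟨s, s0, s1, ?_⟩⟩
    have hr : r = 1 := by linarith
    have ht : t = 0 := (mul_eq_zero.1 (by linarith : κ * t = 0)).resolve_left hκ.ne'
    rw [hr, ht]
    module
  have hfix : ∀ x, x ∈ hexSet o u₁ u₂ u₃ → x + u₂ ∈ hexSet o u₁ u₂ u₃ → ψ x = 1 → x = o + u₁ := by
    intro x hx hx' e
    obtain ⟨s, s0, s1, es⟩ := (hle x hx).2 e
    have e' : ψ (x + u₂) = 1 := by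
      have := hψ x 0 1 0
      simpa [e] using this
    obtain ⟨s', s0', s1', es'⟩ := (hle _ hx').2 e'
    rw [es] at es'
    have : (s + 1) • u₂ = s' • u₂ := by
      rw [add_smul, one_smul]
      rw [add_assoc] at es'
      exact add_left_cancel es'
    have := smul_left_injective ℝ hu2 this
    have hs : s = 0 := by linarith
    rw [es, hs, zero_smul, add_zero]
  have m₃ : ∀ {r s : ℝ}, 0 ≤ r → r ≤ 1 → 0 ≤ s → s ≤ 1 →
      b₃ + r • u₁ + s • u₂ ∈ hexSet o u₁ u₂ u₃ := fun r0 r1 s0 s1 => by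
    rw [← hU]; exact Or.inl (Or.inl ⟨_, _, r0, r1, s0, s1, rfl⟩)
  have m₂ : ∀ {r s : ℝ}, 0 ≤ r → r ≤ 1 → 0 ≤ s → s ≤ 1 →
      b₂ + r • u₁ + s • u₃ ∈ hexSet o u₁ u₂ u₃ := fun r0 r1 s0 s1 => by
    rw [← hU]; exact Or.inl (Or.inr ⟨_, _, r0, r1, s0, s1, rfl⟩)
  have m₁ : ∀ {r s : ℝ}, 0 ≤ r → r ≤ 1 → 0 ≤ s → s ≤ 1 →
      b₁ + r • u₂ + s • u₃ ∈ hexSet o u₁ u₂ u₃ := fun r0 r1 s0 s1 => by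
    rw [← hU]; exact Or.inr ⟨_, _, r0, r1, s0, s1, rfl⟩
  have key : ∀ y : ℝ, 0 ≤ y → y ≤ 1 → b₃ = o ∨ b₁ = o + u₁ ∨ o + u₁ + y • u₂ = b₂ + u₁ := by
    intro y y0 y1
    have hy : o + u₁ + y • u₂ ∈ hexSet o u₁ u₂ u₃ :=
      ⟨1, y, 0, zero_le_one, le_rfl, y0, y1, le_rfl, zero_le_one, by module⟩
    have hψy : ψ (o + u₁ + y • u₂) = 1 := by
      have := hψ o 1 y 0
      simpa [hψo] using this
    rw [← hU] at hy
    rcases hy with (⟨r, s, r0, r1, s0, s1, e⟩ | ⟨r, s, r0, r1, s0, s1, e⟩) |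
      ⟨r, s, r0, r1, s0, s1, e⟩
    · left
      have a1 := m₃ zero_le_one le_rfl le_rfl zero_le_one
      have a2 := m₃ zero_le_one le_rfl zero_le_one le_rfl
      simp only [one_smul, zero_smul, add_zero] at a1 a2
      have b1 := hψ b₃ r s 0
      have b2 := hψ b₃ 1 0 0
      simp only [one_smul, zero_smul, add_zero] at b1 b2
      rw [← e, hψy] at b1
      have := (hle _ a1).1
      exact add_right_cancel (hfix _ a1 a2 (by linarith))
    · right; right
      have a1 := m₂ zero_le_one le_rfl le_rfl zero_le_one
      simp only [one_smul, zero_smul, add_zero] at a1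
      have b1 := hψ b₂ r 0 s
      have b2 := hψ b₂ 1 0 0
      simp only [one_smul, zero_smul, add_zero] at b1 b2
      rw [← e, hψy] at b1
      have := (hle _ a1).1
      have hp := mul_nonneg hκ.le s0
      have hr : r = 1 := by linarith
      have hs : s = 0 := (mul_eq_zero.1 (by linarith : κ * s = 0)).resolve_left hκ.ne'
      rw [e, hr, hs]
      module
    · right; left
      have a1 := m₁ le_rfl zero_le_one le_rfl zero_le_one
      have a2 := m₁ zero_le_one le_rfl le_rfl zero_le_one
      simp only [one_smul, zero_smul, add_zero] at a1 a2
      have b1 := hψ b₁ 0 r s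
      simp only [zero_smul, add_zero] at b1
      rw [← e, hψy] at b1
      have := (hle _ a1).1
      have hp := mul_nonneg hκ.le s0
      exact hfix _ a1 a2 (by linarith)
  rcases key 0 le_rfl zero_le_one with h0 | h0 | h0
  · exact Or.inl h0
  · exact Or.inr h0
  rcases key 1 zero_le_one le_rfl with h1 | h1 | h1
  · exact Or.inl h1
  · exact Or.inr h1
  rw [← h0, zero_smul, one_smul, add_zero] at h1
  exact absurd (add_eq_left.1 h1) hu2

/-- `hexSet_edge` gives one alternative for each of the six edges. Whether `b₁ = o` then decides all
of them. -/
theorem hexSet_cases {u₁ u₂ u₃ : Plane} {c₁ c₂ c₃ : ℝ} (h₁ : 0 < c₁) (h₂ : 0 < c₂) (h₃ : 0 < c₃)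
    (h : c₁ • u₁ + c₂ • u₂ + c₃ • u₃ = 0) (hu : cross u₁ u₂ ≠ 0) (hu' : cross u₁ u₃ ≠ 0)
    (hu'' : cross u₂ u₃ ≠ 0) {o b₁ b₂ b₃ : Plane}
    (hU : para b₃ u₁ u₂ ∪ para b₂ u₁ u₃ ∪ para b₁ u₂ u₃ = hexSet o u₁ u₂ u₃) :
    (b₁ = o ∧ b₂ = o ∧ b₃ = o) ∨ (b₁ = o + u₁ ∧ b₂ = o + u₂ ∧ b₃ = o + u₃) := by
  have e12 : c₂ • u₂ + c₁ • u₁ + c₃ • u₃ = 0 := by rw [← h]; abel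
  have e23 : c₁ • u₁ + c₃ • u₃ + c₂ • u₂ = 0 := by rw [← h]; abel
  have e13 : c₃ • u₃ + c₂ • u₂ + c₁ • u₁ = 0 := by rw [← h]; abel
  have e123 : c₂ • u₂ + c₃ • u₃ + c₁ • u₁ = 0 := by rw [← h]; abel
  have e321 : c₃ • u₃ + c₁ • u₁ + c₂ • u₂ = 0 := by rw [← h]; abel
  have n : ∀ {x y : Plane}, cross x y ≠ 0 → cross y x ≠ 0 := fun hxy => by
    rw [cross_comm]; exact neg_ne_zero.2 hxy
  have k1 := hexSet_edge h₁ h₃ h hu hU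
  have k2 := hexSet_edge (o := o) (b₁ := b₂) (b₂ := b₁) (b₃ := b₃) h₂ h₃ e12 (n hu) (by
    rw [para_swap b₃, hexSet_swap₁, ← hU]; ac_rfl)
  have k3 := hexSet_edge (o := o) (b₁ := b₁) (b₂ := b₃) (b₃ := b₂) h₁ h₂ e23 hu' (by
    rw [para_swap b₁, hexSet_swap₂, ← hU]; ac_rfl)
  have k4 := hexSet_edge (o := o) (b₁ := b₃) (b₂ := b₂) (b₃ := b₁) h₃ h₁ e13 (n hu'') (by
    rw [para_swap b₁, para_swap b₂, para_swap b₃, hexSet_swap₁, hexSet_swap₂, hexSet_swap₁, ← hU]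
    ac_rfl)
  have k5 := hexSet_edge (o := o) (b₁ := b₂) (b₂ := b₃) (b₃ := b₁) h₂ h₁ e123 hu'' (by
    rw [para_swap b₂, para_swap b₃, hexSet_swap₂, hexSet_swap₁, ← hU]; ac_rfl)
  have k6 := hexSet_edge (o := o) (b₁ := b₃) (b₂ := b₁) (b₃ := b₂) h₃ h₂ e321 (n hu') (by
    rw [para_swap b₁, para_swap b₂, hexSet_swap₁, hexSet_swap₂, ← hU]; ac_rfl)
  have z : ∀ {x y : Plane}, cross x y ≠ 0 → o + x ≠ o := fun hxy e => by
    rw [add_eq_left.1 e] at hxy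
    simp [cross] at hxy
  have z1 := z hu
  have z2 := z hu''
  have z3 := z (n hu')
  by_cases b1 : b₁ = o
  · rw [b1] at k1 k3
    have b3 := k1.resolve_right z1.symm
    have b2 := k3.resolve_right z1.symm
    exact Or.inl ⟨b1, b2, b3⟩
  · have b3 := k4.resolve_left b1
    have b2 := k5.resolve_left b1
    rw [b3] at k1
    exact Or.inr ⟨k1.resolve_left z3, b2, b3⟩

theorem exists_isHex (hc : General v) {i j k : Fin n} (hij : i ≠ j) (hik : i ≠ k) (hjk : j ≠ k) :
    ∃ α β γ : ℝ, IsHex v i j k α β γ := by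
  have sg : ∀ x : ℝ, x ≠ 0 → ∃ s : ℝ, (s = 1 ∨ s = -1) ∧ 0 < s * x := by
    intro x hx
    rcases lt_or_gt_of_ne hx with h | h
    · exact ⟨-1, Or.inr rfl, by linarith⟩
    · exact ⟨1, Or.inl rfl, by linarith⟩
  obtain ⟨α, sα, hα⟩ := sg _ (hc j k hjk)
  obtain ⟨β, sβ, hβ⟩ := sg _ (hc k i hik.symm)
  obtain ⟨γ, sγ, hγ⟩ := sg _ (hc i j hij)
  refine ⟨α, β, γ, sα, sβ, sγ, ?_, ?_, ?_⟩ <;> simp only [cross_smul]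
  · rw [cross_comm (v i) (v k)]
    nlinarith [mul_pos hβ hγ]
  · rw [cross_comm (v j) (v i)]
    nlinarith [mul_pos hα hγ]
  · rw [cross_comm (v k) (v j)]
    nlinarith [mul_pos hα hβ]

theorem Fits.of_dir {i j : Fin n} {t : Tile n} (hi : t.HasDir i) (hj : t.HasDir j) (hij : i ≠ j)
    (α β : ℝ) : Fits v t (t.base - ((α - 1) / 2) • v i - ((β - 1) / 2) • v j) α i β j where
  dir := hi
  other := (((Tile.hasDir_iff hi).1 hj).resolve_left hij.symm).symm
  base := by abel

theorem exists_hex_of_union (hc : General v) {i j k : Fin n} (hij : i ≠ j) (hik : i ≠ k)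
    (hjk : j ≠ k) {t₁ t₂ t₃ : Tile n} (d₁ : t₁.HasDir i ∧ t₁.HasDir j)
    (d₂ : t₂.HasDir i ∧ t₂.HasDir k) (d₃ : t₃.HasDir j ∧ t₃.HasDir k) {q : Plane}
    (hU : t₁.carrier v ∪ t₂.carrier v ∪ t₃.carrier v = hexagon v q i j k) :
    ∃ (o : Plane) (α β γ : ℝ), IsHex v i j k α β γ ∧
      q = o + ((α - 1) / 2) • v i + ((β - 1) / 2) • v j + ((γ - 1) / 2) • v k ∧
      Fits v t₁ o α i β j ∧ Fits v t₂ o α i γ k ∧ Fits v t₃ o β j γ k := by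
  obtain ⟨α, β, γ, hH⟩ := exists_isHex hc hij hik hjk
  obtain ⟨c₁, c₂, c₃, h₁, h₂, h₃, hrel⟩ := hH.relation
  have f₁ := Fits.of_dir (v := v) d₁.1 d₁.2 hij α β
  have f₂ := Fits.of_dir (v := v) d₂.1 d₂.2 hik α γ
  have f₃ := Fits.of_dir (v := v) d₃.1 d₃.2 hjk β γ
  set o := q - ((α - 1) / 2) • v i - ((β - 1) / 2) • v j - ((γ - 1) / 2) • v k with ho
  have hq : q = o + ((α - 1) / 2) • v i + ((β - 1) / 2) • v j + ((γ - 1) / 2) • v k := by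
    rw [ho]; abel
  rw [hq, hexagon_eq_hexSet hH.sα hH.sβ hH.sγ, f₁.carrier hH.sα hH.sβ, f₂.carrier hH.sα hH.sγ,
    f₃.carrier hH.sβ hH.sγ] at hU
  have n0 : ∀ {α : ℝ}, α = 1 ∨ α = -1 → α ≠ 0 := by rintro α (rfl | rfl) <;> norm_num
  have nz : ∀ {α β : ℝ} {i j : Fin n}, i ≠ j → α = 1 ∨ α = -1 → β = 1 ∨ β = -1 →
      cross (α • v i) (β • v j) ≠ 0 := fun hij hα hβ => by
    rw [smul_cross, cross_smul]
    exact mul_ne_zero (n0 hα) (mul_ne_zero (n0 hβ) (hc _ _ hij))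
  rcases hexSet_cases h₁ h₂ h₃ hrel (nz hij hH.sα hH.sβ) (nz hik hH.sα hH.sγ)
    (nz hjk hH.sβ hH.sγ) hU with ⟨e1, e2, e3⟩ | ⟨e1, e2, e3⟩
  · rw [e3] at f₁
    rw [e2] at f₂
    rw [e1] at f₃
    exact ⟨o, α, β, γ, hH, hq, f₁, f₂, f₃⟩
  -- In the second tiling the three tiles meet at the other inner vertex, from which all signs
  -- appear reversed.
  · refine ⟨o + α • v i + β • v j + γ • v k, -α, -β, -γ, hH.neg, ?_, ?_, ?_, ?_⟩
    · rw [hq]; module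
    · refine ⟨f₁.dir, f₁.other, ?_⟩
      rw [f₁.base, e3]; module
    · refine ⟨f₂.dir, f₂.other, ?_⟩
      rw [f₂.base, e2]; module
    · refine ⟨f₃.dir, f₃.other, ?_⟩
      rw [f₃.base, e1]; module

theorem Fits.rotate {i j k : Fin n} {t : Tile n} {o : Plane} {α β : ℝ} (h : Fits v t o α i β j)
    (γ : ℝ) : Fits v (t.rotate v (o + ((α - 1) / 2) • v i + ((β - 1) / 2) • v j +
      ((γ - 1) / 2) • v k + (1 / 2 : ℝ) • (v i + v j + v k))) (o + γ • v k) α i β j where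
  dir := h.dir
  other := h.other
  base := by
    have e : v t.i + v t.j = v i + v j := by
      have := h.dir
      have ho := h.other
      unfold Tile.other at ho
      split_ifs at ho with h1
      · rw [h1, ho]
      · rw [this.resolve_left h1, ho, add_comm]
    change (2 : ℝ) • _ - (t.base + v t.i + v t.j) = _
    rw [add_assoc t.base, e, h.base]
    module

end RhombusTiling

end

noncomputable section

namespace RhombusTiling
variable {n : ℕ} {v : Fin n → Plane} {a : Fin n → ℕ}

/-! ### Tiles that meet properly -/

/-- Two tiles meet in nothing, in a common vertex or in a common edge. -/
def Meet (v : Fin n → Plane) (s t : Tile n) : Prop :=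
  s.carrier v ∩ t.carrier v = ∅ ∨
    (∃ x ∈ s.vertices v ∩ t.vertices v, s.carrier v ∩ t.carrier v = {x}) ∨
    (∃ e ∈ s.edges v ∩ t.edges v, s.carrier v ∩ t.carrier v = edgeCarrier v e)

theorem Meet.symm {s t : Tile n} (h : Meet v s t) : Meet v t s := by
  unfold Meet at *
  rwa [Set.inter_comm (t.carrier v), Set.inter_comm (t.vertices v), Set.inter_comm (t.edges v)]

theorem Tile.mem_edges_iff {t : Tile n} {e : Plane × Fin n} : e ∈ t.edges v ↔
    ∃ c : ℝ, (c = 0 ∨ c = 1) ∧ (e = (t.base + c • v t.j, t.i) ∨ e = (t.base + c • v t.i, t.j)) := by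
  simp only [Tile.edges, Set.mem_insert_iff, Set.mem_singleton_iff]
  constructor
  · rintro (h | h | h | h)
    · exact ⟨0, Or.inl rfl, Or.inl (by simpa using h)⟩
    · exact ⟨1, Or.inr rfl, Or.inl (by simpa using h)⟩
    · exact ⟨0, Or.inl rfl, Or.inr (by simpa using h)⟩
    · exact ⟨1, Or.inr rfl, Or.inr (by simpa using h)⟩
  · rintro ⟨c, rfl | rfl, rfl | rfl⟩ <;> simp

theorem Tile.mem_vertices_iff {t : Tile n} {x : Plane} : x ∈ t.vertices v ↔
    ∃ c d : ℝ, (c = 0 ∨ c = 1) ∧ (d = 0 ∨ d = 1) ∧ x = t.base + c • v t.i + d • v t.j := by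
  simp only [Tile.vertices, Set.mem_insert_iff, Set.mem_singleton_iff]
  constructor
  · rintro (h | h | h | h)
    · exact ⟨0, 0, by simp, by simp, by simpa using h⟩
    · exact ⟨1, 0, by simp, by simp, by simpa using h⟩
    · exact ⟨0, 1, by simp, by simp, by simpa using h⟩
    · exact ⟨1, 1, by simp, by simp, by simpa using h⟩
  · rintro ⟨c, d, rfl | rfl, rfl | rfl, rfl⟩ <;> simp

theorem Tile.edge_subset {t : Tile n} {e : Plane × Fin n} (h : e ∈ t.edges v) :
    edgeCarrier v e ⊆ t.carrier v := by
  intro x hx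
  rw [mem_edgeCarrier] at hx
  obtain ⟨r, r0, r1, rfl⟩ := hx
  obtain ⟨c, hc, rfl | rfl⟩ := Tile.mem_edges_iff.1 h
  · exact ⟨r, c, r0, r1, by rcases hc with rfl | rfl <;> norm_num,
      by rcases hc with rfl | rfl <;> norm_num, by simp only; abel⟩
  · exact ⟨c, r, by rcases hc with rfl | rfl <;> norm_num,
      by rcases hc with rfl | rfl <;> norm_num, r0, r1, by simp only⟩

/-- The end points of an edge. -/
def ends (v : Fin n → Plane) (e : Plane × Fin n) : Set Plane :=
  {x | ∃ c : ℝ, (c = 0 ∨ c = 1) ∧ x = e.1 + c • v e.2}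

theorem Tile.ends_subset {t : Tile n} {e : Plane × Fin n} (h : e ∈ t.edges v) :
    ends v e ⊆ t.vertices v := by
  rintro x ⟨d, hd, rfl⟩
  rw [Tile.mem_vertices_iff]
  obtain ⟨c, hc, rfl | rfl⟩ := Tile.mem_edges_iff.1 h
  · exact ⟨d, c, hd, hc, by simp only; abel⟩
  · exact ⟨c, d, hc, hd, by simp only⟩

theorem Tile.vertex_mem_ends (hc : General v) {t : Tile n} {e : Plane × Fin n} (he : e ∈ t.edges v)
    {x : Plane} (hx : x ∈ t.vertices v) (hxe : x ∈ edgeCarrier v e) : x ∈ ends v e := by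
  have h0 := hc _ _ t.lt.ne
  obtain ⟨p, q, hp, hq, rfl⟩ := Tile.mem_vertices_iff.1 hx
  obtain ⟨r, -, -, hr⟩ := mem_edgeCarrier.1 hxe
  obtain ⟨c, -, rfl | rfl⟩ := Tile.mem_edges_iff.1 he
  · have hr' : p • v t.i + q • v t.j = r • v t.i + c • v t.j := by
      rw [← add_right_inj t.base]; simpa only [add_assoc, add_comm, add_left_comm] using hr
    have := (coords_unique h0 hr').1
    exact ⟨r, this ▸ hp, hr⟩
  · have hr' : p • v t.i + q • v t.j = c • v t.i + r • v t.j := by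
      rw [← add_right_inj t.base]; simpa only [add_assoc, add_comm, add_left_comm] using hr
    have := (coords_unique h0 hr').2
    exact ⟨r, this ▸ hq, hr⟩

theorem Tile.edge_inter_edge (hc : General v) {t : Tile n} {e f : Plane × Fin n}
    (he : e ∈ t.edges v) (hf : f ∈ t.edges v) : f = e ∨ edgeCarrier v f ∩ edgeCarrier v e = ∅ ∨
      ∃ x ∈ ends v f ∩ ends v e, edgeCarrier v f ∩ edgeCarrier v e = {x} := by
  have h0 := hc _ _ t.lt.ne
  have u01 : ∀ {c : ℝ}, c = 0 ∨ c = 1 → 0 ≤ c ∧ c ≤ 1 := by rintro c (rfl | rfl) <;> norm_num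
  have par : ∀ {c d : ℝ} {b u w : Plane}, cross u w ≠ 0 → c ≠ d → ∀ {r s : ℝ},
      b + c • u + r • w ≠ b + d • u + s • w := by
    intro c d b u w h0 hcd r s e
    exact hcd (coords_unique h0 (by simpa only [add_assoc, add_right_inj] using e)).1
  have tr : ∀ {c d : ℝ} {b : Plane} {i j : Fin n}, cross (v i) (v j) ≠ 0 → (c = 0 ∨ c = 1) →
      (d = 0 ∨ d = 1) →
      b + c • v j + d • v i ∈ ends v (b + c • v j, i) ∩ ends v (b + d • v i, j) ∧
      edgeCarrier v (b + c • v j, i) ∩ edgeCarrier v (b + d • v i, j) =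
        {b + c • v j + d • v i} := by
    intro c d b i j h0 hc' hd
    refine ⟨⟨⟨d, hd, rfl⟩, ⟨c, hc', by simp only; abel⟩⟩, ?_⟩
    ext x
    simp only [Set.mem_inter_iff, mem_edgeCarrier, Set.mem_singleton_iff]
    constructor
    · rintro ⟨⟨r, -, -, rfl⟩, s, -, -, e⟩
      have e' : r • v i + c • v j = d • v i + s • v j := by
        rw [← add_right_inj b]; simpa only [add_assoc, add_comm, add_left_comm] using e
      rw [(coords_unique h0 e').1]
    · rintro rfl
      exact ⟨⟨d, (u01 hd).1, (u01 hd).2, rfl⟩, c, (u01 hc').1, (u01 hc').2, by abel⟩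
  obtain ⟨c, hc', rfl | rfl⟩ := Tile.mem_edges_iff.1 he <;>
  obtain ⟨d, hd, rfl | rfl⟩ := Tile.mem_edges_iff.1 hf
  · by_cases hcd : d = c
    · exact Or.inl (by rw [hcd])
    · refine Or.inr (Or.inl (Set.eq_empty_iff_forall_notMem.2 fun x hx => ?_))
      simp only [Set.mem_inter_iff, mem_edgeCarrier] at hx
      obtain ⟨⟨r, -, -, rfl⟩, s, -, -, e⟩ := hx
      exact par (hc _ _ t.lt.ne') hcd e
  · obtain ⟨⟨h1, h2⟩, h3⟩ := tr (b := t.base) (hc _ _ t.lt.ne) hc' hd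
    exact Or.inr (Or.inr ⟨_, ⟨h2, h1⟩, by rw [Set.inter_comm]; exact h3⟩)
  · obtain ⟨h1, h3⟩ := tr (b := t.base) (hc _ _ t.lt.ne) hd hc'
    exact Or.inr (Or.inr ⟨_, h1, h3⟩)
  · by_cases hcd : d = c
    · exact Or.inl (by rw [hcd])
    · refine Or.inr (Or.inl (Set.eq_empty_iff_forall_notMem.2 fun x hx => ?_))
      simp only [Set.mem_inter_iff, mem_edgeCarrier] at hx
      obtain ⟨⟨r, -, -, rfl⟩, s, -, -, e⟩ := hx
      exact par (hc _ _ t.lt.ne) hcd e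

/-- The intersection of `s` with `t'` is the intersection of `s` with `t`, cut down to the common
edge `e`. A vertex or an edge of `t` meets `e` in nothing, in an end of `e`, or in `e` itself. -/
theorem Meet.transfer (hc : General v) {s t t' : Tile n} (h : Meet v s t) {e : Plane × Fin n}
    (he : e ∈ t.edges v) (he' : e ∈ t'.edges v)
    (hsub : s.carrier v ∩ t'.carrier v ⊆ edgeCarrier v e) : Meet v s t' := by
  have heq : s.carrier v ∩ t'.carrier v = (s.carrier v ∩ t.carrier v) ∩ edgeCarrier v e := by
    ext x
    exact ⟨fun hx => ⟨⟨hx.1, Tile.edge_subset he (hsub hx)⟩, hsub hx⟩,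
      fun hx => ⟨hx.1.1, Tile.edge_subset he' hx.2⟩⟩
  unfold Meet
  rw [heq]
  rcases h with h | ⟨x, hx, h⟩ | ⟨f, hf, h⟩
  · left
    rw [h, Set.empty_inter]
  · rw [h]
    by_cases hxe : x ∈ edgeCarrier v e
    · exact Or.inr (Or.inl ⟨x, ⟨hx.1, Tile.ends_subset he' (Tile.vertex_mem_ends hc he hx.2 hxe)⟩,
        Set.inter_eq_left.2 (Set.singleton_subset_iff.2 hxe)⟩)
    · exact Or.inl (Set.singleton_inter_eq_empty.2 hxe)
  · rw [h]
    rcases Tile.edge_inter_edge hc he hf.2 with rfl | h1 | ⟨x, hx, h1⟩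
    · exact Or.inr (Or.inr ⟨f, ⟨hf.1, he'⟩, Set.inter_self _⟩)
    · exact Or.inl h1
    · exact Or.inr (Or.inl ⟨x, ⟨Tile.ends_subset hf.1 hx.1, Tile.ends_subset he' hx.2⟩, h1⟩)

variable {t t' : Tile n} {o : Plane} {i j k : Fin n} {α β γ : ℝ}

theorem Fits.edge (hc : General v) (h : Fits v t o α i β j) (hβ : β = 1 ∨ β = -1) :
    (o + ((α - 1) / 2) • v i, i) ∈ t.edges v ∧
      (o + ((α - 1) / 2) • v i + β • v j, i) ∈ t.edges v := by
  have hn : cross (v i) (β • v j) ≠ 0 := by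
    rw [cross_smul]
    refine mul_ne_zero ?_ (hc _ _ h.ne)
    rcases hβ with rfl | rfl <;> norm_num
  rw [Tile.mem_edges, Tile.mem_edges]
  rcases lt_or_gt_of_ne hn with hp | hp
  · obtain ⟨h1, h2⟩ := h.rgt hβ hp
    exact ⟨⟨h.dir, Or.inr h2.symm⟩, h.dir, Or.inl h1.symm⟩
  · obtain ⟨h1, h2⟩ := h.lft hβ hp
    exact ⟨⟨h.dir, Or.inl h1.symm⟩, h.dir, Or.inr h2.symm⟩

theorem mem_edgeCarrier_sign (hα : α = 1 ∨ α = -1) {x : Plane} :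
    x ∈ edgeCarrier v (o + ((α - 1) / 2) • v i, i) ↔
      ∃ r : ℝ, 0 ≤ r ∧ r ≤ 1 ∧ x = o + r • (α • v i) := by
  rw [mem_edgeCarrier]
  rcases hα with rfl | rfl
  · simp
  · constructor <;> rintro ⟨r, r0, r1, rfl⟩ <;>
      exact ⟨1 - r, by linarith, by linarith, by simp only; module⟩

theorem Fits.meet (hc : General v) (h : Fits v t o α i β j) (h' : Fits v t' o α i γ k)
    (hα : α = 1 ∨ α = -1) (hβ : β = 1 ∨ β = -1) (hγ : γ = 1 ∨ γ = -1)
    (hop : cross (v i) (β • v j) * cross (v i) (γ • v k) < 0) : Meet v t t' := by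
  refine Or.inr (Or.inr ⟨_, ⟨(h.edge hc hβ).1, (h'.edge hc hγ).1⟩, ?_⟩)
  ext x
  rw [mem_edgeCarrier_sign hα, h.carrier hα hβ, h'.carrier hα hγ]
  constructor
  · rintro ⟨⟨r, s, r0, r1, s0, s1, rfl⟩, r', s', r0', r1', s0', s1', e⟩
    have e' := congrArg (cross (v i)) e
    simp only [cross_add, cross_smul, cross_self, mul_zero, add_zero, add_right_inj] at e' hop
    have hs : s = 0 := by
      by_contra hs
      have hs' := lt_of_le_of_ne s0 (Ne.symm hs)
      have h1 : (β * cross (v i) (v j)) * (s * (β * cross (v i) (v j))) =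
          s' * ((β * cross (v i) (v j)) * (γ * cross (v i) (v k))) := by rw [e']; ring
      have h2 : (β * cross (v i) (v j)) ≠ 0 := left_ne_zero_of_mul hop.ne
      have h3 : 0 < s * ((β * cross (v i) (v j)) * (β * cross (v i) (v j))) :=
        mul_pos hs' (mul_self_pos.2 h2)
      nlinarith
    exact ⟨r, r0, r1, by rw [hs]; simp⟩
  · rintro ⟨r, r0, r1, rfl⟩
    exact ⟨⟨r, 0, r0, r1, le_rfl, zero_le_one, by simp⟩, r, 0, r0, r1, le_rfl, zero_le_one, by simp⟩

theorem para_toward_center {b u w x : Plane} (hx : x ∈ para b u w) {l : ℝ} (h0 : 0 < l)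
    (h1 : l ≤ 1) : x + l • (b + (1 / 2 : ℝ) • u + (1 / 2 : ℝ) • w - x) ∈ openPara b u w := by
  obtain ⟨r, s, r0, r1, s0, s1, rfl⟩ := hx
  refine ⟨r + l * (1 / 2 - r), s + l * (1 / 2 - s), ?_, ?_, ?_, ?_, by module⟩ <;> nlinarith

/-- A tile that avoids the interior of a hexagon does not contain points inside of it. -/
theorem boundary_of_hexSet {u₁ u₂ u₃ : Plane} {c₁ c₂ c₃ : ℝ} (h₁ : 0 < c₁) (h₂ : 0 < c₂)
    (h₃ : 0 < c₃) (h : c₁ • u₁ + c₂ • u₂ + c₃ • u₃ = 0) (hu : cross u₁ u₂ ≠ 0)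
    (ht : ∀ x ∈ t.inner v, x ∉ hexSet o u₁ u₂ u₃) {r s : ℝ} (r0 : 0 ≤ r) (r1 : r ≤ 1)
    (s0 : 0 ≤ s) (s1 : s ≤ 1) (hx : o + u₃ + r • u₁ + s • u₂ ∈ t.carrier v) : r = 0 ∨ s = 0 := by
  by_contra hn
  push Not at hn
  have r0' := lt_of_le_of_ne r0 hn.1.symm
  have s0' := lt_of_le_of_ne s0 hn.2.symm
  set x := o + u₃ + r • u₁ + s • u₂ with hxd
  set m := t.base + (1 / 2 : ℝ) • v t.i + (1 / 2 : ℝ) • v t.j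
  obtain ⟨A, B, hAB⟩ : ∃ A B : ℝ, m - x = A • u₁ + B • u₂ := ⟨_, _, eq_coords hu _⟩
  obtain ⟨ε, e0, e1, e2, e3⟩ : ∃ ε : ℝ, 0 < ε ∧ ε * c₁ ≤ r / 2 ∧ ε * c₂ ≤ s / 2 ∧ ε * c₃ ≤ 1 := by
    refine ⟨min (r / 2 / c₁) (min (s / 2 / c₂) (1 / c₃)), by positivity, ?_, ?_, ?_⟩
    · rw [← le_div_iff₀ h₁]; exact min_le_left _ _
    · rw [← le_div_iff₀ h₂]; exact (min_le_right _ _).trans (min_le_left _ _)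
    · rw [← le_div_iff₀ h₃]; exact (min_le_right _ _).trans (min_le_right _ _)
  obtain ⟨l, l0, l1, l2, l3⟩ : ∃ l : ℝ, 0 < l ∧ l ≤ 1 ∧ l * (|A| + 1) ≤ ε * c₁ ∧
      l * (|B| + 1) ≤ ε * c₂ := by
    refine ⟨min 1 (min (ε * c₁ / (|A| + 1)) (ε * c₂ / (|B| + 1))), by positivity, min_le_left _ _,
      ?_, ?_⟩
    · rw [← le_div_iff₀ (by positivity)]; exact (min_le_right _ _).trans (min_le_left _ _)
    · rw [← le_div_iff₀ (by positivity)]; exact (min_le_right _ _).trans (min_le_right _ _)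
  -- A step from `x` to the centre of `t` changes `r` and `s` by at most `ε * c₁` and `ε * c₂`.
  -- Subtracting `ε` times the relation then brings all three coordinates into the unit interval, so
  -- an inner point of `t` lies in the hexagon.
  refine ht _ (para_toward_center hx l0 l1) ?_
  have a1 : |l * A| ≤ ε * c₁ := by
    rw [abs_mul, abs_of_pos l0]; linarith
  have b1 : |l * B| ≤ ε * c₂ := by
    rw [abs_mul, abs_of_pos l0]; linarith
  obtain ⟨a2, a3⟩ := abs_le.1 a1
  obtain ⟨b2, b3⟩ := abs_le.1 b1
  have := mul_pos e0 h₃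
  refine ⟨r + l * A - ε * c₁, s + l * B - ε * c₂, 1 - ε * c₃, by linarith, by linarith,
    by linarith, by linarith, by linarith, by linarith, ?_⟩
  change x + l • (m - x) = _
  rw [hAB, hxd, ← sub_eq_zero, ← smul_zero ε, ← h]
  module

/-- By `boundary_of_hexSet` the tile `s` can touch the rotated tile `t₁` only in its two edges on
the boundary of the hexagon, and by convexity only in one of them. That edge also belongs to `t₂` or
to `t₃`, which `s` meets properly. -/
theorem Fits.meet_outside (hc : General v) (hH : IsHex v i j k α β γ) {t₁ t₂ t₃ s : Tile n}
    (f₁ : Fits v t₁ (o + γ • v k) α i β j) (f₂ : Fits v t₂ o α i γ k) (f₃ : Fits v t₃ o β j γ k)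
    (hs : ∀ x ∈ s.inner v, x ∉ hexSet o (α • v i) (β • v j) (γ • v k)) (h₂ : Meet v s t₂)
    (h₃ : Meet v s t₃) : Meet v s t₁ := by
  obtain ⟨c₁, c₂, c₃, p₁, p₂, p₃, hrel⟩ := hH.relation
  have n0 : ∀ {α : ℝ}, α = 1 ∨ α = -1 → α ≠ 0 := by rintro α (rfl | rfl) <;> norm_num
  have hu : cross (α • v i) (β • v j) ≠ 0 := by
    rw [smul_cross, cross_smul]
    exact mul_ne_zero (n0 hH.sα) (mul_ne_zero (n0 hH.sβ) (hc _ _ f₁.ne))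
  have hb : ∀ {r q : ℝ}, 0 ≤ r → r ≤ 1 → 0 ≤ q → q ≤ 1 →
      o + γ • v k + r • (α • v i) + q • (β • v j) ∈ s.carrier v → r = 0 ∨ q = 0 :=
    fun r0 r1 q0 q1 hx => boundary_of_hexSet p₁ p₂ p₃ hrel hu hs r0 r1 q0 q1 hx
  have hcar := f₁.carrier hH.sα hH.sβ
  by_cases hall : ∀ r q : ℝ, 0 ≤ r → r ≤ 1 → 0 ≤ q → q ≤ 1 →
      o + γ • v k + r • (α • v i) + q • (β • v j) ∈ s.carrier v → q = 0
  · refine h₂.transfer hc (e := (o + γ • v k + ((α - 1) / 2) • v i, i)) ?_ (f₁.edge hc hH.sβ).1 ?_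
    · have := (f₂.edge hc hH.sγ).2
      rwa [add_right_comm] at this
    · rintro x ⟨hx, hx'⟩
      rw [hcar] at hx'
      obtain ⟨r, q, r0, r1, q0, q1, rfl⟩ := hx'
      rw [mem_edgeCarrier_sign hH.sα]
      exact ⟨r, r0, r1, by rw [hall r q r0 r1 q0 q1 hx]; simp⟩
  · push Not at hall
    obtain ⟨r, q, r0, r1, q0, q1, hx, hq⟩ := hall
    have hr := (hb r0 r1 q0 q1 hx).resolve_right hq
    refine h₃.transfer hc (e := (o + γ • v k + ((β - 1) / 2) • v j, j)) ?_
      (f₁.symm.edge hc hH.sα).1 ?_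
    · have := (f₃.edge hc hH.sγ).2
      rwa [add_right_comm] at this
    · rintro x ⟨hx', hx''⟩
      rw [hcar] at hx''
      obtain ⟨r', q', r0', r1', q0', q1', rfl⟩ := hx''
      rw [mem_edgeCarrier_sign hH.sβ]
      suffices r' = 0 by exact ⟨q', q0', q1', by rw [this]; simp⟩
      by_contra hr'
      have hmid := (s.convex_carrier (v := v)) hx hx' (a := 1 / 2) (b := 1 / 2) (by norm_num)
        (by norm_num) (by norm_num)
      have e : (1 / 2 : ℝ) • (o + γ • v k + r • (α • v i) + q • (β • v j)) +
          (1 / 2 : ℝ) • (o + γ • v k + r' • (α • v i) + q' • (β • v j)) =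
          o + γ • v k + ((r + r') / 2) • (α • v i) + ((q + q') / 2) • (β • v j) := by module
      rw [e] at hmid
      have hqp := lt_of_le_of_ne q0 (Ne.symm hq)
      have hrp := lt_of_le_of_ne r0' (Ne.symm hr')
      rcases hb (by linarith) (by linarith) (by linarith) (by linarith) hmid with h | h <;> linarith

end RhombusTiling

end

noncomputable section

namespace RhombusTiling
variable {n : ℕ} {v : Fin n → Plane} {a : Fin n → ℕ}

theorem Fits.eq_mk {t : Tile n} {o : Plane} {i j : Fin n} {α β : ℝ} (h : Fits v t o α i β j)
    (hij : i < j) : t = ⟨t.base, i, j, hij⟩ := by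
  have h1 := h.dir
  have h2 := h.other
  have h3 := t.lt
  unfold Tile.other at h2
  split_ifs at h2 with h4
  · ext1 <;> first | rfl | assumption
  · rw [h1.resolve_left h4, h2] at h3
    exact absurd hij h3.asymm

namespace Tiling
variable {T T' : Tiling v a}

/-! ### The flip of a hexagon is a tiling -/

theorem exists_flipped (hc : General v) (T : Tiling v a) {i j k : Fin n} {α β γ : ℝ}
    (hH : IsHex v i j k α β γ) {o : Plane} {t₁ t₂ t₃ t₁' t₂' t₃' : Tile n}
    (f₁ : Fits v t₁ o α i β j) (f₂ : Fits v t₂ o α i γ k) (f₃ : Fits v t₃ o β j γ k)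
    (f₁' : Fits v t₁' (o + γ • v k) α i β j) (f₂' : Fits v t₂' (o + β • v j) α i γ k)
    (f₃' : Fits v t₃' (o + α • v i) β j γ k)
    (h₁ : t₁ ∈ T.tiles) (h₂ : t₂ ∈ T.tiles) (h₃ : t₃ ∈ T.tiles) :
    ∃ T' : Tiling v a, T'.tiles = (T.tiles \ {t₁, t₂, t₃}) ∪ {t₁', t₂', t₃'} := by
  obtain ⟨c₁, c₂, c₃, p₁, p₂, p₃, hrel⟩ := hH.relation
  have e := hexSet_eq p₁ p₂ p₃ hrel o
  have e' := hexSet_eq' p₁ p₂ p₃ hrel o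
  rw [← f₁.carrier hH.sα hH.sβ, ← f₂.carrier hH.sα hH.sγ, ← f₃.carrier hH.sβ hH.sγ] at e
  rw [← f₁'.carrier hH.sα hH.sβ, ← f₂'.carrier hH.sα hH.sγ, ← f₃'.carrier hH.sβ hH.sγ] at e'
  have hout : ∀ s ∈ T.tiles \ {t₁, t₂, t₃}, ∀ x ∈ s.inner v,
      x ∉ hexSet o (α • v i) (β • v j) (γ • v k) := by
    rintro s ⟨hs, hn⟩ x hx hx'
    simp only [Set.mem_insert_iff, Set.mem_singleton_iff, not_or] at hn
    rw [e] at hx'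
    rcases hx' with (hx' | hx') | hx'
    · exact hn.1 (T.inner_unique hc hs h₁ hx hx')
    · exact hn.2.1 (T.inner_unique hc hs h₂ hx hx')
    · exact hn.2.2 (T.inner_unique hc hs h₃ hx hx')
  have hold : ∀ s ∈ T.tiles \ {t₁, t₂, t₃}, ∀ t ∈ ({t₁', t₂', t₃'} : Set (Tile n)), Meet v s t := by
    rintro s hs t ht
    have hx := hout s hs
    have hn := hs.2
    simp only [Set.mem_insert_iff, Set.mem_singleton_iff, not_or] at hn
    have m₁ : Meet v s t₁ := T.meets s hs.1 t₁ h₁ hn.1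
    have m₂ : Meet v s t₂ := T.meets s hs.1 t₂ h₂ hn.2.1
    have m₃ : Meet v s t₃ := T.meets s hs.1 t₃ h₃ hn.2.2
    rcases ht with rfl | rfl | rfl
    · exact f₁'.meet_outside hc hH f₂ f₃ hx m₂ m₃
    · refine f₂'.meet_outside hc hH.swap₂ f₁ f₃.symm ?_ m₁ m₃
      rwa [hexSet_swap₂]
    · refine f₃'.meet_outside hc hH.swap₁.swap₂ f₁.symm f₂.symm ?_ m₁ m₂
      rwa [hexSet_swap₂, hexSet_swap₁]
  have hN := hH.neg
  -- Seen from the common vertex of the new tiles all signs are reversed, which makes `Fits.meet`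
  -- applicable to each pair.
  have g₁ : Fits v t₁' (o + α • v i + β • v j + γ • v k) (-α) i (-β) j :=
    ⟨f₁'.dir, f₁'.other, by rw [f₁'.base]; module⟩
  have g₂ : Fits v t₂' (o + α • v i + β • v j + γ • v k) (-α) i (-γ) k :=
    ⟨f₂'.dir, f₂'.other, by rw [f₂'.base]; module⟩
  have g₃ : Fits v t₃' (o + α • v i + β • v j + γ • v k) (-β) j (-γ) k :=
    ⟨f₃'.dir, f₃'.other, by rw [f₃'.base]; module⟩
  have n12 : Meet v t₁' t₂' := g₁.meet hc g₂ hN.sα hN.sβ hN.sγ hN.opp₁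
  have n13 : Meet v t₁' t₃' := g₁.symm.meet hc g₃ hN.sβ hN.sα hN.sγ hN.opp₂
  have n23 : Meet v t₂' t₃' := g₂.symm.meet hc g₃.symm hN.sγ hN.sα hN.sβ hN.opp₃
  have hnew : ∀ s ∈ ({t₁', t₂', t₃'} : Set (Tile n)), ∀ t ∈ ({t₁', t₂', t₃'} : Set (Tile n)),
      s ≠ t → Meet v s t := by
    rintro s (rfl | rfl | rfl) t (rfl | rfl | rfl) hst
    · exact absurd rfl hst
    · exact n12
    · exact n13
    · exact n12.symm
    · exact absurd rfl hst
    · exact n23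
    · exact n13.symm
    · exact n23.symm
    · exact absurd rfl hst
  refine ⟨⟨(T.tiles \ {t₁, t₂, t₃}) ∪ {t₁', t₂', t₃'}, ?_, ?_⟩, rfl⟩
  · rw [← T.covers]
    have c1 : ⋃ t ∈ ({t₁, t₂, t₃} : Set (Tile n)), t.carrier v =
        ⋃ t ∈ ({t₁', t₂', t₃'} : Set (Tile n)), t.carrier v := by
      simp only [Set.biUnion_insert, Set.biUnion_singleton]
      rw [← Set.union_assoc, ← Set.union_assoc, ← e, ← e']
    rw [Set.biUnion_union, ← c1, ← Set.biUnion_union, Set.sdiff_union_of_subset]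
    rintro s (rfl | rfl | rfl) <;> assumption
  · rintro s (hs | hs) t (ht | ht) hst
    · exact T.meets s hs.1 t ht.1 hst
    · exact hold s hs t ht
    · exact (hold t ht s hs).symm
    · exact hnew s hs t ht hst

/-- The hexagon of three tiles can be flipped. -/
theorem exists_isFlip (hc : General v) (T : Tiling v a) {i j k : Fin n} (hij : i < j) (hjk : j < k)
    {α β γ : ℝ} (hH : IsHex v i j k α β γ) {o : Plane} {t₁ t₂ t₃ : Tile n}
    (f₁ : Fits v t₁ o α i β j) (f₂ : Fits v t₂ o α i γ k) (f₃ : Fits v t₃ o β j γ k)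
    (h₁ : t₁ ∈ T.tiles) (h₂ : t₂ ∈ T.tiles) (h₃ : t₃ ∈ T.tiles) :
    ∃ T' : Tiling v a, IsFlip T T' ∧ ∃ t₁' t₂' t₃', Fits v t₁' (o + γ • v k) α i β j ∧
      Fits v t₂' (o + β • v j) α i γ k ∧ Fits v t₃' (o + α • v i) β j γ k ∧
      T'.tiles = (T.tiles \ {t₁, t₂, t₃}) ∪ {t₁', t₂', t₃'} := by
  have f₁' := f₁.rotate (k := k) γ
  have f₂' := f₂.rotate (k := j) β
  have f₃' := f₃.rotate (k := i) α
  set q := o + ((α - 1) / 2) • v i + ((β - 1) / 2) • v j + ((γ - 1) / 2) • v k with hq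
  have e₂ : o + ((α - 1) / 2) • v i + ((γ - 1) / 2) • v k + ((β - 1) / 2) • v j +
      (1 / 2 : ℝ) • (v i + v k + v j) = q + (1 / 2 : ℝ) • (v i + v j + v k) := by
    rw [hq]; module
  have e₃ : o + ((β - 1) / 2) • v j + ((γ - 1) / 2) • v k + ((α - 1) / 2) • v i +
      (1 / 2 : ℝ) • (v j + v k + v i) = q + (1 / 2 : ℝ) • (v i + v j + v k) := by
    rw [hq]; module
  rw [e₂] at f₂'
  rw [e₃] at f₃'
  obtain ⟨T', hT'⟩ := exists_flipped hc T hH f₁ f₂ f₃ f₁' f₂' f₃' h₁ h₂ h₃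
  refine ⟨T', ⟨i, j, k, hij, hjk, q, t₁.base, t₂.base, t₃.base, ?_⟩, _, _, _, f₁', f₂', f₃', hT'⟩
  simp only
  rw [← f₁.eq_mk hij, ← f₂.eq_mk (hij.trans hjk), ← f₃.eq_mk hjk]
  refine ⟨h₁, h₂, h₃, ?_, hT'⟩
  obtain ⟨c₁, c₂, c₃, p₁, p₂, p₃, hrel⟩ := hH.relation
  rw [hq, hexagon_eq_hexSet hH.sα hH.sβ hH.sγ, hexSet_eq p₁ p₂ p₃ hrel, f₁.carrier hH.sα hH.sβ,
    f₂.carrier hH.sα hH.sγ, f₃.carrier hH.sβ hH.sγ]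

variable [Nontrivial (Fin n)]

/-! ### The hexagon of an uncrossed triangle -/

theorem exists_sign (hc : General v) {t : Tile n} {k : Fin n} (h : t.HasDir k) :
    ∃ β : ℝ, (β = 1 ∨ β = -1) ∧ 0 < cross (v k) (β • v (t.other k)) ∧
      t.base = t.lft v k + ((β - 1) / 2) • v (t.other k) ∧
      t.base = t.rgt v k + ((-β - 1) / 2) • v (t.other k) := by
  have h0 := Tile.stp_pos hc h
  unfold Tile.rgt Tile.lft Tile.stp at *
  split_ifs at * with h1
  · exact ⟨1, Or.inl rfl, by simpa using h1, by module, by module⟩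
  · exact ⟨-1, Or.inr rfl, by simpa using h0, by module, by module⟩

/-- With no line in between, the two crossings are in consecutive tiles of the ribbon of `p`. The
common edge starts at `e`, and the signs record that the tiles lie on different sides of it. -/
theorem exists_shared_edge (hc : General v) {p q r : Line a} (hpq : p.1 ≠ q.1) (hpr : p.1 ≠ r.1)
    (hqr : q.1 ≠ r.1) (hU : ∀ u, ¬ IsArr.Bt T.Before p q u r) {s t : Tile n} (s1 : T.On p s)
    (s2 : T.On q s) (t1 : T.On p t) (t2 : T.On r t) :
    ∃ (e : Plane) (β γ : ℝ), (β = 1 ∨ β = -1) ∧ (γ = 1 ∨ γ = -1) ∧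
      s.base = e + ((β - 1) / 2) • v q.1 ∧ t.base = e + ((γ - 1) / 2) • v r.1 ∧
      cross (v p.1) (β • v q.1) * cross (v p.1) (γ • v r.1) < 0 := by
  have key : ∀ {q r : Line a} {s t : Tile n}, p.1 ≠ q.1 → p.1 ≠ r.1 → T.Before p q r →
      (∀ u, ¬ IsArr.Bt T.Before p q u r) → T.On p s → T.On q s → T.On p t → T.On r t →
      ∃ (e : Plane) (β γ : ℝ), (β = 1 ∨ β = -1) ∧ (γ = 1 ∨ γ = -1) ∧
        s.base = e + ((β - 1) / 2) • v q.1 ∧ t.base = e + ((γ - 1) / 2) • v r.1 ∧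
        cross (v p.1) (β • v q.1) * cross (v p.1) (γ • v r.1) < 0 := by
    intro q r s t hpq hpr hB hU s1 s2 t1 t2
    have hr := s1.reach_rgt_of_lt hc t1 (hB.lt hc s1 s2 t1 t2)
    have he : s.rgt v p.1 = t.lft v p.1 := by
      rcases Relation.ReflTransGen.cases_head hr with h | ⟨c, ⟨u, hu, hup, hul, rfl⟩, h2⟩
      · exact h
      · exfalso
        have u1 : T.On p u := s1.next hu hup hul
        obtain ⟨w, hw, u2⟩ := exists_on_other hc u1
        have l1 := Tile.cross_lft_lt_rgt hc s1.2.1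
        have l2 := Tile.cross_lft_lt_rgt hc u1.2.1
        have l3 := Reach.le hc h2
        rw [← hul] at l1
        exact hU w (Or.inl ⟨⟨hpq.symm, hw.symm, _, _, s1, s2, u1, u2, l1⟩,
          ⟨hw.symm, hpr.symm, _, _, u1, u2, t1, t2, by linarith⟩⟩)
    obtain ⟨β, sβ, pβ, -, bβ⟩ := exists_sign hc s1.2.1
    obtain ⟨γ, sγ, pγ, bγ, -⟩ := exists_sign hc t1.2.1
    rw [s1.other hc hpq s2] at pβ bβ
    rw [t1.other hc hpr t2] at pγ bγ
    refine ⟨s.rgt v p.1, -β, γ, ?_, sγ, bβ, he ▸ bγ, ?_⟩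
    · rcases sβ with rfl | rfl <;> simp
    · rw [neg_smul, cross_neg]
      nlinarith
  have hne : q ≠ r := fun h => hqr (congrArg _ h)
  rcases Before.total T hc hpq.symm hpr.symm hne with h | h
  · exact key hpq hpr h hU s1 s2 t1 t2
  · obtain ⟨e, β, γ, h1, h2, h3, h4, h5⟩ :=
      key hpr hpq h (fun u hu => hU u hu.symm) t1 t2 s1 s2
    exact ⟨e, γ, β, h2, h1, h4, h3, by rw [mul_comm]; exact h5⟩

/-- Each side of the triangle gives a common edge of two tiles. Comparing the bases yields the
relation `hrel`, with coefficients 0 or ±1. Since `β • v q.1` and `γ • v r.1` are on different sides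
of `v p.1`, all its coefficients vanish, so the signs agree and the three edges have a common end
`o`. -/
theorem exists_hex_of_uncrossed (hc : General v) {p q r : Line a} (hpq : p.1 ≠ q.1)
    (hpr : p.1 ≠ r.1) (hqr : q.1 ≠ r.1) (hU : IsArr.Uncrossed T.Before p q r) {t₁ t₂ t₃ : Tile n}
    (p1 : T.On p t₁) (q1 : T.On q t₁) (p2 : T.On p t₂) (r2 : T.On r t₂) (q3 : T.On q t₃)
    (r3 : T.On r t₃) : ∃ (o : Plane) (α β γ : ℝ), IsHex v p.1 q.1 r.1 α β γ ∧
      Fits v t₁ o α p.1 β q.1 ∧ Fits v t₂ o α p.1 γ r.1 ∧ Fits v t₃ o β q.1 γ r.1 := by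
  obtain ⟨e, β, γ, sβ, sγ, b1, b2, op⟩ := exists_shared_edge hc hpq hpr hqr hU.1 p1 q1 p2 r2
  obtain ⟨f, α, γ', sα, sγ', b1', b3, oq⟩ :=
    exists_shared_edge hc hpq.symm hqr hpr hU.2.1 q1 p1 q3 r3
  obtain ⟨g, α', β', sα', sβ', b2', b3', or⟩ :=
    exists_shared_edge hc hpr.symm hqr.symm hpq hU.2.2 r2 p2 r3 q3
  have hrel : ((α' - α) / 2) • v p.1 + ((β - β') / 2) • v q.1 + ((γ' - γ) / 2) • v r.1 = 0 := by
    have h1 := b1.symm.trans b1'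
    have h2 := b2.symm.trans b2'
    have h3 := b3.symm.trans b3'
    have : ((α' - α) / 2) • v p.1 + ((β - β') / 2) • v q.1 + ((γ' - γ) / 2) • v r.1 =
        ((e + ((β - 1) / 2) • v q.1) - (f + ((α - 1) / 2) • v p.1)) -
        ((e + ((γ - 1) / 2) • v r.1) - (g + ((α' - 1) / 2) • v p.1)) +
        ((f + ((γ' - 1) / 2) • v r.1) - (g + ((β' - 1) / 2) • v q.1)) := by module
    rw [this, h1, h2, h3]
    abel
  have n2 := hc _ _ hpq
  have n3 := hc _ _ hpr
  have n0 : v p.1 ≠ 0 := hc.ne_zero _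
  have hx := congrArg (cross (v p.1)) hrel
  simp only [cross_add, cross_smul, cross_self, cross_zero, mul_zero, zero_add] at hx op
  have hβ : β' = β := by
    by_contra hne
    have e1 : β' = -β := by
      rcases sβ with rfl | rfl <;> rcases sβ' with rfl | rfl <;> first | exact absurd rfl hne | norm_num
    rw [e1] at hx
    have hγne : γ' ≠ γ := by
      rintro rfl
      have : β * cross (v p.1) (v q.1) = 0 := by linarith
      rcases mul_eq_zero.1 this with h | h
      · rcases sβ with rfl | rfl <;> norm_num at h
      · exact n2 h
    have e2 : γ' = -γ := by
      rcases sγ with rfl | rfl <;> rcases sγ' with rfl | rfl <;>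
        first | exact absurd rfl hγne | norm_num
    rw [e2] at hx
    have : β * cross (v p.1) (v q.1) = γ * cross (v p.1) (v r.1) := by linarith
    rw [this] at op
    exact absurd op (not_lt.2 (mul_self_nonneg _))
  subst hβ
  have hγ : γ' = γ := by
    have : (γ' - γ) / 2 * cross (v p.1) (v r.1) = 0 := by linarith
    have := (mul_eq_zero.1 this).resolve_right n3
    linarith
  subst hγ
  have hα : α' = α := by
    simp only [sub_self, zero_div, zero_smul, add_zero] at hrel
    have := (smul_eq_zero.1 hrel).resolve_right n0
    linarith
  subst hα
  refine ⟨e - ((α' - 1) / 2) • v p.1, α', β', γ', ⟨sα, sβ, sγ, ?_, oq, or⟩,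
    ⟨p1.2.1, p1.other hc hpq q1, ?_⟩, ⟨p2.2.1, p2.other hc hpr r2, ?_⟩,
    ⟨q3.2.1, q3.other hc hqr r3, ?_⟩⟩
  · simpa only [cross_smul] using op
  · rw [b1]; abel
  · rw [b2]; abel
  · have hf : f = e + ((β' - 1) / 2) • v q.1 - ((α' - 1) / 2) • v p.1 := by
      rw [← b1, b1']; abel
    rw [b3, hf]; abel

/-! ### Flips and inverted triangles -/

theorem isInverted_iff_sign (hc : General v) {t : Triple a} :
    IsInverted T T' t ↔ ¬ (IsPositive T t ↔ IsPositive T' t) := by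
  simp only [IsInverted, isTriangle hc, true_and]

theorem isInverted_comm (hc : General v) {t : Triple a} : IsInverted T T' t ↔ IsInverted T' T t := by
  rw [isInverted_iff_sign hc, isInverted_iff_sign hc]
  tauto

theorem triple_unique (hc : General v) {i j k : Fin n} (hij : i < j) (hjk : j < k) {t₁ t₂ : Tile n}
    (d₁ : ∀ d, t₁.HasDir d ↔ d = i ∨ d = j) (d₂ : ∀ d, t₂.HasDir d ↔ d = i ∨ d = k)
    {s t : Triple a} (hs : T.On s.l₁ t₁ ∧ T.On s.l₂ t₁ ∧ T.On s.l₃ t₂)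
    (ht : T.On t.l₁ t₁ ∧ T.On t.l₂ t₁ ∧ T.On t.l₃ t₂) : s = t := by
  have key : ∀ {s : Triple a}, T.On s.l₁ t₁ ∧ T.On s.l₂ t₁ ∧ T.On s.l₃ t₂ →
      s.l₁.1 = i ∧ s.l₂.1 = j ∧ s.l₃.1 = k := by
    rintro s ⟨h1, h2, h3⟩
    have e1 := (d₁ _).1 h1.2.1
    have e2 := (d₁ _).1 h2.2.1
    have e3 := (d₂ _).1 h3.2.1
    have := s.lt₁₂
    have := s.lt₂₃
    rcases e1 with e1 | e1 <;> rcases e2 with e2 | e2 <;> rcases e3 with e3 | e3 <;> omega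
  obtain ⟨a1, a2, a3⟩ := key hs
  obtain ⟨b1, b2, b3⟩ := key ht
  ext1
  · exact hs.1.eq_of_fst_eq hc ht.1 (a1.trans b1.symm)
  · exact hs.2.1.eq_of_fst_eq hc ht.2.1 (a2.trans b2.symm)
  · exact hs.2.2.eq_of_fst_eq hc ht.2.2 (a3.trans b3.symm)

/-- `IsFlip` prescribes only the union of the three tiles. Their positions are recovered by
`exists_hex_of_union`, and then the tiles determine the lines of an inverted triangle. -/
theorem inverted_subsingleton (hc : General v) (h : IsFlip T T') :
    {t : Triple a | IsInverted T T' t}.Subsingleton := by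
  obtain ⟨i, j, k, hij, hjk, q, p₁, p₂, p₃, h₁, h₂, h₃, hU, hT'⟩ := h
  have hik := hij.trans hjk
  obtain ⟨o, α, β, γ, hH, hq, f₁, f₂, f₃⟩ := exists_hex_of_union hc hij.ne hik.ne hjk.ne
    ⟨Or.inl rfl, Or.inr rfl⟩ ⟨Or.inl rfl, Or.inr rfl⟩ ⟨Or.inl rfl, Or.inr rfl⟩ hU
  have f₁' := f₁.rotate (k := k) γ
  have f₂' := f₂.rotate (k := j) β
  have f₃' := f₃.rotate (k := i) α
  have e₂ : o + ((α - 1) / 2) • v i + ((γ - 1) / 2) • v k + ((β - 1) / 2) • v j +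
      (1 / 2 : ℝ) • (v i + v k + v j) = q + (1 / 2 : ℝ) • (v i + v j + v k) := by
    rw [hq]; module
  have e₃ : o + ((β - 1) / 2) • v j + ((γ - 1) / 2) • v k + ((α - 1) / 2) • v i +
      (1 / 2 : ℝ) • (v j + v k + v i) = q + (1 / 2 : ℝ) • (v i + v j + v k) := by
    rw [hq]; module
  rw [← hq] at f₁'
  rw [e₂] at f₂'
  rw [e₃] at f₃'
  intro s hs t ht
  have := on_of_inv_of_hex hc hij hjk hH f₁ f₂ f₃ f₁' f₂' f₃' h₁ h₂ h₃ hT' hs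
  have := on_of_inv_of_hex hc hij hjk hH f₁ f₂ f₃ f₁' f₂' f₃' h₁ h₂ h₃ hT' ht
  refine triple_unique hc hij hjk (fun d => f₁.hasDir_iff) (fun d => f₂.hasDir_iff) ?_ this
  assumption

theorem exists_isInverted_of_ne (hc : General v) (h : T ≠ T') : ∃ t : Triple a, IsInverted T T' t := by
  by_contra hn
  refine h (eq_of_not_inv hc fun l m r hI => hn ?_)
  obtain ⟨t, ht⟩ := exists_sorted_triple (Inv T T') (Inv.swap₁ hc) (Inv.swap₂ hc) hI.1.1 hI.1.2.1
    hI.1.2.2 hI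
  exact ⟨t, (isInverted_iff hc).2 (ht.swap₂ hc)⟩

/-- A triangle that no line crosses can be flipped. -/
theorem exists_flip_of_uncrossed (hc : General v) {t : Triple a}
    (hU : IsArr.Uncrossed T.Before t.l₁ t.l₂ t.l₃) :
    ∃ T' : Tiling v a, IsFlip T T' ∧ T ≠ T' ∧ IsInverted T T' t := by
  have h12 := t.lt₁₂.ne
  have h23 := t.lt₂₃.ne
  have h13 := (t.lt₁₂.trans t.lt₂₃).ne
  obtain ⟨t₁, p1, q1⟩ := T.exists_cross hc h12
  obtain ⟨t₂, p2, r2⟩ := T.exists_cross hc h13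
  obtain ⟨t₃, q3, r3⟩ := T.exists_cross hc h23
  obtain ⟨o, α, β, γ, hH, f₁, f₂, f₃⟩ :=
    exists_hex_of_uncrossed hc h12 h13 h23 hU p1 q1 p2 r2 q3 r3
  obtain ⟨T', hF, t₁', t₂', t₃', f₁', f₂', f₃', hT'⟩ :=
    exists_isFlip hc T t.lt₁₂ t.lt₂₃ hH f₁ f₂ f₃ p1.1 p2.1 q3.1
  have hne : T ≠ T' := by
    intro h
    have hm : t₁ ∈ T'.tiles := h ▸ p1.1
    rw [hT'] at hm
    rcases hm with hm | hm | hm | hm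
    · exact hm.2 (Or.inl rfl)
    · have hb := f₁'.base
      rw [← hm, f₁.base] at hb
      have h0 : γ • v t.l₃.1 = 0 := by
        rw [add_right_comm o (γ • v _), add_right_comm _ (γ • v _)] at hb
        exact left_eq_add.1 hb
      rcases smul_eq_zero.1 h0 with h | h
      · rcases hH.sγ with rfl | rfl <;> norm_num at h
      · exact hc.ne_zero _ h
    · rw [hm] at f₁
      rcases f₁.hasDir_iff.1 (f₂'.hasDir_iff.2 (Or.inr rfl)) with h | h
      · exact h13 h.symm
      · exact h23 h.symm
    · rw [Set.mem_singleton_iff.1 hm] at f₁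
      rcases f₁.hasDir_iff.1 (f₃'.hasDir_iff.2 (Or.inr rfl)) with h | h
      · exact h13 h.symm
      · exact h23 h.symm
  refine ⟨T', hF, hne, ?_⟩
  -- That `t` is inverted needs no computation: the tilings differ, so some triangle is inverted,
  -- and `t` is the only candidate.
  obtain ⟨s, hs⟩ := exists_isInverted_of_ne hc hne
  have := on_of_inv_of_hex hc t.lt₁₂ t.lt₂₃ hH f₁ f₂ f₃ f₁' f₂' f₃' p1.1 p2.1 q3.1 hT' hs
  rwa [← triple_unique hc t.lt₁₂ t.lt₂₃ (fun d => f₁.hasDir_iff) (fun d => f₂.hasDir_iff) this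
    ⟨p1, q1, r2⟩]

/-! ### The flip-distance -/

theorem finite_triple : Finite (Triple a) :=
  Finite.of_injective (fun t : Triple a => (t.l₁, t.l₂, t.l₃)) fun s t h => by
    simp only [Prod.mk.injEq] at h
    exact Triple.ext h.1 h.2.1 h.2.2

/-- A sign that differs at the two ends of a walk differs across one of its edges, and an edge,
being a flip in one direction or the other, changes at most one sign. -/
theorem hammingDist_le_flipDist (hc : General v) (T T' : Tiling v a) :
    hammingDist T T' ≤ flipDist T T' := by
  have key : ∀ {T T' : Tiling v a} (p : (tilingSpace v a).Walk T T'),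
      hammingDist T T' ≤ p.length := by
    intro T T' p
    induction p with
    | @nil T =>
      have : {t : Triple a | IsInverted T T t} = ∅ :=
        Set.eq_empty_iff_forall_notMem.2 fun t ht => ht.2.2 Iff.rfl
      rw [hammingDist, this]
      simp
    | @cons T T₁ T' h p ih =>
      have hsub : {t : Triple a | IsInverted T T' t} ⊆
          {t : Triple a | IsInverted T T₁ t} ∪ {t : Triple a | IsInverted T₁ T' t} := by
        intro t ht
        simp only [Set.mem_union, Set.mem_ofPred_eq, isInverted_iff_sign hc] at *
        tauto
      have h1 : {t : Triple a | IsInverted T T₁ t}.encard ≤ 1 := by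
        rw [Set.encard_le_one_iff_subsingleton]
        rw [tilingSpace, SimpleGraph.fromRel_adj] at h
        rcases h.2 with h | h
        · exact inverted_subsingleton hc h
        · intro s hs t ht
          exact inverted_subsingleton hc h ((isInverted_comm hc).1 hs) ((isInverted_comm hc).1 ht)
      calc hammingDist T T' ≤ _ := Set.encard_le_encard hsub
        _ ≤ _ := Set.encard_union_le _ _
        _ ≤ 1 + p.length := add_le_add h1 ih
        _ = _ := by rw [SimpleGraph.Walk.length_cons, add_comm]; push_cast; rfl
  unfold flipDist
  by_cases h : (tilingSpace v a).edist T T' = ⊤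
  · rw [h]; exact le_top
  · obtain ⟨p, hp⟩ := SimpleGraph.exists_walk_of_edist_ne_top h
    rw [← hp]
    exact key p

/-- Induction on the finite number of inverted triangles: flipping an uncrossed one changes its sign
and no other, so it lowers the number by one. -/
theorem flipDist_le_hammingDist {v : Fin 4 → Plane} {a : Fin 4 → ℕ} (hc : General v)
    (T T' : Tiling v a) : flipDist T T' ≤ hammingDist T T' := by
  have := finite_triple (a := a)
  induction hN : {t : Triple a | IsInverted T T' t}.ncard using Nat.strong_induction_on
    generalizing T with
  | _ N ih =>
    by_cases hne : T = T'
    · subst hne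
      rw [flipDist, SimpleGraph.edist_self]
      exact zero_le
    obtain ⟨s, hs⟩ := exists_isInverted_of_ne hc hne
    obtain ⟨t, ht, hU⟩ := exists_uncrossed hc ((isInverted_iff hc).1 hs)
    obtain ⟨T₁, hF, hne₁, hI⟩ := exists_flip_of_uncrossed hc hU
    have hset : {t : Triple a | IsInverted T T' t} =
        insert t {t : Triple a | IsInverted T₁ T' t} := by
      ext s
      by_cases hst : s = t
      · subst hst
        exact iff_of_true ht (Or.inl rfl)
      have hn : ¬ IsInverted T T₁ s := fun h => hst (inverted_subsingleton hc hF h hI)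
      simp only [Set.mem_insert_iff, hst, false_or, Set.mem_ofPred_eq]
      rw [isInverted_iff_sign hc] at *
      rw [isInverted_iff_sign hc, not_not.1 hn]
    have hnot : t ∉ {t : Triple a | IsInverted T₁ T' t} := by
      intro h
      simp only [Set.mem_ofPred_eq] at h
      rw [isInverted_iff_sign hc] at ht hI h
      tauto
    have hlt : {t : Triple a | IsInverted T₁ T' t}.ncard < N := by
      rw [← hN, hset, Set.ncard_insert_of_notMem hnot]
      exact Nat.lt_succ_self _
    have h1 : (tilingSpace v a).edist T T₁ = 1 := by
      rw [SimpleGraph.edist_eq_one_iff_adj, tilingSpace, SimpleGraph.fromRel_adj]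
      exact ⟨hne₁, Or.inl hF⟩
    calc flipDist T T' ≤ (tilingSpace v a).edist T T₁ + flipDist T₁ T' :=
          SimpleGraph.edist_triangle
      _ ≤ 1 + hammingDist T₁ T' := by rw [h1]; exact add_le_add_right (ih _ hlt T₁ rfl) _
      _ = hammingDist T T' := by
        rw [hammingDist, hammingDist, hset, Set.encard_insert_of_notMem hnot, add_comm]

end Tiling
end RhombusTiling

end

theorem mainTheorem3
    (v : Fin 4 → Plane) (hunit : ∀ k, ‖v k‖ = 1)
    (hv : ∀ i j, i ≠ j → LinearIndependent ℝ ![v i, v j])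
    (a : Fin 4 → ℕ) (ha : ∀ k, 1 ≤ a k) :
    (∀ T T' : RhombusTiling.Tiling v a, T ≠ T' →
      (∃ t, RhombusTiling.IsMinimalTriangle T t ∧ RhombusTiling.IsInverted T T' t) ∧
      (∃ t, RhombusTiling.IsMinimalTriangle T' t ∧ RhombusTiling.IsInverted T T' t)) ∧
    (∀ T T' : RhombusTiling.Tiling v a,
      RhombusTiling.flipDist T T' = RhombusTiling.hammingDist T T') := by
  have hc : RhombusTiling.General v := fun i j hij =>
    RhombusTiling.cross_ne_zero_of_linearIndependent (hv i j hij)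
  have key : ∀ T T' : RhombusTiling.Tiling v a, T ≠ T' →
      ∃ t, RhombusTiling.IsMinimalTriangle T t ∧ RhombusTiling.IsInverted T T' t := by
    intro T T' hne
    obtain ⟨s, hs⟩ := RhombusTiling.Tiling.exists_isInverted_of_ne hc hne
    obtain ⟨t, ht, hU⟩ := RhombusTiling.Tiling.exists_uncrossed hc
      ((RhombusTiling.Tiling.isInverted_iff hc).1 hs)
    exact ⟨t, RhombusTiling.Tiling.isMinimalTriangle_of_uncrossed hc hU, ht⟩
  refine ⟨fun T T' hne => ⟨key T T' hne, ?_⟩, fun T T' => le_antisymm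
    (RhombusTiling.Tiling.flipDist_le_hammingDist hc T T')
    (RhombusTiling.Tiling.hammingDist_le_flipDist hc T T')⟩
  obtain ⟨t, ht, hi⟩ := key T' T hne.symm
  exact ⟨t, ht, (RhombusTiling.Tiling.isInverted_comm hc).1 hi⟩
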